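/- A triangulated torus $T$ is a finite (abstract) simplicial complex that is a triangulation of the 2-torus, i.e. a connected closed orientable triangulated surface of Euler characteristic $0$. A cycle of $T$ is a simple closed curve in its 1-skeleton, without orientation; its length is its number of edges; it is called non-separating if it does not bound a disc in $T$. For a non-separating cycle $M$ of $T$ let $k_M$ be the length of a shortest non-separating cycle of $T$ that is not (freely) homotopic to $M$ in $T$ as an unoriented closed curve. The combinatorial stick number $s(T)$ is the maximum of $k_M$ over all non-separating cycles $M$ of $T$. The triangulated torus $T$ is of type $m\times k$ if $m$ is the length of a shortest non-separating cycle of $T$ and $s(T)=k$; thus it is of type $3\times k$ if and only if it has a non-separating cycle of length $3$ (an empty triangle) and $s(T)=k$, and then $k\geq 3$. Theorem. Every triangulated torus of type $3\times k$ has at least $3k-2$ vertices. Moreover, for every integer $k\geq 3$ there is, up to isomorphism of simplicial complexes, exactly one triangulated torus of type $3\times k$ with $3k-2$ vertices. -/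

import Mathlib

namespace TorusTriangulation

/-- The number of vertices minus the number of edges plus the number of triangles in a family
of simplices of dimension at most two. -/
noncomputable def eulerChar {V : Type*} (F : Set (Finset V)) : ℤ :=
  ({s ∈ F | s.card = 1}.ncard : ℤ) - ({s ∈ F | s.card = 2}.ncard : ℤ)
    + ({s ∈ F | s.card = 3}.ncard : ℤ)

/-- Two vertices are adjacent if they span an edge of `K`. -/
def Adj {V : Type*} [DecidableEq V] (K : AbstractSimplicialComplex V) (a b : V) : Prop :=
  a ≠ b ∧ {a, b} ∈ K.faces

/-- `a`, `b`, `c` are the three distinct vertices of a triangle of `K`. -/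
def IsTriangle {V : Type*} [DecidableEq V] (K : AbstractSimplicialComplex V)
    (a b c : V) : Prop :=
  a ≠ b ∧ b ≠ c ∧ a ≠ c ∧ {a, b, c} ∈ K.faces

/-- A coherent orientation: every triangle is given exactly one of its two cyclic orders
(`O a b c` says that `a → b → c → a` is the chosen one), and two distinct triangles with a common
edge induce opposite directions on it. -/
structure IsOrientation {V : Type*} [DecidableEq V] (K : AbstractSimplicialComplex V)
    (O : V → V → V → Prop) : Prop where
  triangle : ∀ a b c, O a b c → IsTriangle K a b c
  rotate : ∀ a b c, O a b c → O b c a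
  exactly_one : ∀ a b c, IsTriangle K a b c → Xor (O a b c) (O b a c)
  coherent : ∀ a b c d, O a b c → O a b d → c = d

/-- `K` is a triangulated torus: a finite simplicial complex which is a connected closed
surface (pure of dimension two, every edge in exactly two triangles, every vertex link connected
and hence a circle), is orientable, and has Euler characteristic `0`. The vertex set of `K` is
all of `V`. -/
structure IsTriangulatedTorus {V : Type*} [DecidableEq V]
    (K : AbstractSimplicialComplex V) : Prop where
  finite : Finite V
  nonempty : Nonempty V
  card_le : ∀ s ∈ K.faces, s.card ≤ 3
  pure : ∀ s ∈ K.faces, ∃ t ∈ K.faces, s ⊆ t ∧ t.card = 3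
  edge : ∀ e ∈ K.faces, e.card = 2 → {t ∈ K.faces | e ⊆ t ∧ t.card = 3}.ncard = 2
  link : ∀ v a b, Adj K v a → Adj K v b → Relation.ReflTransGen (IsTriangle K v) a b
  connected : ∀ a b, Relation.ReflTransGen (Adj K) a b
  orientable : ∃ O : V → V → V → Prop, IsOrientation K O
  euler : eulerChar K.faces = 0

/-- `K` and `L` are isomorphic simplicial complexes. -/
def Isomorphic {V W : Type*} (K : AbstractSimplicialComplex V)
    (L : AbstractSimplicialComplex W) : Prop :=
  ∃ e : V ≃ W, ∀ s : Finset V, s ∈ K.faces ↔ s.map e.toEmbedding ∈ L.faces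

/-- A cycle of `K`, i.e. a simple closed curve in the 1-skeleton, given by the cyclic sequence of
its vertices. Its length, the number of its edges, is `c.length`. -/
def IsCycle {V : Type*} [DecidableEq V] (K : AbstractSimplicialComplex V) (c : Cycle V) : Prop :=
  c.Nodup ∧ 3 ≤ c.length ∧ c.Chain (Adj K)

/-- The edges between consecutive vertices of a cyclic sequence. -/
def cycleEdges {V : Type*} [DecidableEq V] (c : Cycle V) : Set (Finset V) :=
  {e | ∃ (a b : V) (l : List V), c = ((a :: b :: l : List V) : Cycle V) ∧ e = {a, b}}

/-- `c` bounds a disc: some set `D` of triangles of `K` is connected through common edges, has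
Euler characteristic `1` (together with the edges and vertices of its triangles), and its boundary
edges, those in exactly one triangle of `D`, are the edges of `c`. If `K` is a closed surface and
`c` is a cycle, then `D` is a surface with boundary `c`, so these conditions say that `D` is a
disc. -/
def BoundsDisc {V : Type*} [DecidableEq V] (K : AbstractSimplicialComplex V)
    (c : Cycle V) : Prop :=
  ∃ D : Set (Finset V),
    (∀ t ∈ D, t ∈ K.faces ∧ t.card = 3) ∧
    (∀ s ∈ D, ∀ t ∈ D,
      Relation.ReflTransGen (fun x y => x ∈ D ∧ y ∈ D ∧ (x ∩ y).card = 2) s t) ∧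
    eulerChar {s | s.Nonempty ∧ ∃ t ∈ D, s ⊆ t} = 1 ∧
    {e : Finset V | e.card = 2 ∧ {t ∈ D | e ⊆ t}.ncard = 1} = cycleEdges c

/-- A non-separating cycle: a cycle which does not bound a disc. -/
def IsNonSeparating {V : Type*} [DecidableEq V] (K : AbstractSimplicialComplex V)
    (c : Cycle V) : Prop :=
  IsCycle K c ∧ ¬ BoundsDisc K c

/-- An elementary homotopy of closed edge paths: a vertex `b` between `a` and `c` is left out,
where `a`, `b`, `c` (not necessarily distinct) span a simplex of `K`. -/
inductive HomotopyStep {V : Type*} [DecidableEq V] (K : AbstractSimplicialComplex V) :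
    Cycle V → Cycle V → Prop
  | skip (a b c : V) (l : List V) (h : {a, b, c} ∈ K.faces) :
      HomotopyStep K ((a :: b :: c :: l : List V) : Cycle V) ((a :: c :: l : List V) : Cycle V)

/-- Two cycles are homotopic: one of them can be deformed into the other, or into the other run
backwards (cycles carry no orientation), by elementary homotopies and their inverses. -/
def Homotopic {V : Type*} [DecidableEq V] (K : AbstractSimplicialComplex V)
    (M N : Cycle V) : Prop :=
  Relation.EqvGen (HomotopyStep K) M N ∨ Relation.EqvGen (HomotopyStep K) M N.reverse

/-- `k` is the length of a shortest non-separating cycle that is not homotopic to `M`. -/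
def IsShortestNotHomotopic {V : Type*} [DecidableEq V] (K : AbstractSimplicialComplex V)
    (M : Cycle V) (k : ℕ) : Prop :=
  IsLeast {l | ∃ N, IsNonSeparating K N ∧ ¬ Homotopic K M N ∧ N.length = l} k

/-- `k` is the combinatorial stick number of `K`. -/
def IsCombStickNumber {V : Type*} [DecidableEq V] (K : AbstractSimplicialComplex V)
    (k : ℕ) : Prop :=
  IsGreatest {j | ∃ M, IsNonSeparating K M ∧ IsShortestNotHomotopic K M j} k

/-- `K` is of type `m × k`: `m` is the length of a shortest non-separating cycle and `k` is the
combinatorial stick number. -/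
def HasType {V : Type*} [DecidableEq V] (K : AbstractSimplicialComplex V) (m k : ℕ) : Prop :=
  IsLeast {l | ∃ N, IsNonSeparating K N ∧ N.length = l} m ∧ IsCombStickNumber K k

end TorusTriangulation

/-!
The empty triangle of a torus of type `3 × k` is studied through its dual cocycle `η`, which counts
the edges that leave the triangle on its left. As a cocycle vanishes on the boundary of every disc
and is invariant under homotopy, a closed walk on which `η` does not vanish contains a
non-separating cycle that is not homotopic to the empty triangle. Hence such walks have length at
least `k` (`HasType.exists_isCut`). That the dual cocycle is not a coboundary, if the triangle bounds
no disc, rests on the criterion `boundsDisc_of_chain`: a cycle which is the boundary of a 2-chain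
modulo `m ≠ 1` bounds a disc. There, the cycle cuts the torus into two connected parts whose Euler
characteristics add up to `0`, are odd (`IsRegion.odd_euler`, by comparing the signs of the
permutations of the darts that define faces, edges and vertices) and are at most `1`
(`IsRegion.euler_le`, by collapsing), so that one part is a disc.

*Lower bound.* The layers of vertices at distance `2, …, k - 2` on the left of the triangle, as seen
from one of its vertices `a`, are disjoint from each other, from the triangle and from the neighbours
of `a`. Each layer carries a cocycle that is cohomologous to `η`, so it has at least three vertices
(`three_le_ncard`). Hence `l + r + 3 k ≤ n + 6`, if `a` has `l` neighbours on the left and `r` on the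
right (`IsCutTriple.degree_le`). As the three vertices of an empty triangle have together at least
six neighbours on each side (`IsCutTriple.six_le`), this gives `n ≥ 3 k - 2`.

*Uniqueness.* For `n = 3 k - 2` all these estimates are sharp. The vertices of the triangle then have
`1`, `2` and `3` neighbours on the left (`IsCutTriple.exists_one_two_three`), and moving the triangle
across the two triangles at its first vertex gives an empty triangle with the same property. The
vertices `x t` that appear in this way satisfy a recursion of period `n`: a walk from `x i` to `x j`
with steps of length three has nonzero period if `x i = x j`, so that it has at least `k` steps
(`IsUnrolling.le_of_eq`). Thus the vertices are numbered by `ZMod n` such that `i, i + 1, i + 3` and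
`i, i + 2, i + 3` are triangles, and there are no others since these already form a closed surface.

*Existence.* In the torus on `ZMod n` with these triangles, a closed walk of length less than `k`
lifts to a path in the triangular lattice `ℤ × ℤ` whose end point is `(-2 q, q)`. The lattice being
simply connected, the walk is homotopic to the one that runs `q` times around the triangle
`v, v + 2, v + 1`. If it is a cycle and `q ≠ ±1`, then it bounds a disc by the criterion above with
`m = |q|` (`homotopic_base`). So all short non-separating cycles are homotopic to the empty triangle
`0, 1, 2`, while the closed walk `0, 3, …, 3 k - 3` is not.
-/

namespace TorusTriangulation

variable {V : Type*} [DecidableEq V] {K : AbstractSimplicialComplex V} {O : V → V → V → Prop}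

/-! ### Oriented surfaces and vertex links -/

theorem faces_of_subset {s t : Finset V} (hs : s ∈ K.faces) (ht : t ⊆ s) (hn : t.Nonempty) :
    t ∈ K.faces :=
  (K.isRelLowerSet_faces hs).2 ht hn

theorem Adj.symm {a b : V} (h : Adj K a b) : Adj K b a :=
  ⟨h.1.symm, by rw [Finset.pair_comm]; exact h.2⟩

theorem IsTriangle.rotate {a b c : V} (h : IsTriangle K a b c) : IsTriangle K b c a := by
  obtain ⟨h1, h2, h3, h4⟩ := h
  refine ⟨h2, h3.symm, h1.symm, ?_⟩
  convert h4 using 1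
  ext x; simp; tauto

theorem IsTriangle.swap {a b c : V} (h : IsTriangle K a b c) : IsTriangle K b a c := by
  obtain ⟨h1, h2, h3, h4⟩ := h
  refine ⟨h1.symm, h3, h2, ?_⟩
  convert h4 using 1
  ext x; simp; tauto

theorem IsTriangle.adj {a b c : V} (h : IsTriangle K a b c) : Adj K a b :=
  ⟨h.1, faces_of_subset h.2.2.2 (by intro x; simp; tauto) (by simp)⟩

theorem IsOrientation.tri (hO : IsOrientation K O) {a b c : V} (h : O a b c) :
    IsTriangle K a b c := hO.triangle a b c h

theorem IsOrientation.rot (hO : IsOrientation K O) {a b c : V} (h : O a b c) : O b c a :=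
  hO.rotate a b c h

theorem IsOrientation.uniq (hO : IsOrientation K O) {a b c d : V} (h : O a b c) (h' : O a b d) :
    c = d := hO.coherent a b c d h h'

theorem IsOrientation.or (hO : IsOrientation K O) {a b c : V} (h : IsTriangle K a b c) :
    O a b c ∨ O b a c := by
  rcases hO.exactly_one a b c h with h | h
  · exact Or.inl h.1
  · exact Or.inr h.1

theorem IsOrientation.not_both (hO : IsOrientation K O) {a b c : V} (h : O a b c)
    (h' : O b a c) : False := by
  rcases hO.exactly_one a b c (hO.tri h) with ⟨_, h2⟩ | ⟨_, h2⟩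
  · exact h2 h'
  · exact h2 h

/-- The opposite orientation. -/
theorem IsOrientation.flip (hO : IsOrientation K O) : IsOrientation K (fun a b c => O b a c) where
  triangle _ _ _ h := (hO.tri h).swap
  rotate _ _ _ h := hO.rot (hO.rot h)
  exactly_one a b c h := hO.exactly_one b a c h.swap
  coherent a b c d h h' := hO.coherent b a c d h h'

theorem exists_third {a b : V} {t : Finset V} (hab : a ≠ b) (ht : {a, b} ⊆ t) (h3 : t.card = 3) :
    ∃ c, c ≠ a ∧ c ≠ b ∧ t = {a, b, c} := by
  have h1 : (t \ {a, b}).card = 1 := by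
    rw [Finset.card_sdiff_of_subset ht, h3, Finset.card_pair hab]
  obtain ⟨c, hc⟩ := Finset.card_eq_one.mp h1
  have hc' : c ∈ t \ {a, b} := by rw [hc]; simp
  simp only [Finset.mem_sdiff, Finset.mem_insert, Finset.mem_singleton, not_or] at hc'
  refine ⟨c, hc'.2.1, hc'.2.2, ?_⟩
  rw [← Finset.union_sdiff_of_subset ht, hc]
  ext x; simp

/-- Every directed edge has a triangle on its left. -/
theorem exists_left (hK : IsTriangulatedTorus K) (hO : IsOrientation K O) {a b : V}
    (h : Adj K a b) : ∃ c, O a b c := by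
  have h2 := hK.edge {a, b} h.2 (Finset.card_pair h.1)
  obtain ⟨s, t, hst, hset⟩ := Set.ncard_eq_two.mp h2
  have hs : s ∈ {t ∈ K.faces | {a, b} ⊆ t ∧ t.card = 3} := by rw [hset]; simp
  have ht : t ∈ {t ∈ K.faces | {a, b} ⊆ t ∧ t.card = 3} := by rw [hset]; simp
  obtain ⟨c, hca, hcb, rfl⟩ := exists_third h.1 hs.2.1 hs.2.2
  obtain ⟨d, hda, hdb, rfl⟩ := exists_third h.1 ht.2.1 ht.2.2
  rcases hO.or (⟨h.1, hcb.symm, hca.symm, hs.1⟩ : IsTriangle K a b c) with h1 | h1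
  · exact ⟨c, h1⟩
  rcases hO.or (⟨h.1, hdb.symm, hda.symm, ht.1⟩ : IsTriangle K a b d) with h3 | h3
  · exact ⟨d, h3⟩
  exact absurd (by rw [hO.uniq h1 h3]) hst

/-- A vertex link is a single circle: a property that passes from each neighbour to the next one
in the direction of the orientation holds for all neighbours as soon as it holds for one. -/
theorem link_forward (hK : IsTriangulatedTorus K) (hO : IsOrientation K O) {a x₀ : V}
    {P : V → Prop} (h0 : Adj K a x₀) (hx : P x₀) (step : ∀ z w, O a z w → P z → P w) :
    ∀ z, Adj K a z → P z := by
  have := hK.finite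
  -- the rotation maps the finite set of neighbours with `P` injectively to itself
  choose! ρ hρ using fun z (hz : Adj K a z) => exists_left hK hO hz
  let f : {z // Adj K a z ∧ P z} → {z // Adj K a z ∧ P z} := fun z =>
    ⟨ρ z.1, ((hO.tri (hρ z.1 z.2.1)).rotate.rotate.adj).symm, step _ _ (hρ z.1 z.2.1) z.2.2⟩
  have hf : Function.Injective f := by
    intro z w hzw
    have h1 := hρ z.1 z.2.1
    have h2 := hρ w.1 w.2.1
    have h3 : ρ z.1 = ρ w.1 := congrArg Subtype.val hzw
    rw [h3] at h1
    exact Subtype.ext (hO.uniq (hO.rot (hO.rot h1)) (hO.rot (hO.rot h2)))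
  have hs := Finite.surjective_of_injective hf
  intro z hz
  have key := hK.link a x₀ z h0 hz
  induction key with
  | refl => exact hx
  | @tail b c _ hbc ih =>
    have hb : Adj K a b := hbc.adj
    rcases hO.or hbc with h | h
    · exact step _ _ h (ih hb)
    · obtain ⟨w, hw⟩ := hs ⟨b, hb, ih hb⟩
      have h1 := hρ w.1 w.2.1
      have h3 : ρ w.1 = b := congrArg Subtype.val hw
      rw [h3] at h1
      have : w.1 = c := hO.uniq (hO.rot (hO.rot h1)) h
      exact this ▸ w.2.2

theorem link_backward (hK : IsTriangulatedTorus K) (hO : IsOrientation K O) {a x₀ : V}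
    {P : V → Prop} (h0 : Adj K a x₀) (hx : P x₀) (step : ∀ z w, O a z w → P w → P z) :
    ∀ z, Adj K a z → P z :=
  link_forward hK hO.flip h0 hx fun z w h => step w z (hO.rot h)

theorem exists_adj (hK : IsTriangulatedTorus K) (v : V) : ∃ w, Adj K v w := by
  obtain ⟨t, ht, hvt, h3⟩ := hK.pure {v} (K.singleton_mem v)
  have hv : v ∈ t := hvt (by simp)
  obtain ⟨w, hw, hwv⟩ := Finset.exists_mem_ne (by omega : 1 < t.card) v
  exact ⟨w, hwv.symm, faces_of_subset ht (by intro x; simp; rintro (rfl | rfl) <;> assumption)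
    (by simp)⟩

/-! ### Cocycles -/

/-- An integral simplicial 1-cocycle, as a function on ordered pairs of vertices. It is
antisymmetric on all pairs; its values on pairs that do not span an edge play no role. -/
structure IsCocycle (K : AbstractSimplicialComplex V) (η : V → V → ℤ) : Prop where
  antisymm : ∀ a b, η a b = - η b a
  closed : ∀ a b c, IsTriangle K a b c → η a b + η b c + η c a = 0

/-- The coboundary of a function on the vertices. -/
def cobd (f : V → ℤ) : V → V → ℤ := fun a b => f b - f a

/-- The cocycle `η` is the coboundary of a function on the vertices. -/
def IsCobd (K : AbstractSimplicialComplex V) (η : V → V → ℤ) : Prop :=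
  ∃ f : V → ℤ, ∀ a b, Adj K a b → η a b = f b - f a

theorem IsCocycle.self {η : V → V → ℤ} (h : IsCocycle K η) (a : V) : η a a = 0 := by
  have := h.antisymm a a; omega

theorem IsCocycle.sub_cobd {η : V → V → ℤ} (h : IsCocycle K η) (f : V → ℤ) :
    IsCocycle K (η - cobd f) where
  antisymm a b := by have := h.antisymm a b; simp [cobd]; omega
  closed a b c ht := by have := h.closed a b c ht; simp [cobd]; omega

theorem IsCocycle.neg {η : V → V → ℤ} (h : IsCocycle K η) : IsCocycle K (-η) where
  antisymm a b := by have := h.antisymm a b; simp; omega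
  closed a b c ht := by have := h.closed a b c ht; simp; omega

theorem IsCobd.of_sub_cobd {η : V → V → ℤ} {f : V → ℤ} (h : IsCobd K (η - cobd f)) :
    IsCobd K η := by
  obtain ⟨g, hg⟩ := h
  refine ⟨g + f, fun a b hab => ?_⟩
  have := hg a b hab
  simp [cobd] at this ⊢; omega

/-- If `η` vanishes on edges that avoid both `u` and `v`, then it is constant on the edges from
`u` to vertices other than `v`: the link of `u` without `v` is connected. -/
theorem const_on_link (hK : IsTriangulatedTorus K) {η : V → V → ℤ} (h : IsCocycle K η) (u v : V)
    (h0 : ∀ x y, Adj K x y → x ≠ u → x ≠ v → y ≠ u → y ≠ v → η x y = 0) :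
    ∃ c, ∀ z, Adj K u z → z ≠ v → η u z = c := by
  obtain ⟨O, hO⟩ := hK.orientable
  obtain ⟨x₀, hx₀, hstart⟩ : ∃ x₀, Adj K u x₀ ∧ ∀ w, O u v w → w = x₀ := by
    by_cases hv : Adj K u v
    · obtain ⟨w, hw⟩ := exists_left hK hO hv
      exact ⟨w, (hO.tri hw).rotate.rotate.adj.symm, fun w' hw' => hO.uniq hw' hw⟩
    · obtain ⟨w, hw⟩ := exists_adj hK u
      exact ⟨w, hw, fun w' hw' => absurd (hO.tri hw').adj hv⟩
  refine ⟨η u x₀, fun z hz hzv => ?_⟩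
  refine (link_forward hK hO (P := fun z => z = v ∨ η u z = η u x₀) hx₀ (Or.inr rfl) ?_ z
    hz).resolve_left hzv
  intro z w hzw hP
  by_cases hzv : z = v
  · subst hzv; right; rw [hstart w hzw]
  by_cases hwv : w = v
  · exact Or.inl hwv
  right
  have ht := hO.tri hzw
  have h1 := h0 z w ht.rotate.adj ht.1.symm hzv ht.2.2.1.symm hwv
  have h2 := h.closed u z w ht
  have h3 := h.antisymm u w
  rcases hP with hP | hP
  · exact absurd hP hzv
  · omega

/-- A cocycle supported on the edges that leave a set of at most two vertices is a coboundary. -/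
theorem isCobd_of_pair (hK : IsTriangulatedTorus K) {η : V → V → ℤ} (h : IsCocycle K η) (u v : V)
    (huv : Adj K u v → η u v = 0)
    (h0 : ∀ x y, Adj K x y → x ≠ u → x ≠ v → y ≠ u → y ≠ v → η x y = 0) : IsCobd K η := by
  obtain ⟨O, hO⟩ := hK.orientable
  obtain ⟨c, hc⟩ := const_on_link hK h u v h0
  obtain ⟨d, hd⟩ := const_on_link hK h v u
    (fun x y hxy h1 h2 h3 h4 => h0 x y hxy h2 h1 h4 h3)
  have hcd : Adj K u v → c = d := by
    intro hadj
    obtain ⟨w, hw⟩ := exists_left hK hO hadj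
    have ht := hO.tri hw
    have h1 := h.closed u v w ht
    have h2 := hc w ht.rotate.rotate.adj.symm ht.2.1.symm
    have h3 := hd w ht.rotate.adj ht.2.2.1.symm
    have h4 := huv hadj
    have h5 := h.antisymm u w
    omega
  refine ⟨fun z => if z = u then -c else if z = v then -d else 0, fun a b hab => ?_⟩
  have hanti := h.antisymm a b
  have hne := hab.1
  by_cases hau : a = u
  · subst hau
    by_cases hbv : b = v
    · subst hbv
      have := hcd hab; have := huv hab
      simp [hne.symm]; omega
    · have := hc b hab hbv
      simp [hne.symm, hbv]; omega
  by_cases hbu : b = u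
  · subst hbu
    by_cases hav : a = v
    · subst hav
      have := hcd hab.symm; have := huv hab.symm
      simp [hne]; omega
    · have := hc a hab.symm hav
      simp [hau, hav]; omega
  by_cases hav : a = v
  · subst hav
    have := hd b hab hbu
    simp [hau, hbu, hne.symm]; omega
  by_cases hbv : b = v
  · subst hbv
    have := hd a hab.symm hau
    simp [hau, hbu, hav]; omega
  · simp [hau, hav, hbu, hbv]; exact h0 a b hab hau hav hbu hbv

/-- A cocycle that vanishes on the edges inside `T` and on the edges outside `T` is a coboundary,
unless `T` has at least three vertices. -/
theorem three_le_ncard (hK : IsTriangulatedTorus K) {η : V → V → ℤ} (h : IsCocycle K η)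
    (hη : ¬ IsCobd K η) {T : Set V} (hin : ∀ x y, Adj K x y → x ∈ T → y ∈ T → η x y = 0)
    (hout : ∀ x y, Adj K x y → x ∉ T → y ∉ T → η x y = 0) : 3 ≤ T.ncard := by
  have := hK.finite
  by_contra hT
  apply hη
  have h3 : T.ncard = 0 ∨ T.ncard = 1 ∨ T.ncard = 2 := by omega
  rcases h3 with h3 | h3 | h3
  · rw [Set.ncard_eq_zero] at h3
    obtain ⟨v⟩ := hK.nonempty
    subst h3
    exact isCobd_of_pair hK h v v (fun h => absurd rfl h.1)
      (fun x y hxy _ _ _ _ => hout x y hxy (by simp) (by simp))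
  · obtain ⟨v, rfl⟩ := Set.ncard_eq_one.mp h3
    exact isCobd_of_pair hK h v v (fun h => absurd rfl h.1)
      (fun x y hxy h1 _ h2 _ => hout x y hxy (by simpa) (by simpa))
  · obtain ⟨u, v, _, rfl⟩ := Set.ncard_eq_two.mp h3
    exact isCobd_of_pair hK h u v (fun h => hin u v h (by simp) (by simp))
      (fun x y hxy h1 h2 h3 h4 => hout x y hxy (by simp [h1, h2]) (by simp [h3, h4]))

/-! ### Sums along cycles and homotopies -/

/-- The sum of `η` along the path that starts at a vertex and runs through a list. -/
def pathSum (η : V → V → ℤ) : V → List V → ℤ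
  | _, [] => 0
  | a, b :: l => η a b + pathSum η b l

/-- The sum of `η` along a closed path, given by the list of its vertices. -/
def listSum (η : V → V → ℤ) : List V → ℤ
  | [] => 0
  | a :: l => pathSum η a (l ++ [a])

theorem pathSum_append (η : V → V → ℤ) (a b : V) (l m : List V) :
    pathSum η a (l ++ b :: m) = pathSum η a (l ++ [b]) + pathSum η b m := by
  induction l generalizing a with
  | nil => simp [pathSum]
  | cons c l ih => simp only [List.cons_append, pathSum]; rw [ih]; ring

theorem listSum_append (η : V → V → ℤ) (x : V) (m l : List V) :
    listSum η (x :: m ++ x :: l) = listSum η (x :: m) + listSum η (x :: l) := by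
  simp only [List.cons_append, listSum, List.append_assoc]
  rw [pathSum_append]

theorem listSum_rotate_one (η : V → V → ℤ) (l : List V) : listSum η (l.rotate 1) = listSum η l := by
  match l with
  | [] => rfl
  | [a] => rw [List.rotate_singleton]
  | a :: b :: l =>
    simp only [List.rotate_cons_succ, List.rotate_zero, List.cons_append, listSum, pathSum,
      List.append_assoc, List.nil_append]
    rw [pathSum_append]
    simp only [pathSum]; ring

theorem listSum_isRotated (η : V → V → ℤ) {l l' : List V} (h : l ~r l') :
    listSum η l = listSum η l' := by
  obtain ⟨n, rfl⟩ := h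
  induction n with
  | zero => simp
  | succ n ih => rw [ih, ← List.rotate_rotate, listSum_rotate_one]

/-- The sum of `η` along a cycle. -/
def cycleSum (η : V → V → ℤ) (c : Cycle V) : ℤ :=
  Quotient.liftOn c (listSum η) fun _ _ h => listSum_isRotated η h

theorem cycleSum_coe (η : V → V → ℤ) (l : List V) : cycleSum η (l : Cycle V) = listSum η l := rfl

theorem pathSum_reverse {η : V → V → ℤ} (h : ∀ a b, η a b = - η b a) (a b : V) (l : List V) :
    pathSum η b (l.reverse ++ [a]) = - pathSum η a (l ++ [b]) := by
  induction l generalizing a with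
  | nil => simp [pathSum]; exact h b a
  | cons c l ih =>
    simp only [List.reverse_cons, List.append_assoc, List.cons_append, List.nil_append, pathSum]
    rw [pathSum_append, ih]
    simp only [pathSum]
    have := h c a; omega

theorem listSum_reverse {η : V → V → ℤ} (h : ∀ a b, η a b = - η b a) (l : List V) :
    listSum η l.reverse = - listSum η l := by
  match l with
  | [] => rfl
  | a :: l =>
    have h1 : listSum η (a :: l).reverse = listSum η (a :: l.reverse) := by
      apply listSum_isRotated
      rw [List.reverse_cons]
      exact (List.IsRotated.symm ⟨1, by simp⟩)
    rw [h1]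
    exact pathSum_reverse h a a l

theorem cycleSum_reverse {η : V → V → ℤ} (h : ∀ a b, η a b = - η b a) (c : Cycle V) :
    cycleSum η c.reverse = - cycleSum η c := by
  induction c using Quotient.inductionOn with
  | h l => exact listSum_reverse h l

theorem cycleSum_homotopyStep {η : V → V → ℤ} (h : IsCocycle K η) {M N : Cycle V}
    (hs : HomotopyStep K M N) : cycleSum η M = cycleSum η N := by
  obtain ⟨a, b, c, l, hf⟩ := hs
  simp only [cycleSum_coe, listSum, pathSum, List.cons_append]
  have key : η a b + η b c = η a c := by
    by_cases hab : a = b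
    · subst hab; rw [h.self]; simp
    by_cases hbc : b = c
    · subst hbc; rw [h.self]; simp
    by_cases hac : a = c
    · subst hac; rw [h.self, h.antisymm a b]; simp
    have := h.closed a b c ⟨hab, hbc, hac, hf⟩
    have := h.antisymm a c
    omega
  rw [← key]; ring

theorem cycleSum_eqvGen {η : V → V → ℤ} (h : IsCocycle K η) {M N : Cycle V}
    (hs : Relation.EqvGen (HomotopyStep K) M N) : cycleSum η M = cycleSum η N := by
  induction hs with
  | rel _ _ h' => exact cycleSum_homotopyStep h h'
  | refl => rfl
  | symm _ _ _ ih => exact ih.symm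
  | trans _ _ _ _ _ ih ih' => exact ih.trans ih'

/-- Homotopic cycles have the same period up to sign. -/
theorem cycleSum_homotopic {η : V → V → ℤ} (h : IsCocycle K η) {M N : Cycle V}
    (hs : Homotopic K M N) (h0 : cycleSum η M = 0) : cycleSum η N = 0 := by
  rcases hs with hs | hs
  · rw [← cycleSum_eqvGen h hs, h0]
  · have := cycleSum_eqvGen h hs
    rw [cycleSum_reverse h.antisymm] at this
    omega

theorem homotopyStep_reverse {M N : Cycle V} (h : HomotopyStep K M N) :
    HomotopyStep K M.reverse N.reverse := by
  obtain ⟨a, b, c, l, hf⟩ := h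
  have h1 : ((a :: b :: c :: l : List V) : Cycle V).reverse
      = ((c :: b :: a :: l.reverse : List V) : Cycle V) := by
    rw [Cycle.reverse_coe, Cycle.coe_eq_coe]
    simpa using List.isRotated_append (l := l.reverse) (l' := [c, b, a])
  have h2 : ((a :: c :: l : List V) : Cycle V).reverse
      = ((c :: a :: l.reverse : List V) : Cycle V) := by
    rw [Cycle.reverse_coe, Cycle.coe_eq_coe]
    simpa using List.isRotated_append (l := l.reverse) (l' := [c, a])
  rw [h1, h2]
  refine HomotopyStep.skip c b a l.reverse ?_
  convert hf using 1
  ext x; simp; tauto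

theorem eqvGen_reverse {M N : Cycle V} (h : Relation.EqvGen (HomotopyStep K) M N) :
    Relation.EqvGen (HomotopyStep K) M.reverse N.reverse := by
  induction h with
  | rel _ _ h' => exact .rel _ _ (homotopyStep_reverse h')
  | refl => exact .refl _
  | symm _ _ _ ih => exact ih.symm
  | trans _ _ _ _ _ ih ih' => exact ih.trans _ _ _ ih'

theorem Homotopic.symm {M N : Cycle V} (h : Homotopic K M N) : Homotopic K N M := by
  rcases h with h | h
  · exact Or.inl h.symm
  · right
    have := eqvGen_reverse h
    rw [Cycle.reverse_reverse] at this
    exact this.symm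

theorem Homotopic.trans {M N P : Cycle V} (h : Homotopic K M N) (h' : Homotopic K N P) :
    Homotopic K M P := by
  rcases h with h | h <;> rcases h' with h' | h'
  · exact Or.inl (h.trans _ _ _ h')
  · exact Or.inr (h.trans _ _ _ h')
  · exact Or.inr (h.trans _ _ _ (eqvGen_reverse h'))
  · left
    have := eqvGen_reverse h'
    rw [Cycle.reverse_reverse] at this
    exact h.trans _ _ _ this

/-! ### Cycles as closed walks -/

/-- There is a walk from `a` to `b` of the given length along which `η` has the given sum. -/
inductive WalkSum (K : AbstractSimplicialComplex V) (η : V → V → ℤ) : V → V → ℕ → ℤ → Prop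
  | nil (a : V) : WalkSum K η a a 0 0
  | cons {a b c : V} {n : ℕ} {s : ℤ} (h : Adj K a b) (w : WalkSum K η b c n s) :
      WalkSum K η a c (n + 1) (η a b + s)

theorem WalkSum.append {η : V → V → ℤ} {a b c : V} {m n : ℕ} {s t : ℤ} (h : WalkSum K η a b m s)
    (h' : WalkSum K η b c n t) : WalkSum K η a c (m + n) (s + t) := by
  induction h with
  | nil => simpa using h'
  | cons hab _ ih =>
    convert WalkSum.cons hab (ih h') using 1 <;> ring

theorem WalkSum.single {η : V → V → ℤ} {a b : V} (h : Adj K a b) : WalkSum K η a b 1 (η a b) := by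
  have := WalkSum.cons h (WalkSum.nil (η := η) b)
  simpa using this

theorem WalkSum.snoc {η : V → V → ℤ} {a b c : V} {n : ℕ} {s : ℤ} (h : WalkSum K η a b n s)
    (h' : Adj K b c) : WalkSum K η a c (n + 1) (s + η b c) := h.append (.single h')

theorem WalkSum.sub_cobd {η : V → V → ℤ} {a b : V} {n : ℕ} {s : ℤ} (h : WalkSum K η a b n s)
    (f : V → ℤ) : WalkSum K (η - cobd f) a b n (s - (f b - f a)) := by
  induction h with
  | nil => simpa using WalkSum.nil _
  | cons hab _ ih =>
    convert WalkSum.cons hab ih using 1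
    simp [cobd]; ring

theorem WalkSum.neg {η : V → V → ℤ} {a b : V} {n : ℕ} {s : ℤ} (h : WalkSum K η a b n s) :
    WalkSum K (-η) a b n (-s) := by
  induction h with
  | nil => simpa using WalkSum.nil _
  | cons hab _ ih =>
    convert WalkSum.cons hab ih using 1
    simp; ring

theorem WalkSum.exists_list {η : V → V → ℤ} {a b : V} {n : ℕ} {s : ℤ} (h : WalkSum K η a b n s)
    (hn : n ≠ 0) : ∃ l : List V, l.length + 1 = n ∧ List.IsChain (Adj K) (a :: (l ++ [b])) ∧
      pathSum η a (l ++ [b]) = s := by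
  induction h with
  | nil => exact absurd rfl hn
  | @cons a b c n s hab w ih =>
    cases w with
    | nil => exact ⟨[], rfl, by simpa using hab, by simp [pathSum]⟩
    | cons h' w' =>
      obtain ⟨l, h1, h2, h3⟩ := ih (by omega)
      exact ⟨b :: l, by simp [h1], List.isChain_cons_cons.mpr ⟨hab, h2⟩, by simp [pathSum, h3]⟩

theorem exists_eq_append_of_not_nodup {α : Type*} {l : List α} (h : ¬ l.Nodup) :
    ∃ (p m q : List α) (x : α), l = p ++ x :: m ++ x :: q := by
  induction l with
  | nil => simp at h
  | cons a l ih =>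
    by_cases ha : a ∈ l
    · obtain ⟨m, q, rfl⟩ := List.append_of_mem ha
      exact ⟨[], m, q, a, rfl⟩
    · obtain ⟨p, m, q, x, rfl⟩ := ih (fun h' => h (List.nodup_cons.mpr ⟨ha, h'⟩))
      exact ⟨a :: p, m, q, x, rfl⟩

/-- A closed path with nonzero sum contains a simple cycle with nonzero sum. -/
theorem exists_isCycle {η : V → V → ℤ} (h : ∀ a b, η a b = - η b a) (n : ℕ) : ∀ l : List V,
    l.length ≤ n → (l : Cycle V).Chain (Adj K) → listSum η l ≠ 0 →
    ∃ c : Cycle V, IsCycle K c ∧ c.length ≤ n ∧ cycleSum η c ≠ 0 := by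
  induction n with
  | zero =>
    intro l hl _ hs
    simp at hl
    subst hl
    exact absurd rfl hs
  | succ n ih =>
    intro l hl hc hs
    by_cases hd : l.Nodup
    · refine ⟨l, ⟨hd, ?_, hc⟩, hl, hs⟩
      match l with
      | [] => exact absurd rfl hs
      | [a] =>
        have := h a a
        simp [listSum, pathSum] at hs; omega
      | [a, b] =>
        have := h a b
        simp [listSum, pathSum] at hs; omega
      | a :: b :: c :: l => simp
    · obtain ⟨p, m, q, x, rfl⟩ := exists_eq_append_of_not_nodup hd
      have hrot : (p ++ x :: m ++ x :: q) ~r (x :: m ++ x :: (q ++ p)) :=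
        ⟨p.length, by rw [List.append_assoc, List.rotate_append_length_eq]; simp⟩
      rw [Cycle.coe_eq_coe.mpr hrot] at hc
      rw [listSum_isRotated η hrot, listSum_append] at hs
      simp only [List.length_append, List.length_cons] at hl
      rw [List.cons_append, Cycle.chain_coe_cons, List.append_assoc] at hc
      have hc' : List.IsChain (Adj K) ((x :: m) ++ x :: ((q ++ p) ++ [x])) := by simpa using hc
      obtain ⟨hc1, hc2⟩ := List.isChain_split.mp hc'
      by_cases hs1 : listSum η (x :: m) = 0
      · obtain ⟨c, h1, h2, h3⟩ := ih (x :: (q ++ p)) (by simp; omega)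
          ((Cycle.chain_coe_cons _ _ _).mpr hc2) (by omega)
        exact ⟨c, h1, by omega, h3⟩
      · obtain ⟨c, h1, h2, h3⟩ := ih (x :: m) (by simp; omega)
          ((Cycle.chain_coe_cons _ _ _).mpr (by simpa using hc1)) hs1
        exact ⟨c, h1, by omega, h3⟩

theorem WalkSum.exists_isCycle {η : V → V → ℤ} (hη : ∀ a b, η a b = - η b a) {v : V} {n : ℕ}
    {s : ℤ} (h : WalkSum K η v v n s) (hs : s ≠ 0) :
    ∃ c : Cycle V, IsCycle K c ∧ c.length ≤ n ∧ cycleSum η c ≠ 0 := by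
  have hn : n ≠ 0 := by
    rintro rfl
    cases h
    exact hs rfl
  obtain ⟨l, h1, h2, h3⟩ := h.exists_list hn
  exact TorusTriangulation.exists_isCycle hη n (v :: l) (by simp [h1])
    ((Cycle.chain_coe_cons _ _ _).mpr h2) (by simp only [listSum]; rw [h3]; exact hs)

/-- A simple closed curve in the 1-skeleton of `K` with vertices indexed by `ZMod n`. -/
structure IsLoop (K : AbstractSimplicialComplex V) (n : ℕ) (u : ZMod n → V) : Prop where
  three_le : 3 ≤ n
  inj : Function.Injective u
  adj : ∀ i, Adj K (u i) (u (i + 1))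

theorem pathSum_map_range' (η : V → V → ℤ) (w : ℕ → V) (s n : ℕ) :
    pathSum η (w s) (List.map w (List.range' (s + 1) n)) =
      ∑ i ∈ Finset.range n, η (w (s + i)) (w (s + i + 1)) := by
  induction n generalizing s with
  | zero => simp [pathSum]
  | succ n ih =>
    rw [List.range'_succ, List.map_cons, pathSum, ih, Finset.sum_range_succ']
    simp only [add_zero]
    rw [add_comm]
    congr 1
    refine Finset.sum_congr rfl fun i _ => ?_
    rw [show s + 1 + i = s + (i + 1) by ring]

/-- The vertices of a cycle can be numbered by `ZMod n`. -/
theorem IsCycle.exists_loop {c : Cycle V} (h : IsCycle K c) :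
    ∃ (n : ℕ) (u : ZMod n → V), IsLoop K n u ∧ c.length = n ∧
      cycleEdges c = Set.range (fun i => ({u i, u (i + 1)} : Finset V)) ∧
      ∀ (_ : NeZero n) (η : V → V → ℤ), cycleSum η c = ∑ i, η (u i) (u (i + 1)) := by
  induction c using Quotient.inductionOn with
  | h l =>
  obtain ⟨hnd, h3, hch⟩ := h
  change l.Nodup at hnd
  change 3 ≤ l.length at h3
  obtain ⟨n, hn⟩ : ∃ n, l.length = n + 1 := ⟨l.length - 1, by omega⟩
  let u : ZMod (n + 1) → V := fun i => l.get (Fin.cast hn.symm i)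
  have hu : ∀ i : ℕ, (hi : i < l.length) → u (i : ZMod (n + 1)) = l[i] := by
    intro i hi
    simp only [u, List.get_eq_getElem]
    congr 1
    change ((i : ZMod (n + 1))).val = i
    rw [ZMod.val_natCast]
    exact Nat.mod_eq_of_lt (by omega)
  have hl : l = List.map (fun i : ℕ => u (i : ZMod (n + 1))) (List.range (n + 1)) := by
    apply List.ext_getElem
    · simp [hn]
    · intro i h1 h2
      simp [hu i h1]
  have hinj : Function.Injective u := by
    intro i j hij
    have := (List.nodup_iff_injective_get.mp hnd) hij
    exact Fin.cast_injective _ this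
  have hcast : ((n + 1 : ℕ) : ZMod (n + 1)) = 0 := ZMod.natCast_self _
  refine ⟨n + 1, u, ⟨by omega, hinj, ?_⟩, hn, ?_, ?_⟩
  · have h1 : Cycle.Chain (Adj K) (l : Cycle V) := hch
    rw [hl, ← Cycle.map_coe, Cycle.chain_map, Cycle.chain_range_succ] at h1
    intro i
    obtain ⟨j, hj, rfl⟩ : ∃ j : ℕ, j ≤ n ∧ (j : ZMod (n + 1)) = i :=
      ⟨i.val, Nat.lt_succ_iff.mp (ZMod.val_lt i), ZMod.natCast_zmod_val i⟩
    rcases Nat.lt_or_ge j n with hjn | hjn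
    · have := h1.2 j hjn
      push_cast at this; exact this
    · have hjn : j = n := by omega
      subst hjn
      have := h1.1
      push_cast at this hcast
      rw [hcast]; exact this
  · ext e
    constructor
    · rintro ⟨a, b, m, hm, rfl⟩
      obtain ⟨k, hk⟩ := (Cycle.coe_eq_coe.mp hm : l ~r _)
      have hlen : (l.rotate k).length = n + 1 := by rw [List.length_rotate, hn]
      have hlen' : m.length + 2 = n + 1 := by rw [hk] at hlen; simpa using hlen
      have ha : (l.rotate k)[0]'(by omega) = a := by simp [hk]
      have hb : (l.rotate k)[1]'(by omega) = b := by simp [hk]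
      rw [List.getElem_rotate] at ha hb
      refine ⟨(k : ZMod (n + 1)), ?_⟩
      have e1 : u (k : ZMod (n + 1)) = a := by
        rw [← ha, ← hu]
        congr 1
        rw [hn, zero_add]
        exact ((ZMod.natCast_mod k (n + 1))).symm
      have e2 : u ((k : ZMod (n + 1)) + 1) = b := by
        rw [← hb, ← hu]
        congr 1
        rw [hn, ZMod.natCast_mod]
        push_cast; ring
      simp only [e1, e2]
    · rintro ⟨i, rfl⟩
      obtain ⟨j, hj, rfl⟩ : ∃ j : ℕ, j ≤ n ∧ (j : ZMod (n + 1)) = i :=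
        ⟨i.val, Nat.lt_succ_iff.mp (ZMod.val_lt i), ZMod.natCast_zmod_val i⟩
      have hlen : (l.rotate j).length = n + 1 := by rw [List.length_rotate, hn]
      match hm : l.rotate j with
      | [] => rw [hm] at hlen; simp at hlen
      | [a] => rw [hm] at hlen; simp at hlen; omega
      | a :: b :: m =>
        refine ⟨a, b, m, ?_, ?_⟩
        · exact Cycle.coe_eq_coe.mpr ⟨j, hm⟩
        have ha : (l.rotate j)[0]'(by omega) = a := by simp [hm]
        have hb : (l.rotate j)[1]'(by omega) = b := by simp [hm]
        rw [List.getElem_rotate, ← hu] at ha hb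
        rw [← ha, ← hb, hn, ZMod.natCast_mod, ZMod.natCast_mod]
        push_cast
        ring_nf
  · intro _ η
    change listSum η l = _
    rw [hl, List.range_eq_range', List.range'_succ, List.map_cons, listSum]
    have h1 : [u ((0 : ℕ) : ZMod (n + 1))] =
        List.map (fun i : ℕ => u (i : ZMod (n + 1))) (List.range' (0 + 1 + n) 1) := by
      simp only [List.range'_one, List.map_cons, List.map_nil]
      congr 2
      rw [zero_add, add_comm 1 n, hcast]; simp
    rw [h1, ← List.map_append, List.range'_append_1,
      pathSum_map_range' η (fun i : ℕ => u (i : ZMod (n + 1))) 0 (n + 1)]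
    rw [Finset.sum_range]
    refine Fintype.sum_congr _ _ fun i => ?_
    have : ((i : ℕ) : ZMod (n + 1)) = (i : ZMod (n + 1)) := ZMod.natCast_zmod_val (n := n + 1) i
    simp only [zero_add]
    push_cast
    rw [this]

/-! ### Regions and their boundary -/

/-- The triangle on the left of the directed edge `a → b` belongs to `D`. -/
def Lft (O : V → V → V → Prop) (D : Set (Finset V)) (a b : V) : Prop :=
  ∃ c, O a b c ∧ {a, b, c} ∈ D

/-- The directed edge `a → b` is on the boundary of `D`, with `D` on its left. -/
def Bd (O : V → V → V → Prop) (D : Set (Finset V)) (a b : V) : Prop :=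
  Lft O D a b ∧ ¬ Lft O D b a

theorem triple_rotate (a b c : V) : ({b, c, a} : Finset V) = {a, b, c} := by
  ext x; simp; tauto

theorem triple_swap (a b c : V) : ({b, a, c} : Finset V) = {a, b, c} := by
  ext x; simp; tauto

theorem IsOrientation.lft_iff (hO : IsOrientation K O) {D : Set (Finset V)} {a b c : V}
    (h : O a b c) : Lft O D a b ↔ {a, b, c} ∈ D := by
  constructor
  · rintro ⟨d, hd, hD⟩
    rwa [hO.uniq h hd]
  · exact fun hD => ⟨c, h, hD⟩

theorem IsOrientation.lft_rot (hO : IsOrientation K O) {D : Set (Finset V)} {a b c : V}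
    (h : O a b c) : Lft O D a b ↔ Lft O D b c := by
  rw [hO.lft_iff h, hO.lft_iff (hO.rot h), triple_rotate a b c]

theorem Lft.adj (hO : IsOrientation K O) {D : Set (Finset V)} {a b : V} (h : Lft O D a b) :
    Adj K a b := by
  obtain ⟨c, hc, _⟩ := h
  exact (hO.tri hc).adj

/-- A nonempty region without boundary is everything. -/
theorem lft_of_no_boundary (hK : IsTriangulatedTorus K) (hO : IsOrientation K O)
    {D : Set (Finset V)} (h : ∀ a b, ¬ Bd O D a b) {a₀ b₀ : V} (h0 : Lft O D a₀ b₀) :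
    ∀ a b, Adj K a b → Lft O D a b := by
  have hsymm : ∀ a b, Lft O D a b → Lft O D b a := fun a b hab => by
    by_contra hc; exact h a b ⟨hab, hc⟩
  have key : ∀ v z, Lft O D v z → ∀ w, Adj K v w → Lft O D v w := fun v z hz =>
    link_forward hK hO (hz.adj hO) hz fun z w ho hl =>
      hsymm _ _ ((hO.lft_rot (hO.rot ho)).mp ((hO.lft_rot ho).mp hl))
  have hall : ∀ v, Relation.ReflTransGen (Adj K) a₀ v → ∀ w, Adj K v w → Lft O D v w := by
    intro v hv
    induction hv with
    | refl => exact key _ _ h0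
    | tail _ hbc ih => exact key _ _ (hsymm _ _ (ih _ hbc))
  exact fun a b hab => hall a (hK.connected a₀ a) b hab

/-- The boundary of a region can be followed from each of its directed edges. -/
theorem Bd.exists_next (hK : IsTriangulatedTorus K) (hO : IsOrientation K O)
    {D : Set (Finset V)} {a v : V} (h : Bd O D a v) : ∃ y, Bd O D v y := by
  by_contra hno
  push Not at hno
  obtain ⟨c, hc⟩ := exists_left hK hO (h.1.adj hO)
  have h1 : Lft O D v c := (hO.lft_rot hc).mp h.1
  refine h.2 (link_backward hK hO (P := fun z => Lft O D v z) (h1.adj hO) h1 ?_ a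
    (h.1.adj hO).symm)
  intro z w ho hw
  have h2 : Lft O D w v := by
    by_contra hc; exact hno w ⟨hw, hc⟩
  exact (hO.lft_rot (hO.rot (hO.rot ho))).mp h2

theorem ZMod.forall_of_succ {n : ℕ} [NeZero n] {P : ZMod n → Prop} (i₀ : ZMod n) (h0 : P i₀)
    (hs : ∀ i, P i → P (i + 1)) (i : ZMod n) : P i := by
  have h1 : ∀ k : ℕ, P (i₀ + k) := by
    intro k
    induction k with
    | zero => simpa using h0
    | succ k ih => push_cast; rw [← add_assoc]; exact hs _ ih
  have := h1 (i - i₀).val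
  rwa [ZMod.natCast_zmod_val, add_sub_cancel] at this

theorem IsLoop.neZero {n : ℕ} {u : ZMod n → V} (h : IsLoop K n u) : NeZero n :=
  ⟨by have := h.three_le; omega⟩

theorem IsLoop.two_ne {n : ℕ} {u : ZMod n → V} (h : IsLoop K n u) : (2 : ZMod n) ≠ 0 := by
  intro h2
  have h3 := (ZMod.natCast_eq_zero_iff 2 n).mp (by exact_mod_cast h2)
  have := Nat.le_of_dvd (by omega) h3
  have := h.three_le
  omega

theorem IsLoop.reverse {n : ℕ} {u : ZMod n → V} (h : IsLoop K n u) :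
    IsLoop K n (fun i => u (-i)) where
  three_le := h.three_le
  inj i j hij := by simpa using h.inj hij
  adj i := by
    have := (h.adj (-(i + 1))).symm
    rwa [show -(i + 1) + 1 = -i by ring] at this

theorem pair_eq {a b c d : V} (h : ({a, b} : Finset V) = {c, d}) :
    (a = c ∧ b = d) ∨ (a = d ∧ b = c) := by
  have h' : ({a, b} : Set V) = {c, d} := by
    rw [← Finset.coe_pair, h, Finset.coe_pair]
  exact Set.pair_eq_pair_iff.mp h'

/-- If the boundary of a region runs in a loop, it fills the loop and is directed coherently. -/
theorem bd_coherent (hK : IsTriangulatedTorus K) (hO : IsOrientation K O) {D : Set (Finset V)}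
    {n : ℕ} {u : ZMod n → V} (hu : IsLoop K n u)
    (hsub : ∀ a b, Bd O D a b → ∃ i, ({a, b} : Finset V) = {u i, u (i + 1)})
    (hex : ∃ a b, Bd O D a b) :
    (∀ i, Bd O D (u i) (u (i + 1))) ∨ (∀ i, Bd O D (u (i + 1)) (u i)) := by
  have := hu.neZero
  obtain ⟨a, b, hab⟩ := hex
  obtain ⟨i, hi⟩ := hsub a b hab
  rcases pair_eq hi with ⟨rfl, rfl⟩ | ⟨rfl, rfl⟩
  · left
    refine ZMod.forall_of_succ i hab fun j hj => ?_
    obtain ⟨y, hy⟩ := hj.exists_next hK hO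
    obtain ⟨k, hk⟩ := hsub _ _ hy
    rcases pair_eq hk with ⟨h1, rfl⟩ | ⟨h1, rfl⟩
    · rwa [← hu.inj h1] at hy
    · have : k = j := by simpa using (hu.inj h1).symm
      subst this
      exact absurd hj.1 hy.2
  · right
    have h2 := ZMod.forall_of_succ (P := fun j => Bd O D (u (-j + 1)) (u (-j))) (-i)
      (by simpa using hab) ?_
    · intro j; simpa using h2 (-j)
    intro j hj
    obtain ⟨y, hy⟩ := hj.exists_next hK hO
    obtain ⟨k, hk⟩ := hsub _ _ hy
    rcases pair_eq hk with ⟨h1, rfl⟩ | ⟨h1, rfl⟩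
    · have : k = -j := (hu.inj h1).symm
      subst this
      exact absurd hj.1 hy.2
    · have h3 : k = -(j + 1) := by
        have := hu.inj h1
        rw [neg_add, this]; ring
      rw [← h3, ← h1]
      exact hy

/-- The region `D` lies on the left of the loop `u`, which is its whole boundary. -/
structure IsRegion (K : AbstractSimplicialComplex V) (O : V → V → V → Prop) (D : Set (Finset V))
    {n : ℕ} (u : ZMod n → V) : Prop where
  loop : IsLoop K n u
  tri : ∀ t ∈ D, t ∈ K.faces ∧ t.card = 3
  fwd : ∀ i, Bd O D (u i) (u (i + 1))
  only : ∀ a b, Bd O D a b → ∃ i, a = u i ∧ b = u (i + 1)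

/-- The triangles of `K` that do not belong to `D`. -/
def triCompl (K : AbstractSimplicialComplex V) (D : Set (Finset V)) : Set (Finset V) :=
  {t | t ∈ K.faces ∧ t.card = 3 ∧ t ∉ D}

theorem lft_triCompl (hO : IsOrientation K O) {D : Set (Finset V)} {a b c : V} (h : O a b c) :
    Lft O (triCompl K D) a b ↔ ¬ Lft O D a b := by
  rw [hO.lft_iff h, hO.lft_iff h]
  have ht := hO.tri h
  simp only [triCompl, Set.mem_ofPred_eq, and_iff_right ht.2.2.2,
    Finset.card_eq_three.mpr ⟨a, b, c, ht.1, ht.2.2.1, ht.2.1, rfl⟩, true_and]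

theorem bd_triCompl (hK : IsTriangulatedTorus K) (hO : IsOrientation K O) {D : Set (Finset V)}
    {a b : V} : Bd O (triCompl K D) a b ↔ Bd O D b a := by
  by_cases h : Adj K a b
  · obtain ⟨c, hc⟩ := exists_left hK hO h
    obtain ⟨d, hd⟩ := exists_left hK hO h.symm
    simp only [Bd, lft_triCompl hO hc, lft_triCompl hO hd]
    tauto
  · exact ⟨fun h' => absurd (h'.1.adj hO) h, fun h' => absurd (h'.1.adj hO).symm h⟩

theorem isRegion_of_fwd {D : Set (Finset V)} {n : ℕ} {u : ZMod n → V} (hu : IsLoop K n u)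
    (hD : ∀ t ∈ D, t ∈ K.faces ∧ t.card = 3)
    (hsub : ∀ a b, Bd O D a b → ∃ i, ({a, b} : Finset V) = {u i, u (i + 1)})
    (hf : ∀ i, Bd O D (u i) (u (i + 1))) : IsRegion K O D u where
  loop := hu
  tri := hD
  fwd := hf
  only a b hab := by
    obtain ⟨i, hi⟩ := hsub a b hab
    rcases pair_eq hi with ⟨rfl, rfl⟩ | ⟨rfl, rfl⟩
    · exact ⟨i, rfl, rfl⟩
    · exact absurd (hf i).1 hab.2

theorem IsRegion.reverse (hK : IsTriangulatedTorus K) (hO : IsOrientation K O)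
    {D : Set (Finset V)} {n : ℕ} {u : ZMod n → V} (h : IsRegion K O D u) :
    IsRegion K O (triCompl K D) (fun i => u (-i)) where
  loop := h.loop.reverse
  tri _ ht := ⟨ht.1, ht.2.1⟩
  fwd i := by
    rw [bd_triCompl hK hO]
    have := h.fwd (-(i + 1))
    rwa [show -(i + 1) + 1 = -i by ring] at this
  only a b hab := by
    rw [bd_triCompl hK hO] at hab
    obtain ⟨i, rfl, rfl⟩ := h.only _ _ hab
    exact ⟨-(i + 1), by simp, by simp⟩

theorem exists_isRegion (hK : IsTriangulatedTorus K) (hO : IsOrientation K O)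
    {D : Set (Finset V)} {n : ℕ} {u : ZMod n → V} (hu : IsLoop K n u)
    (hD : ∀ t ∈ D, t ∈ K.faces ∧ t.card = 3)
    (hsub : ∀ a b, Bd O D a b → ∃ i, ({a, b} : Finset V) = {u i, u (i + 1)})
    (hex : ∃ a b, Bd O D a b) : IsRegion K O D u ∨ IsRegion K O D (fun i => u (-i)) := by
  rcases bd_coherent hK hO hu hsub hex with h | h
  · exact Or.inl (isRegion_of_fwd hu hD hsub h)
  · right
    refine isRegion_of_fwd hu.reverse hD (fun a b hab => ?_) fun i => ?_
    · obtain ⟨i, hi⟩ := hsub a b hab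
      exact ⟨-(i + 1), by rw [hi, Finset.pair_comm]; simp⟩
    · have := h (-(i + 1))
      rwa [show -(i + 1) + 1 = -i by ring] at this

/-- The triangles of a set that contain a given edge. -/
theorem ncard_edge (hK : IsTriangulatedTorus K) (hO : IsOrientation K O) {D : Set (Finset V)}
    (hD : ∀ t ∈ D, t ∈ K.faces ∧ t.card = 3) {a b : V} (hab : Adj K a b) :
    {t ∈ D | {a, b} ⊆ t}.ncard = 1 ↔ (Bd O D a b ∨ Bd O D b a) := by
  obtain ⟨c, hc⟩ := exists_left hK hO hab
  obtain ⟨d, hd⟩ := exists_left hK hO hab.symm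
  have hcd : ({a, b, c} : Finset V) ≠ {a, b, d} := by
    intro h
    have : c ∈ ({a, b, d} : Finset V) := by rw [← h]; simp
    have htc := hO.tri hc
    simp only [Finset.mem_insert, Finset.mem_singleton, htc.2.1.symm, htc.2.2.1.symm,
      false_or] at this
    subst this
    exact hO.not_both hc hd
  have hset : {t ∈ D | {a, b} ⊆ t} =
      {t | (t = {a, b, c} ∧ {a, b, c} ∈ D) ∨ (t = {a, b, d} ∧ {a, b, d} ∈ D)} := by
    ext t
    constructor
    · rintro ⟨htD, hsub⟩
      obtain ⟨e, hea, heb, rfl⟩ := exists_third hab.1 hsub (hD t htD).2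
      rcases hO.or (⟨hab.1, heb.symm, hea.symm, (hD _ htD).1⟩ : IsTriangle K a b e) with h | h
      · left; rw [hO.uniq hc h]; exact ⟨rfl, htD⟩
      · right; rw [hO.uniq hd h]; exact ⟨rfl, htD⟩
    · rintro (⟨rfl, h⟩ | ⟨rfl, h⟩) <;> exact ⟨h, by intro x; simp; tauto⟩
  simp only [Bd, hO.lft_iff hc, hO.lft_iff hd, triple_swap, hset]
  by_cases h1 : ({a, b, c} : Finset V) ∈ D <;> by_cases h2 : ({a, b, d} : Finset V) ∈ D
  · simp only [h1, h2, and_true, not_true, and_false, or_false, iff_false]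
    have : {t : Finset V | t = {a, b, c} ∨ t = {a, b, d}} = {{a, b, c}, {a, b, d}} := rfl
    rw [this, Set.ncard_pair hcd]; decide
  · simp [h1, h2]
  · simp [h1, h2]
  · simp [h1, h2]

theorem bd_eq_edges (hK : IsTriangulatedTorus K) (hO : IsOrientation K O) {D : Set (Finset V)}
    {n : ℕ} {u : ZMod n → V} (h : IsRegion K O D u) :
    {e : Finset V | e.card = 2 ∧ {t ∈ D | e ⊆ t}.ncard = 1} =
      Set.range (fun i => ({u i, u (i + 1)} : Finset V)) := by
  ext e
  constructor
  · rintro ⟨h2, h1⟩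
    obtain ⟨a, b, hab, rfl⟩ := Finset.card_eq_two.mp h2
    have hadj : Adj K a b := by
      obtain ⟨t, ht⟩ := Set.ncard_eq_one.mp h1
      have : t ∈ {t ∈ D | {a, b} ⊆ t} := by rw [ht]; rfl
      exact ⟨hab, faces_of_subset (h.tri t this.1).1 this.2 (by simp)⟩
    rcases (ncard_edge hK hO h.tri hadj).mp h1 with h3 | h3
    · obtain ⟨i, rfl, rfl⟩ := h.only _ _ h3
      exact ⟨i, rfl⟩
    · obtain ⟨i, rfl, rfl⟩ := h.only _ _ h3
      exact ⟨i, Finset.pair_comm _ _⟩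
  · rintro ⟨i, rfl⟩
    exact ⟨Finset.card_pair (h.loop.adj i).1,
      (ncard_edge hK hO h.tri (h.loop.adj i)).mpr (Or.inl (h.fwd i))⟩

theorem card_inter_eq_two {a b c d : V} (h1 : a ≠ b) (hca : c ≠ a) (hcb : c ≠ b)
    (hcd : c ≠ d) : (({a, b, c} : Finset V) ∩ {a, b, d}).card = 2 := by
  have : (({a, b, c} : Finset V) ∩ {a, b, d}) = {a, b} := by
    ext x
    simp only [Finset.mem_inter, Finset.mem_insert, Finset.mem_singleton]
    constructor
    · rintro ⟨rfl | rfl | rfl, h⟩ <;> simp_all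
    · rintro (rfl | rfl) <;> simp
  rw [this, Finset.card_pair h1]

/-- A region whose boundary is a single loop is connected through edges: every component has the
whole loop as its boundary. -/
theorem IsRegion.connected (hK : IsTriangulatedTorus K) (hO : IsOrientation K O)
    {D : Set (Finset V)} {n : ℕ} {u : ZMod n → V} (h : IsRegion K O D u) :
    ∀ s ∈ D, ∀ t ∈ D,
      Relation.ReflTransGen (fun x y => x ∈ D ∧ y ∈ D ∧ (x ∩ y).card = 2) s t := by
  set r : Finset V → Finset V → Prop := fun x y => x ∈ D ∧ y ∈ D ∧ (x ∩ y).card = 2 with hr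
  have hsymm : ∀ s t, Relation.ReflTransGen r s t → Relation.ReflTransGen r t s := by
    intro s t hst
    induction hst with
    | refl => exact .refl
    | tail _ h ih => exact ih.head ⟨h.2.1, h.1, by rw [Finset.inter_comm]; exact h.2.2⟩
  obtain ⟨c₀, hc₀, hD₀⟩ := (h.fwd 0).1
  suffices key : ∀ s ∈ D, Relation.ReflTransGen r s {u 0, u (0 + 1), c₀} from
    fun s hs t ht => (key s hs).trans (hsymm _ _ (key t ht))
  intro s hs
  let D₁ : Set (Finset V) := {t | t ∈ D ∧ Relation.ReflTransGen r s t}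
  have hsub : ∀ a b, Bd O D₁ a b → Bd O D a b := by
    rintro a b ⟨⟨c, hc, hcD⟩, h2⟩
    refine ⟨⟨c, hc, hcD.1⟩, fun ⟨d, hd, hdD⟩ => h2 ⟨d, hd, hdD, hcD.2.tail ⟨hcD.1, hdD, ?_⟩⟩⟩
    have ht := hO.tri hc
    have hcd : c ≠ d := by
      rintro rfl; exact hO.not_both hc hd
    rw [triple_swap]
    exact card_inter_eq_two ht.1.symm ht.2.1.symm ht.2.2.1.symm hcd
  have hex : ∃ a b, Bd O D₁ a b := by
    by_contra hno
    push Not at hno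
    have h3 := (h.tri s hs).2
    obtain ⟨a, b, c, hab, hac, hbc, rfl⟩ := Finset.card_eq_three.mp h3
    have ht : IsTriangle K a b c := ⟨hab, hbc, hac, (h.tri _ hs).1⟩
    have h0 : Lft O D₁ a b ∨ Lft O D₁ b a := by
      rcases hO.or ht with h' | h'
      · exact Or.inl ⟨c, h', hs, .refl⟩
      · exact Or.inr ⟨c, h', by rw [triple_swap]; exact ⟨hs, .refl⟩⟩
    have hall : ∀ a b, Adj K a b → Lft O D₁ a b := by
      rcases h0 with h0 | h0
      · exact lft_of_no_boundary hK hO hno h0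
      · exact lft_of_no_boundary hK hO hno h0
    obtain ⟨d, hd, hd'⟩ := hall _ _ (h.loop.adj 0).symm
    exact (h.fwd 0).2 ⟨d, hd, hd'.1⟩
  rcases bd_coherent hK hO h.loop (fun a b hab => by
    obtain ⟨i, rfl, rfl⟩ := h.only _ _ (hsub a b hab)
    exact ⟨i, rfl⟩) hex with hf | hf
  · obtain ⟨d, hd, hd'⟩ := (hf 0).1
    rw [hO.uniq hc₀ hd]
    exact hd'.2
  · exact absurd (h.fwd 0).1 (hsub _ _ (hf 0)).2

/-! ### The sign of a permutation and its number of orbits -/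

theorem sameCycle_imp_eq {X Y : Type*} {π : Equiv.Perm X} {p : X → Y} (h : ∀ x, p (π x) = p x)
    {x y : X} (hxy : π.SameCycle x y) : p x = p y := by
  obtain ⟨i, rfl⟩ := hxy
  have hnat : ∀ (k : ℕ) x, p ((π ^ k) x) = p x := by
    intro k
    induction k with
    | zero => simp
    | succ k ih => intro x; rw [pow_succ, Equiv.Perm.mul_apply, ih, h]
  obtain ⟨k, rfl | rfl⟩ := i.eq_nat_or_neg
  · rw [zpow_natCast, hnat]
  · have := hnat k ((π ^ (-(k : ℤ))) x)
    rw [← this, ← Equiv.Perm.mul_apply, ← zpow_natCast, ← zpow_add]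
    simp

/-- If the fibres of a surjection are the orbits of a permutation, the sign is determined by the
numbers of points and of fibres. -/
theorem sign_eq_of_orbits {X Y : Type*} [Fintype X] [DecidableEq X] {π : Equiv.Perm X} {p : X → Y}
    (hp : Function.Surjective p) (h : ∀ x y, p x = p y ↔ π.SameCycle x y) :
    Equiv.Perm.sign π = (-1) ^ (Nat.card X + Nat.card Y) := by
  classical
  have := Fintype.ofSurjective p hp
  -- fibres of moved points correspond to nontrivial cycles
  have h1 : (π.support.image p).card = π.cycleFactorsFinset.card := by
    have h2 : π.cycleFactorsFinset = π.support.image π.cycleOf := by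
      ext c
      simp only [Finset.mem_image]
      constructor
      · intro hc
        obtain ⟨x, hx⟩ := (Equiv.Perm.mem_cycleFactorsFinset_iff.mp hc).1.nonempty_support
        have := Equiv.Perm.cycle_is_cycleOf hx hc
        exact ⟨x, Equiv.Perm.mem_cycleFactorsFinset_support_le hc hx, this.symm⟩
      · rintro ⟨x, hx, rfl⟩
        exact Equiv.Perm.cycleOf_mem_cycleFactorsFinset_iff.mpr hx
    rw [h2]
    have hs : ∀ x ∈ π.support, ∀ y ∈ π.support, p x = p y ↔ π.cycleOf x = π.cycleOf y := by
      intro x hx y hy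
      rw [h]
      exact Equiv.Perm.sameCycle_iff_cycleOf_eq_of_mem_support hx hy
    refine Finset.card_bij (fun y hy => π.cycleOf (Finset.mem_image.mp hy).choose) ?_ ?_ ?_
    · intro y hy
      exact Finset.mem_image_of_mem _ (Finset.mem_image.mp hy).choose_spec.1
    · intro y hy z hz hyz
      have e1 := (Finset.mem_image.mp hy).choose_spec
      have e2 := (Finset.mem_image.mp hz).choose_spec
      rw [← e1.2, ← e2.2]
      exact (hs _ e1.1 _ e2.1).mpr hyz
    · intro c hc
      obtain ⟨x, hx, rfl⟩ := Finset.mem_image.mp hc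
      have hy : p x ∈ π.support.image p := Finset.mem_image_of_mem _ hx
      have e1 := (Finset.mem_image.mp hy).choose_spec
      exact ⟨p x, hy, (hs _ e1.1 _ hx).mp e1.2⟩
  have h2 : (π.supportᶜ.image p).card = π.supportᶜ.card := by
    refine Finset.card_image_of_injOn fun x hx y _ hxy => ?_
    have hx' : π x = x := by simpa using hx
    obtain ⟨i, rfl⟩ := (h x y).mp hxy
    exact (Equiv.Perm.zpow_apply_eq_self_of_apply_eq_self hx' i).symm
  have h3 : Fintype.card Y = (π.support.image p).card + (π.supportᶜ.image p).card := by
    rw [← Finset.card_union_of_disjoint, ← Finset.image_union, Finset.union_compl,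
      Finset.image_univ_of_surjective hp, Finset.card_univ]
    rw [Finset.disjoint_left]
    intro y hy hy'
    obtain ⟨x, hx, rfl⟩ := Finset.mem_image.mp hy
    obtain ⟨z, hz, hzx⟩ := Finset.mem_image.mp hy'
    have hz' : π z = z := by simpa using hz
    obtain ⟨i, rfl⟩ := (h z x).mp hzx
    rw [Equiv.Perm.zpow_apply_eq_self_of_apply_eq_self hz' i] at hx
    simp at hz
    simp [hz] at hx
  have h4 : π.support.card + π.supportᶜ.card = Fintype.card X := Finset.card_add_card_compl _
  have h5 : Multiset.card π.cycleType = π.cycleFactorsFinset.card := by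
    rw [Equiv.Perm.cycleType_def]; simp
  rw [Equiv.Perm.sign_of_cycleType, Equiv.Perm.sum_cycleType, h5, ← h1]
  rw [Nat.card_eq_fintype_card, Nat.card_eq_fintype_card]
  have : Fintype.card X + Fintype.card Y =
      π.support.card + (π.support.image p).card + 2 * π.supportᶜ.card := by omega
  rw [this, pow_add _ _ (2 * _), pow_mul]
  simp

/-! ### Darts of a region -/

/-- The directed edges that have a triangle of `D` on their left. -/
abbrev Dart (O : V → V → V → Prop) (D : Set (Finset V)) : Type _ :=
  {d : V × V // Lft O D d.1 d.2}

/-- The third vertex of the triangle on the left of a dart. -/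
noncomputable def Dart.apex {D : Set (Finset V)} (d : Dart O D) : V := d.2.choose

theorem Dart.apex_spec {D : Set (Finset V)} (d : Dart O D) : O d.1.1 d.1.2 d.apex :=
  d.2.choose_spec.1

theorem Dart.apex_mem {D : Set (Finset V)} (d : Dart O D) : {d.1.1, d.1.2, d.apex} ∈ D :=
  d.2.choose_spec.2

/-- The permutation of the darts that turns around the triangles. -/
noncomputable def faceRot (hO : IsOrientation K O) (D : Set (Finset V)) :
    Equiv.Perm (Dart O D) where
  toFun d := ⟨(d.1.2, d.apex), (hO.lft_rot d.apex_spec).mp d.2⟩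
  invFun d := ⟨(d.apex, d.1.1),
    (hO.lft_rot (hO.rot d.apex_spec)).mp ((hO.lft_rot d.apex_spec).mp d.2)⟩
  left_inv d := by
    apply Subtype.ext
    refine Prod.ext ?_ rfl
    exact hO.uniq (Dart.apex_spec _) (hO.rot d.apex_spec)
  right_inv d := by
    apply Subtype.ext
    refine Prod.ext rfl ?_
    exact hO.uniq (Dart.apex_spec _) (hO.rot (hO.rot d.apex_spec))

open Classical in
/-- The permutation of the darts of `D` that reverses the interior edges and fixes the darts on
the boundary. -/
noncomputable def edgeFlip (O : V → V → V → Prop) (D : Set (Finset V)) : Equiv.Perm (Dart O D) :=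
  Function.Involutive.toPerm
    (fun d => if h : Lft O D d.1.2 d.1.1 then ⟨(d.1.2, d.1.1), h⟩ else d) (by
      intro d
      by_cases h : Lft O D d.1.2 d.1.1
      · simp [h, d.2]
      · simp [h])

theorem faceRot_apply (hO : IsOrientation K O) {D : Set (Finset V)} {a b c : V} (h : O a b c)
    (hl : Lft O D a b) : faceRot hO D ⟨(a, b), hl⟩ = ⟨(b, c), (hO.lft_rot h).mp hl⟩ := by
  apply Subtype.ext
  refine Prod.ext rfl ?_
  exact hO.uniq (Dart.apex_spec ⟨(a, b), hl⟩) h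

theorem edgeFlip_apply {D : Set (Finset V)} {a b : V} (hl : Lft O D a b) (h : Lft O D b a) :
    edgeFlip O D ⟨(a, b), hl⟩ = ⟨(b, a), h⟩ := by
  exact dif_pos h

theorem edgeFlip_apply_of_not {D : Set (Finset V)} {a b : V} (hl : Lft O D a b)
    (h : ¬ Lft O D b a) : edgeFlip O D ⟨(a, b), hl⟩ = ⟨(a, b), hl⟩ := by
  exact dif_neg h

theorem edgeFlip_edgeFlip {D : Set (Finset V)} (d : Dart O D) :
    edgeFlip O D (edgeFlip O D d) = d := by
  obtain ⟨⟨a, b⟩, hl⟩ := d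
  by_cases h : Lft O D b a
  · rw [edgeFlip_apply hl h, edgeFlip_apply h hl]
  · rw [edgeFlip_apply_of_not hl h, edgeFlip_apply_of_not hl h]

theorem faceRot_cube (hO : IsOrientation K O) (D : Set (Finset V)) : faceRot hO D ^ 3 = 1 := by
  ext1 ⟨⟨a, b⟩, hl⟩
  obtain ⟨c, hc, _⟩ := id hl
  simp only [pow_succ, pow_zero, one_mul, Equiv.Perm.mul_apply, Equiv.Perm.one_apply]
  rw [faceRot_apply hO hc, faceRot_apply hO (hO.rot hc), faceRot_apply hO (hO.rot (hO.rot hc))]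

open Classical in
/-- The Stokes formula: a cocycle sums to zero over the boundary of a region. -/
theorem sum_boundary (hO : IsOrientation K O) (D : Set (Finset V)) [Fintype (Dart O D)]
    {η : V → V → ℤ} (h : IsCocycle K η) :
    ∑ d : Dart O D, (if Lft O D d.1.2 d.1.1 then 0 else η d.1.1 d.1.2) = 0 := by
  have h1 : ∑ d : Dart O D, η d.1.1 d.1.2 = 0 := by
    have e1 := Equiv.sum_comp (faceRot hO D) (fun d => η d.1.1 d.1.2)
    have e2 := Equiv.sum_comp (faceRot hO D) (fun d => η (faceRot hO D d).1.1 (faceRot hO D d).1.2)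
    have e3 : ∑ d : Dart O D, (η d.1.1 d.1.2 + η (faceRot hO D d).1.1 (faceRot hO D d).1.2 +
        η (faceRot hO D (faceRot hO D d)).1.1 (faceRot hO D (faceRot hO D d)).1.2) = 0 := by
      refine Finset.sum_eq_zero ?_
      rintro ⟨⟨a, b⟩, hl⟩ _
      obtain ⟨c, hc, _⟩ := id hl
      rw [faceRot_apply hO hc, faceRot_apply hO (hO.rot hc)]
      exact h.closed a b c (hO.tri hc)
    rw [Finset.sum_add_distrib, Finset.sum_add_distrib, e2, e1] at e3
    omega
  have h2 : ∑ d : Dart O D, (η d.1.1 d.1.2 + η (edgeFlip O D d).1.1 (edgeFlip O D d).1.2) =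
      ∑ d : Dart O D, 2 * (if Lft O D d.1.2 d.1.1 then 0 else η d.1.1 d.1.2) := by
    refine Finset.sum_congr rfl ?_
    rintro ⟨⟨a, b⟩, hl⟩ _
    by_cases hb : Lft O D b a
    · rw [edgeFlip_apply hl hb]
      simp [hb, h.antisymm a b]
    · rw [edgeFlip_apply_of_not hl hb]
      simp [hb]; ring
  rw [Finset.sum_add_distrib, Equiv.sum_comp (edgeFlip O D) (fun d => η d.1.1 d.1.2), h1,
    ← Finset.mul_sum] at h2
  omega

/-- A cocycle has period zero along the boundary of a region. -/
theorem IsRegion.sum_eq_zero (hK : IsTriangulatedTorus K) (hO : IsOrientation K O)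
    {D : Set (Finset V)} {n : ℕ} [NeZero n] {u : ZMod n → V} (hD : IsRegion K O D u)
    {η : V → V → ℤ} (h : IsCocycle K η) : ∑ i, η (u i) (u (i + 1)) = 0 := by
  classical
  have := hK.finite
  have := Fintype.ofFinite (Dart O D)
  rw [← sum_boundary hO D h]
  refine Fintype.sum_of_injective (fun i => (⟨(u i, u (i + 1)), (hD.fwd i).1⟩ : Dart O D)) ?_ _ _
    ?_ ?_
  · intro i j hij
    exact hD.loop.inj (congrArg (fun d : Dart O D => d.1.1) hij)
  · rintro ⟨⟨a, b⟩, hl⟩ hd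
    by_cases hb : Lft O D b a
    · simp [hb]
    · obtain ⟨i, rfl, rfl⟩ := hD.only a b ⟨hl, hb⟩
      exact absurd ⟨i, rfl⟩ hd
  · intro i
    rw [if_neg (hD.fwd i).2]

/-- A cocycle has period zero along every cycle that bounds a disc. -/
theorem BoundsDisc.cycleSum_eq_zero (hK : IsTriangulatedTorus K) {c : Cycle V}
    (hc : IsCycle K c) (hd : BoundsDisc K c) {η : V → V → ℤ} (h : IsCocycle K η) :
    cycleSum η c = 0 := by
  obtain ⟨O, hO⟩ := hK.orientable
  obtain ⟨n, u, hu, -, hedges, hsum⟩ := hc.exists_loop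
  obtain ⟨D, htri, -, -, hbd⟩ := hd
  have := hu.neZero
  rw [hsum this]
  have hbd' : ∀ a b, (Bd O D a b ∨ Bd O D b a) → ∃ i, ({a, b} : Finset V) = {u i, u (i + 1)} := by
    intro a b hab
    have hadj : Adj K a b := by
      rcases hab with h | h
      · exact h.1.adj hO
      · exact (h.1.adj hO).symm
    have : ({a, b} : Finset V) ∈ cycleEdges c := by
      rw [← hbd]
      exact ⟨Finset.card_pair hadj.1, (ncard_edge hK hO htri hadj).mpr hab⟩
    rw [hedges] at this
    obtain ⟨i, hi⟩ := this
    exact ⟨i, hi.symm⟩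
  have hex : ∃ a b, Bd O D a b := by
    have h0 : ({u 0, u (0 + 1)} : Finset V) ∈ cycleEdges c := by rw [hedges]; exact ⟨0, rfl⟩
    rw [← hbd] at h0
    rcases (ncard_edge hK hO htri (hu.adj 0)).mp h0.2 with h | h
    · exact ⟨_, _, h⟩
    · exact ⟨_, _, h⟩
  rcases exists_isRegion hK hO hu htri (fun a b hab => hbd' a b (Or.inl hab)) hex with hr | hr
  · exact hr.sum_eq_zero hK hO h
  · have h1 := hr.sum_eq_zero hK hO h
    rw [← Equiv.sum_comp ((Equiv.neg (ZMod n)).trans (Equiv.subRight 1))] at h1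
    simp only [Equiv.trans_apply, Equiv.neg_apply, Equiv.subRight_apply] at h1
    have h2 : ∑ i, η (u (i + 1)) (u i) = 0 := by
      rw [← h1]
      refine Fintype.sum_congr _ _ fun i => ?_
      congr 2 <;> ring
    rw [← neg_eq_zero, ← Finset.sum_neg_distrib, ← h2]
    refine Fintype.sum_congr _ _ fun i => ?_
    have := h.antisymm (u i) (u (i + 1)); omega

/-! ### The Euler characteristic of a region is odd -/

/-- The vertices of the triangles of `D`. -/
def verts (D : Set (Finset V)) : Set V := {v | ∃ t ∈ D, v ∈ t}

/-- The edges of the triangles of `D`. -/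
def edges (D : Set (Finset V)) : Set (Finset V) := {e | e.card = 2 ∧ ∃ t ∈ D, e ⊆ t}

theorem Lft.mem_verts {D : Set (Finset V)} {a b : V} (h : Lft O D a b) : a ∈ verts D := by
  obtain ⟨c, _, hc⟩ := h
  exact ⟨_, hc, by simp⟩

theorem Lft.mem_edges (hO : IsOrientation K O) {D : Set (Finset V)} {a b : V} (h : Lft O D a b) :
    {a, b} ∈ edges D := by
  refine ⟨Finset.card_pair (h.adj hO).1, ?_⟩
  obtain ⟨c, _, hc⟩ := h
  exact ⟨_, hc, by intro x; simp; tauto⟩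

theorem exists_dart_of_mem (hO : IsOrientation K O) {D : Set (Finset V)}
    (hD : ∀ t ∈ D, t ∈ K.faces ∧ t.card = 3) {t : Finset V} (ht : t ∈ D) {v : V} (hv : v ∈ t) :
    ∃ b, Lft O D v b := by
  obtain ⟨w, hw, hwv⟩ := Finset.exists_mem_ne (by have := (hD t ht).2; omega : 1 < t.card) v
  obtain ⟨c, hcv, hcw, rfl⟩ := exists_third hwv.symm
    (by intro x; simp; rintro (rfl | rfl) <;> assumption : {v, w} ⊆ t) (hD t ht).2
  rcases hO.or (⟨hwv.symm, hcw.symm, hcv.symm, (hD _ ht).1⟩ : IsTriangle K v w c) with h | h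
  · exact ⟨w, c, h, ht⟩
  · exact ⟨c, w, hO.rot h, by rwa [Finset.pair_comm c w]⟩

theorem exists_dart_of_edge (hO : IsOrientation K O) {D : Set (Finset V)}
    (hD : ∀ t ∈ D, t ∈ K.faces ∧ t.card = 3) {e : Finset V} (he : e ∈ edges D) :
    ∃ a b, Lft O D a b ∧ e = {a, b} := by
  obtain ⟨h2, t, ht, hsub⟩ := he
  obtain ⟨a, b, hab, rfl⟩ := Finset.card_eq_two.mp h2
  obtain ⟨c, hca, hcb, rfl⟩ := exists_third hab hsub (hD t ht).2
  rcases hO.or (⟨hab, hcb.symm, hca.symm, (hD _ ht).1⟩ : IsTriangle K a b c) with h | h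
  · exact ⟨a, b, ⟨c, h, ht⟩, rfl⟩
  · exact ⟨b, a, ⟨c, h, by rwa [triple_swap]⟩, Finset.pair_comm _ _⟩

/-- Around a vertex off the boundary, all triangles are in the region if one of them is. -/
theorem IsRegion.lft_all (hK : IsTriangulatedTorus K) (hO : IsOrientation K O)
    {D : Set (Finset V)} {n : ℕ} {u : ZMod n → V} (h : IsRegion K O D u) {a b : V}
    (ha : a ∉ Set.range u) (hl : Lft O D a b) : ∀ z, Adj K a z → Lft O D a z ∧ Lft O D z a := by
  have h1 : ∀ z, Lft O D a z → Lft O D z a := by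
    intro z hz
    by_contra hc
    obtain ⟨i, rfl, -⟩ := h.only a z ⟨hz, hc⟩
    exact ha ⟨i, rfl⟩
  have h2 : ∀ z, Lft O D z a → Lft O D a z := by
    intro z hz
    by_contra hc
    obtain ⟨i, -, rfl⟩ := h.only z a ⟨hz, hc⟩
    exact ha ⟨i + 1, rfl⟩
  have h3 := link_forward hK hO (P := fun z => Lft O D a z) (hl.adj hO) hl
    fun z w ho hz => h2 w ((hO.lft_rot (hO.rot ho)).mp ((hO.lft_rot ho).mp hz))
  exact fun z hz => ⟨h3 z hz, h1 z (h3 z hz)⟩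

theorem IsOrientation.cyclic (hO : IsOrientation K O) {a b c p q r : V} (h : O a b c)
    (h' : O p q r) (e : ({a, b, c} : Finset V) = {p, q, r}) :
    (a = p ∧ b = q) ∨ (a = q ∧ b = r) ∨ (a = r ∧ b = p) := by
  have ha : a ∈ ({p, q, r} : Finset V) := by rw [← e]; simp
  have hb : b ∈ ({p, q, r} : Finset V) := by rw [← e]; simp
  have hc : c ∈ ({p, q, r} : Finset V) := by rw [← e]; simp
  have ht := hO.tri h
  obtain ⟨h1, h2, h3, -⟩ := ht
  have n1 := fun x => hO.not_both h' (c := r) x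
  have n2 := fun x => hO.not_both (hO.rot h') (c := p) x
  have n3 := fun x => hO.not_both (hO.rot (hO.rot h')) (c := q) x
  simp only [Finset.mem_insert, Finset.mem_singleton] at ha hb hc
  rcases ha with rfl | rfl | rfl <;> rcases hb with rfl | rfl | rfl <;>
    first
    | (exact absurd rfl h1)
    | (simp; done)
    | (rcases hc with rfl | rfl | rfl <;> simp_all)

theorem faceRot_sameCycle (hO : IsOrientation K O) {D : Set (Finset V)} (x y : Dart O D) :
    ({x.1.1, x.1.2, x.apex} : Finset V) = {y.1.1, y.1.2, y.apex} ↔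
      (faceRot hO D).SameCycle x y := by
  constructor
  · intro hxy
    rcases hO.cyclic x.apex_spec y.apex_spec hxy with ⟨h1, h2⟩ | ⟨h1, h2⟩ | ⟨h1, h2⟩
    · rw [show x = y from Subtype.ext (Prod.ext h1 h2)]
    · rw [show x = faceRot hO D y from Subtype.ext (Prod.ext h1 h2),
        Equiv.Perm.sameCycle_apply_left]
    · rw [show x = (faceRot hO D)⁻¹ y from Subtype.ext (Prod.ext h1 h2)]
      exact ⟨1, by simp⟩
  · intro h
    refine sameCycle_imp_eq (p := fun x : Dart O D => ({x.1.1, x.1.2, x.apex} : Finset V)) ?_ h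
    intro d
    have h1 := Dart.apex_spec (faceRot hO D d)
    have := hO.uniq h1 (hO.rot d.apex_spec)
    simp only [this]
    exact triple_rotate d.1.1 d.1.2 d.apex

theorem edgeFlip_sameCycle {D : Set (Finset V)} (x y : Dart O D) :
    ({x.1.1, x.1.2} : Finset V) = {y.1.1, y.1.2} ↔ (edgeFlip O D).SameCycle x y := by
  constructor
  · intro hxy
    obtain ⟨⟨a, b⟩, hl⟩ := x
    obtain ⟨⟨p, q⟩, hl'⟩ := y
    rcases pair_eq hxy with ⟨rfl, rfl⟩ | ⟨rfl, rfl⟩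
    · rfl
    · rw [← edgeFlip_apply hl hl', Equiv.Perm.sameCycle_apply_right]
  · intro h
    refine sameCycle_imp_eq (p := fun x : Dart O D => ({x.1.1, x.1.2} : Finset V)) ?_ h
    rintro ⟨⟨a, b⟩, hl⟩
    by_cases hb : Lft O D b a
    · rw [edgeFlip_apply hl hb]; exact Finset.pair_comm _ _
    · rw [edgeFlip_apply_of_not hl hb]

theorem turn_interior (hO : IsOrientation K O) {D : Set (Finset V)} {a b c : V} (hl : Lft O D a b)
    (h : Lft O D b a) (ho : O b a c) :
    (faceRot hO D * edgeFlip O D) ⟨(a, b), hl⟩ = ⟨(a, c), (hO.lft_rot ho).mp h⟩ := by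
  rw [Equiv.Perm.mul_apply, edgeFlip_apply hl h, faceRot_apply hO ho]

theorem turn_boundary (hO : IsOrientation K O) {D : Set (Finset V)} {a b c : V}
    (hl : Lft O D a b) (h : ¬ Lft O D b a) (ho : O a b c) :
    (faceRot hO D * edgeFlip O D) ⟨(a, b), hl⟩ = ⟨(b, c), (hO.lft_rot ho).mp hl⟩ := by
  rw [Equiv.Perm.mul_apply, edgeFlip_apply_of_not hl h, faceRot_apply hO ho]

/-- The orbits of the permutation that turns around the vertices: one for each interior vertex,
and one for all the vertices on the boundary loop together. -/
theorem turn_sameCycle (hK : IsTriangulatedTorus K) (hO : IsOrientation K O)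
    {D : Set (Finset V)} {n : ℕ} {u : ZMod n → V} (h : IsRegion K O D u) (x y : Dart O D) :
    (x.1.1 = y.1.1 ∨ (x.1.1 ∈ Set.range u ∧ y.1.1 ∈ Set.range u)) ↔
      (faceRot hO D * edgeFlip O D).SameCycle x y := by
  have := h.loop.neZero
  set π := faceRot hO D * edgeFlip O D with hπ
  constructor
  · -- all darts that start at the same boundary vertex are in the orbit of the boundary dart
    have hb : ∀ i z (hz : Lft O D (u i) z),
        π.SameCycle ⟨(u i, z), hz⟩ ⟨(u i, u (i + 1)), (h.fwd i).1⟩ := by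
      intro i z hz
      refine link_forward hK hO (P := fun z => ∀ hz : Lft O D (u i) z,
        π.SameCycle ⟨(u i, z), hz⟩ ⟨(u i, u (i + 1)), (h.fwd i).1⟩) (h.loop.adj i)
        (fun _ => .refl _ _) ?_ z (hz.adj hO) hz
      intro z w ho hP hw
      by_cases hw' : Lft O D w (u i)
      · rw [← Equiv.Perm.sameCycle_apply_left, hπ, turn_interior hO hw hw' (hO.rot (hO.rot ho))]
        exact hP _
      · obtain ⟨j, hj, rfl⟩ := h.only _ _ ⟨hw, hw'⟩
        have := h.loop.inj hj
        subst this
        exact .refl _ _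
    have hall : ∀ i, π.SameCycle ⟨(u 0, u (0 + 1)), (h.fwd 0).1⟩
        ⟨(u i, u (i + 1)), (h.fwd i).1⟩ := by
      refine ZMod.forall_of_succ 0 (.refl _ _) fun i hi => ?_
      refine hi.trans ?_
      obtain ⟨c, hc, -⟩ := (h.fwd i).1
      rw [← Equiv.Perm.sameCycle_apply_left, hπ, turn_boundary hO (h.fwd i).1 (h.fwd i).2 hc]
      exact hb (i + 1) c _
    rintro (hxy | ⟨⟨i, hi⟩, ⟨j, hj⟩⟩)
    · obtain ⟨⟨a, b⟩, hl⟩ := x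
      obtain ⟨⟨p, q⟩, hl'⟩ := y
      have hxy : a = p := hxy
      subst hxy
      by_cases ha : a ∈ Set.range u
      · obtain ⟨i, rfl⟩ := ha
        exact (hb i b hl).trans (hb i q hl').symm
      · have hint := h.lft_all hK hO ha hl
        refine link_forward hK hO (P := fun z => ∀ hz : Lft O D a z,
          π.SameCycle ⟨(a, z), hz⟩ ⟨(a, q), hl'⟩) (hl'.adj hO) (fun _ => .refl _ _) ?_ b
          (hl.adj hO) hl
        intro z w ho hP hw
        rw [← Equiv.Perm.sameCycle_apply_left, hπ,
          turn_interior hO hw (hint w (hw.adj hO)).2 (hO.rot (hO.rot ho))]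
        exact hP _
    · obtain ⟨⟨a, b⟩, hl⟩ := x
      obtain ⟨⟨p, q⟩, hl'⟩ := y
      subst hi hj
      exact (hb i b hl).trans ((hall i).symm.trans ((hall j).trans (hb j q hl').symm))
  · intro hs
    have key := sameCycle_imp_eq (p := fun x : Dart O D =>
      ({v | v = x.1.1 ∨ (x.1.1 ∈ Set.range u ∧ v ∈ Set.range u)} : Set V)) ?_ hs
    · have : x.1.1 ∈ ({v | v = y.1.1 ∨ (y.1.1 ∈ Set.range u ∧ v ∈ Set.range u)} : Set V) := by
        rw [← key]; exact Or.inl rfl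
      rcases this with h1 | h1
      · exact Or.inl h1
      · exact Or.inr h1.symm
    rintro ⟨⟨a, b⟩, hl⟩
    by_cases hb : Lft O D b a
    · obtain ⟨c, hc, -⟩ := id hb
      rw [hπ, turn_interior hO hl hb hc]
    · obtain ⟨c, hc, -⟩ := id hl
      rw [hπ, turn_boundary hO hl hb hc]
      obtain ⟨i, rfl, rfl⟩ := h.only _ _ ⟨hl, hb⟩
      ext v
      constructor
      · rintro (rfl | h1)
        · exact Or.inr ⟨⟨_, rfl⟩, ⟨_, rfl⟩⟩
        · exact Or.inr ⟨⟨_, rfl⟩, h1.2⟩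
      · rintro (rfl | h1)
        · exact Or.inr ⟨⟨_, rfl⟩, ⟨_, rfl⟩⟩
        · exact Or.inr ⟨⟨_, rfl⟩, h1.2⟩

/-- The Euler characteristic of a region bounded by a single loop is odd. -/
theorem IsRegion.odd_euler (hK : IsTriangulatedTorus K) (hO : IsOrientation K O)
    {D : Set (Finset V)} {n : ℕ} {u : ZMod n → V} (h : IsRegion K O D u) :
    Odd (((verts D).ncard : ℤ) - ((edges D).ncard : ℤ) + (D.ncard : ℤ)) := by
  classical
  have := hK.finite
  have := h.loop.neZero
  have := Fintype.ofFinite (Dart O D)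
  set φ := faceRot hO D
  set τ := edgeFlip O D
  have s1 : Equiv.Perm.sign φ = (-1) ^ (Nat.card (Dart O D) + Nat.card D) := by
    refine sign_eq_of_orbits (p := fun d => ⟨_, d.apex_mem⟩) ?_ fun x y => ?_
    · rintro ⟨t, ht⟩
      have hn : t.Nonempty := Finset.card_pos.mp (by rw [(h.tri t ht).2]; norm_num)
      obtain ⟨a, b, c, hab, hac, hbc, rfl⟩ := Finset.card_eq_three.mp (h.tri t ht).2
      rcases hO.or (⟨hab, hbc, hac, (h.tri _ ht).1⟩ : IsTriangle K a b c) with ho | ho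
      · let d : Dart O D := ⟨(a, b), ⟨c, ho, ht⟩⟩
        have e : d.apex = c := hO.uniq d.apex_spec ho
        exact ⟨d, Subtype.ext (by simp only [e, d])⟩
      · let d : Dart O D := ⟨(b, a), ⟨c, ho, by rwa [triple_swap]⟩⟩
        have e : d.apex = c := hO.uniq d.apex_spec ho
        exact ⟨d, Subtype.ext (by simp only [e, d]; exact triple_swap _ _ _)⟩
    · rw [← faceRot_sameCycle, Subtype.mk.injEq]
  have s2 : Equiv.Perm.sign τ = (-1) ^ (Nat.card (Dart O D) + Nat.card (edges D)) := by
    refine sign_eq_of_orbits (p := fun d => ⟨_, d.2.mem_edges hO⟩) ?_ fun x y => ?_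
    · rintro ⟨e, he⟩
      obtain ⟨a, b, hl, rfl⟩ := exists_dart_of_edge hO h.tri he
      exact ⟨⟨(a, b), hl⟩, rfl⟩
    · rw [← edgeFlip_sameCycle, Subtype.mk.injEq]
  have s3 : Equiv.Perm.sign (φ * τ) =
      (-1) ^ (Nat.card (Dart O D) + Nat.card (Option ↥(verts D \ Set.range u))) := by
    refine sign_eq_of_orbits (p := fun d => if hd : d.1.1 ∈ Set.range u then none else
      some ⟨d.1.1, d.2.mem_verts, hd⟩) ?_ fun x y => ?_
    · rintro (_ | ⟨v, ⟨t, ht, hv⟩, hvu⟩)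
      · exact ⟨⟨(u 0, u (0 + 1)), (h.fwd 0).1⟩, by simp⟩
      · obtain ⟨b, hb⟩ := exists_dart_of_mem hO h.tri ht hv
        exact ⟨⟨(v, b), hb⟩, dif_neg hvu⟩
    · rw [← turn_sameCycle hK hO h]
      by_cases hx : x.1.1 ∈ Set.range u <;> by_cases hy : y.1.1 ∈ Set.range u
      · rw [dif_pos hx, dif_pos hy]
        exact ⟨fun _ => Or.inr ⟨hx, hy⟩, fun _ => rfl⟩
      · rw [dif_pos hx, dif_neg hy]
        refine ⟨fun he => absurd he (by simp), ?_⟩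
        rintro (he | he)
        · rw [he] at hx; exact absurd hx hy
        · exact absurd he.2 hy
      · rw [dif_neg hx, dif_pos hy]
        refine ⟨fun he => absurd he (by simp), ?_⟩
        rintro (he | he)
        · rw [he] at hx; exact absurd hy hx
        · exact absurd he.1 hx
      · rw [dif_neg hx, dif_neg hy, Option.some.injEq]
        exact ⟨fun he => Or.inl (congrArg Subtype.val he),
          fun he => Subtype.ext (he.resolve_right fun h' => hx h'.1)⟩
  have hφ : Equiv.Perm.sign φ = 1 := by
    have h3 : Equiv.Perm.sign φ ^ 3 = 1 := by
      rw [← map_pow, faceRot_cube, map_one]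
    rcases Int.units_eq_one_or (Equiv.Perm.sign φ) with h' | h'
    · exact h'
    · rw [h'] at h3; exact absurd h3 (by decide)
  -- the darts fixed by the edge flip are the `n` boundary darts
  have hfix : Nat.card (Dart O D) % 2 = n % 2 := by
    let f : Function.End (Dart O D) := fun d => τ d
    have h2 : f ^ 2 ^ 1 = 1 := by
      funext d
      exact edgeFlip_edgeFlip d
    have h3 := Equiv.Perm.card_fixedPoints_modEq (p := 2) h2
    rw [Nat.card_eq_fintype_card, h3, ← ZMod.card n]
    congr 1
    symm
    refine Fintype.card_congr (Equiv.ofBijective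
      (fun i => ⟨⟨(u i, u (i + 1)), (h.fwd i).1⟩, edgeFlip_apply_of_not _ (h.fwd i).2⟩) ⟨?_, ?_⟩)
    · intro i j hij
      exact h.loop.inj (congrArg (fun d => d.1.1.1) hij)
    · rintro ⟨⟨⟨a, b⟩, hl⟩, hd⟩
      have hb : ¬ Lft O D b a := by
        intro hb
        have hd' : edgeFlip O D ⟨(a, b), hl⟩ = ⟨(a, b), hl⟩ := hd
        rw [edgeFlip_apply hl hb] at hd'
        exact (hl.adj hO).1 (congrArg (fun d : Dart O D => d.1.2) hd')
      obtain ⟨i, rfl, rfl⟩ := h.only a b ⟨hl, hb⟩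
      exact ⟨i, rfl⟩
  have hv : (verts D).ncard = (verts D \ Set.range u).ncard + n := by
    have hsub : Set.range u ⊆ verts D := by
      rintro _ ⟨i, rfl⟩
      exact (h.fwd i).1.mem_verts
    have hr : (Set.range u).ncard = n := by
      rw [← Set.image_univ, Set.ncard_image_of_injective _ h.loop.inj, Set.ncard_univ]
      simp
    have := Set.ncard_sdiff_add_ncard_of_subset hsub
    omega
  rw [map_mul, hφ, one_mul, s2] at s3
  rw [s1] at hφ
  rw [Finite.card_option, Nat.card_coe_set_eq] at s3
  rw [Nat.card_coe_set_eq] at s3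
  rw [Nat.card_coe_set_eq] at hφ
  have p1 : (Nat.card (Dart O D) + D.ncard) % 2 = 0 := by
    have : ((-1 : ℤˣ)) ^ (Nat.card (Dart O D) + D.ncard) = 1 := hφ
    exact Nat.even_iff.mp ((neg_one_pow_eq_one_iff_even (by decide)).mp this)
  have p2 : (Nat.card (Dart O D) + (edges D).ncard +
      (Nat.card (Dart O D) + ((verts D \ Set.range u).ncard + 1))) % 2 = 0 := by
    refine Nat.even_iff.mp ((neg_one_pow_eq_one_iff_even (R := ℤˣ) (by decide)).mp ?_)
    rw [pow_add, s3, ← pow_add, ← two_mul, pow_mul]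
    simp
  rw [Int.odd_iff]
  omega

/-! ### Regions with Euler characteristic one -/

theorem ncard_singletons {F : Set (Finset V)} :
    {s ∈ F | s.card = 1}.ncard = {v : V | {v} ∈ F}.ncard := by
  rw [← Set.ncard_image_of_injective _ (Finset.singleton_injective (α := V))]
  congr 1
  ext s
  constructor
  · rintro ⟨hs, h1⟩
    obtain ⟨v, rfl⟩ := Finset.card_eq_one.mp h1
    exact ⟨v, hs, rfl⟩
  · rintro ⟨v, hv, rfl⟩
    exact ⟨hv, Finset.card_singleton v⟩

theorem eulerChar_closure {D : Set (Finset V)} (hD : ∀ t ∈ D, t ∈ K.faces ∧ t.card = 3) :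
    eulerChar {s : Finset V | s.Nonempty ∧ ∃ t ∈ D, s ⊆ t} =
      ((verts D).ncard : ℤ) - ((edges D).ncard : ℤ) + (D.ncard : ℤ) := by
  have h2 : {s : Finset V | (s ∈ {s : Finset V | s.Nonempty ∧ ∃ t ∈ D, s ⊆ t}) ∧ s.card = 2} =
      edges D := by
    ext s
    constructor
    · rintro ⟨⟨_, h⟩, h2⟩; exact ⟨h2, h⟩
    · rintro ⟨h2, h⟩; exact ⟨⟨Finset.card_pos.mp (by omega), h⟩, h2⟩
  have h3 : {s : Finset V | (s ∈ {s : Finset V | s.Nonempty ∧ ∃ t ∈ D, s ⊆ t}) ∧ s.card = 3} =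
      D := by
    ext s
    constructor
    · rintro ⟨⟨_, t, ht, hst⟩, h2⟩
      rwa [Finset.eq_of_subset_of_card_le hst (by rw [h2, (hD t ht).2])]
    · intro h
      exact ⟨⟨Finset.card_pos.mp (by have := (hD s h).2; omega), s, h, subset_rfl⟩, (hD s h).2⟩
  rw [eulerChar, ncard_singletons, h2, h3]
  congr 4
  ext v
  simp [verts]

theorem exists_tri_of_face (hK : IsTriangulatedTorus K) {s : Finset V} (hs : s ∈ K.faces)
    (D : Set (Finset V)) : (∃ t ∈ D, s ⊆ t) ∨ ∃ t ∈ triCompl K D, s ⊆ t := by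
  obtain ⟨t, ht, hst, h3⟩ := hK.pure s hs
  by_cases h : t ∈ D
  · exact Or.inl ⟨t, h, hst⟩
  · exact Or.inr ⟨t, ⟨ht, h3, h⟩, hst⟩

theorem IsLoop.ncard_range {n : ℕ} {u : ZMod n → V} (h : IsLoop K n u) :
    (Set.range u).ncard = n := by
  rw [← Set.image_univ, Set.ncard_image_of_injective _ h.inj, Set.ncard_univ]
  simp

theorem IsLoop.ncard_range_edges {n : ℕ} {u : ZMod n → V} (h : IsLoop K n u) :
    (Set.range (fun i => ({u i, u (i + 1)} : Finset V))).ncard = n := by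
  rw [← Set.image_univ, Set.ncard_image_of_injective, Set.ncard_univ]
  · simp
  · intro i j hij
    rcases pair_eq hij with ⟨h1, -⟩ | ⟨h1, h2⟩
    · exact h.inj h1
    · have e1 := h.inj h1
      have e2 := h.inj h2
      refine absurd ?_ h.two_ne
      have : i + 1 + 1 = i := by rw [e2, ← e1]
      linear_combination this

/-- The Euler characteristics of the two sides of a loop add up to zero. -/
theorem IsRegion.euler_add (hK : IsTriangulatedTorus K) (hO : IsOrientation K O)
    {D : Set (Finset V)} {n : ℕ} {u : ZMod n → V} (h : IsRegion K O D u) :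
    (((verts D).ncard : ℤ) - ((edges D).ncard : ℤ) + (D.ncard : ℤ)) +
      (((verts (triCompl K D)).ncard : ℤ) - ((edges (triCompl K D)).ncard : ℤ) +
        ((triCompl K D).ncard : ℤ)) = 0 := by
  have := hK.finite
  have hc : ∀ t ∈ triCompl K D, t ∈ K.faces ∧ t.card = 3 := fun t ht => ⟨ht.1, ht.2.1⟩
  have hnot : ∀ {a b}, Lft O (triCompl K D) a b → ¬ Lft O D a b := by
    intro a b hl
    obtain ⟨c, hc, -⟩ := id hl
    exact (lft_triCompl hO hc).mp hl
  have hyes : ∀ i, Lft O (triCompl K D) (u (i + 1)) (u i) := by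
    intro i
    obtain ⟨c, hc⟩ := exists_left hK hO (h.loop.adj i).symm
    exact (lft_triCompl hO hc).mpr (h.fwd i).2
  have v1 := Set.ncard_union_add_ncard_inter (verts D) (verts (triCompl K D))
  have e1 := Set.ncard_union_add_ncard_inter (edges D) (edges (triCompl K D))
  have t1 := Set.ncard_union_add_ncard_inter D (triCompl K D)
  have v2 : verts D ∪ verts (triCompl K D) = {v | {v} ∈ K.faces} := by
    ext v
    refine ⟨fun _ => K.singleton_mem v, fun hv => ?_⟩
    rcases exists_tri_of_face hK hv D with ⟨t, ht, hvt⟩ | ⟨t, ht, hvt⟩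
    · exact Or.inl ⟨t, ht, hvt (by simp)⟩
    · exact Or.inr ⟨t, ht, hvt (by simp)⟩
  have v3 : verts D ∩ verts (triCompl K D) = Set.range u := by
    ext v
    constructor
    · rintro ⟨⟨t, ht, hv⟩, t', ht', hv'⟩
      by_contra hvu
      obtain ⟨b, hb⟩ := exists_dart_of_mem hO h.tri ht hv
      obtain ⟨b', hb'⟩ := exists_dart_of_mem hO hc ht' hv'
      exact hnot hb' (h.lft_all hK hO hvu hb b' (hb'.adj hO)).1
    · rintro ⟨i, rfl⟩
      refine ⟨(h.fwd i).1.mem_verts, ?_⟩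
      have := hyes (i - 1)
      rw [sub_add_cancel] at this
      exact this.mem_verts
  have e2 : edges D ∪ edges (triCompl K D) = {s ∈ K.faces | s.card = 2} := by
    ext e
    constructor
    · rintro (⟨h2, t, ht, het⟩ | ⟨h2, t, ht, het⟩)
      · exact ⟨faces_of_subset (h.tri t ht).1 het (Finset.card_pos.mp (by omega)), h2⟩
      · exact ⟨faces_of_subset ht.1 het (Finset.card_pos.mp (by omega)), h2⟩
    · rintro ⟨he, h2⟩
      rcases exists_tri_of_face hK he D with ⟨t, ht, hvt⟩ | ⟨t, ht, hvt⟩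
      · exact Or.inl ⟨h2, t, ht, hvt⟩
      · exact Or.inr ⟨h2, t, ht, hvt⟩
  have e3 : edges D ∩ edges (triCompl K D) =
      Set.range (fun i => ({u i, u (i + 1)} : Finset V)) := by
    ext e
    constructor
    · rintro ⟨he, he'⟩
      obtain ⟨a, b, hl, rfl⟩ := exists_dart_of_edge hO h.tri he
      obtain ⟨p, q, hl', hpq⟩ := exists_dart_of_edge hO hc he'
      rcases pair_eq hpq with ⟨rfl, rfl⟩ | ⟨rfl, rfl⟩
      · exact absurd hl (hnot hl')
      · obtain ⟨i, rfl, rfl⟩ := h.only _ _ ⟨hl, hnot hl'⟩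
        exact ⟨i, rfl⟩
    · rintro ⟨i, rfl⟩
      refine ⟨(h.fwd i).1.mem_edges hO, ?_⟩
      have := (hyes i).mem_edges hO
      rwa [Finset.pair_comm] at this
  have t2 : D ∪ triCompl K D = {s ∈ K.faces | s.card = 3} := by
    ext t
    constructor
    · rintro (ht | ht)
      · exact h.tri t ht
      · exact hc t ht
    · rintro ⟨ht, h3⟩
      by_cases htD : t ∈ D
      · exact Or.inl htD
      · exact Or.inr ⟨ht, h3, htD⟩
  have t3 : D ∩ triCompl K D = ∅ := by
    ext t
    simp only [Set.mem_inter_iff, Set.mem_empty_iff_false, iff_false]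
    exact fun ht => ht.2.2.2 ht.1
  have hE := hK.euler
  rw [eulerChar, ncard_singletons] at hE
  rw [v2, v3, h.loop.ncard_range] at v1
  rw [e2, e3, h.loop.ncard_range_edges] at e1
  rw [t2, t3, Set.ncard_empty] at t1
  omega

theorem reach_in_triangle {E : Set (Finset V)} {t : Finset V}
    (hE : ∀ e : Finset V, e.card = 2 → e ⊆ t → e ∈ E) {x y : V} (hx : x ∈ t) (hy : y ∈ t) :
    Relation.ReflTransGen (fun a b => ({a, b} : Finset V) ∈ E) x y := by
  by_cases hxy : x = y
  · rw [hxy]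
  · exact .single (hE _ (Finset.card_pair hxy)
      (by intro z; simp; rintro (rfl | rfl) <;> assumption))

/-- The region can be collapsed onto a connected graph that contains all its vertices, by removing
each triangle together with one of its edges, starting at the boundary. -/
theorem IsRegion.collapse (hK : IsTriangulatedTorus K) (hO : IsOrientation K O)
    {D : Set (Finset V)} {n : ℕ} {u : ZMod n → V} (h : IsRegion K O D u) (m : ℕ)
    (hm : m ≤ D.ncard) :
    ∃ S ⊆ D, ∃ E ⊆ edges D, S.ncard = m ∧ E.ncard + m = (edges D).ncard ∧
      (∀ t ∈ D, t ∉ S → ∀ e : Finset V, e.card = 2 → e ⊆ t → e ∈ E) ∧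
      ∀ x ∈ verts D, ∀ y ∈ verts D,
        Relation.ReflTransGen (fun a b => ({a, b} : Finset V) ∈ E) x y := by
  have := hK.finite
  induction m with
  | zero =>
    refine ⟨∅, Set.empty_subset _, edges D, subset_rfl, by simp, by simp,
      fun t ht _ e h2 het => ⟨h2, t, ht, het⟩, ?_⟩
    rintro x ⟨s, hs, hx⟩ y ⟨t, ht, hy⟩
    have hst := h.connected hK hO s hs t ht
    have hin : ∀ t ∈ D, ∀ x ∈ t, ∀ y ∈ t,
        Relation.ReflTransGen (fun a b => ({a, b} : Finset V) ∈ edges D) x y :=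
      fun t ht x hx y hy => reach_in_triangle (E := edges D)
        (fun e h2 het => ⟨h2, t, ht, het⟩) hx hy
    clear ht
    induction hst generalizing y with
    | refl => exact hin s hs x hx y hy
    | tail _ hbc ih =>
      obtain ⟨z, hz⟩ := Finset.card_pos.mp (by rw [hbc.2.2]; norm_num)
      rw [Finset.mem_inter] at hz
      exact (ih z hz.1).trans (hin _ hbc.2.1 z hz.2 y hy)
  | succ m ih =>
    obtain ⟨S, hSD, E, hED, hS, hE, hun, hconn⟩ := ih (by omega)
    -- a remaining triangle `t` with an edge `e` that lies in no other remaining triangle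
    obtain ⟨t, htD, htS, e, he2, het, hfree⟩ : ∃ t ∈ D, t ∉ S ∧ ∃ e : Finset V, e.card = 2 ∧
        e ⊆ t ∧ ∀ r ∈ D, r ∉ S → e ⊆ r → r = t := by
      by_cases hS0 : S = ∅
      · have h0 : ({u 0, u (0 + 1)} : Finset V) ∈
            {e : Finset V | e.card = 2 ∧ {t ∈ D | e ⊆ t}.ncard = 1} := by
          rw [bd_eq_edges hK hO h]; exact ⟨0, rfl⟩
        obtain ⟨t, ht⟩ := Set.ncard_eq_one.mp h0.2
        have htm : t ∈ {t ∈ D | {u 0, u (0 + 1)} ⊆ t} := by rw [ht]; rfl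
        refine ⟨t, htm.1, by simp [hS0], _, h0.1, htm.2, fun r hr _ hrt => ?_⟩
        have : r ∈ {t ∈ D | {u 0, u (0 + 1)} ⊆ t} := ⟨hr, hrt⟩
        rw [ht] at this; exact this
      · obtain ⟨s, hs⟩ := Set.nonempty_iff_ne_empty.mpr hS0
        obtain ⟨t, htD, htS⟩ : ∃ t ∈ D, t ∉ S := by
          by_contra hno
          push Not at hno
          have := Set.ncard_le_ncard (s := D) (t := S) hno
          omega
        have hst := h.connected hK hO s (hSD hs) t htD
        obtain ⟨p, q, hpq, hp, hq⟩ : ∃ p q, (p ∈ D ∧ q ∈ D ∧ (p ∩ q).card = 2) ∧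
            p ∈ S ∧ q ∉ S := by
          by_contra hno
          push Not at hno
          refine htS ?_
          clear htS
          induction hst with
          | refl => exact hs
          | tail _ hbc ih => exact hno _ _ hbc (ih hbc.1)
        refine ⟨q, hpq.2.1, hq, p ∩ q, hpq.2.2, Finset.inter_subset_right, fun r hr hrS hrt => ?_⟩
        have hf := faces_of_subset (h.tri p hpq.1).1 (Finset.inter_subset_left (s₂ := q))
          (Finset.card_pos.mp (by omega))
        have h2 := hK.edge _ hf hpq.2.2
        by_contra hrq
        have hne : p ≠ q := by rintro rfl; exact hq hp
        have hnr : p ≠ r := by rintro rfl; exact hrS hp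
        have h3 : ({p, q, r} : Set (Finset V)).ncard = 3 := by
          rw [Set.ncard_eq_three]
          exact ⟨p, q, r, hne, hnr, fun h => hrq h.symm, rfl⟩
        have h4 : ({p, q, r} : Set (Finset V)) ⊆ {t ∈ K.faces | p ∩ q ⊆ t ∧ t.card = 3} := by
          rintro x (rfl | rfl | rfl)
          · exact ⟨(h.tri _ hpq.1).1, Finset.inter_subset_left, (h.tri _ hpq.1).2⟩
          · exact ⟨(h.tri _ hpq.2.1).1, Finset.inter_subset_right, (h.tri _ hpq.2.1).2⟩
          · exact ⟨(h.tri _ hr).1, hrt, (h.tri _ hr).2⟩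
        have := Set.ncard_le_ncard h4
        omega
    have heE : e ∈ E := hun t htD htS e he2 het
    refine ⟨insert t S, Set.insert_subset htD hSD, E \ {e}, Set.sdiff_subset.trans hED, ?_, ?_,
      ?_, ?_⟩
    · rw [Set.ncard_insert_of_notMem htS, hS]
    · have := Set.ncard_sdiff_singleton_add_one heE
      omega
    · intro r hr hrS d hd2 hdr
      rw [Set.mem_insert_iff, not_or] at hrS
      refine ⟨hun r hr hrS.2 d hd2 hdr, ?_⟩
      rintro rfl
      exact hrS.1 (hfree r hr hrS.2 hdr)
    · intro x hx y hy
      obtain ⟨a, b, hab, rfl⟩ := Finset.card_eq_two.mp he2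
      obtain ⟨c, hca, hcb, rfl⟩ := exists_third hab het (h.tri t htD).2
      -- the removed edge is bypassed along the two other edges of the triangle
      have hac : ({a, c} : Finset V) ∈ E \ {{a, b}} := by
        refine ⟨hun _ htD htS _ (Finset.card_pair hca.symm) (by intro x; simp; tauto), ?_⟩
        intro he
        rcases pair_eq he with h' | h'
        · exact hcb h'.2
        · exact hab h'.1
      have hbc : ({c, b} : Finset V) ∈ E \ {{a, b}} := by
        refine ⟨hun _ htD htS _ (Finset.card_pair hcb) (by intro x; simp; tauto), ?_⟩
        intro he
        rcases pair_eq he with h' | h'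
        · exact hca h'.1
        · exact hcb h'.1
      have hxy := hconn x hx y hy
      clear hx hy
      induction hxy with
      | refl => exact .refl
      | @tail y z _ hyz ih =>
        by_cases he : ({y, z} : Finset V) = {a, b}
        · rcases pair_eq he with ⟨rfl, rfl⟩ | ⟨rfl, rfl⟩
          · exact (ih.tail hac).tail hbc
          · exact (ih.tail (by rw [Finset.pair_comm y c]; exact hbc)).tail
              (by rw [Finset.pair_comm c z]; exact hac)
        · exact ih.tail ⟨hyz, he⟩

/-- The Euler characteristic of a region bounded by a single loop is at most one. -/
theorem IsRegion.euler_le (hK : IsTriangulatedTorus K) (hO : IsOrientation K O)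
    {D : Set (Finset V)} {n : ℕ} {u : ZMod n → V} (h : IsRegion K O D u) :
    (verts D).ncard + D.ncard ≤ (edges D).ncard + 1 := by
  have := hK.finite
  obtain ⟨S, -, E, hED, -, hE, -, hconn⟩ := h.collapse hK hO D.ncard le_rfl
  let G : SimpleGraph (verts D) :=
    { Adj := fun x y => x ≠ y ∧ ({x.1, y.1} : Finset V) ∈ E
      symm := ⟨fun x y hxy => ⟨hxy.1.symm, by rw [Finset.pair_comm]; exact hxy.2⟩⟩
      loopless := ⟨fun x hx => hx.1 rfl⟩ }
  have hne : Nonempty (verts D) := ⟨⟨_, (h.fwd 0).1.mem_verts⟩⟩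
  have hG : G.Connected := by
    refine ⟨fun x y => ?_⟩
    have key : ∀ y, Relation.ReflTransGen (fun a b => ({a, b} : Finset V) ∈ E) x.1 y →
        ∃ hy : y ∈ verts D, G.Reachable x ⟨y, hy⟩ := by
      intro y hxy
      induction hxy with
      | refl => exact ⟨x.2, SimpleGraph.Reachable.refl _⟩
      | @tail b c _ hbc ih =>
        obtain ⟨hb, hr⟩ := ih
        obtain ⟨h2, t, ht, hsub⟩ := hED hbc
        refine ⟨⟨t, ht, hsub (by simp)⟩, hr.trans (SimpleGraph.Adj.reachable ⟨?_, hbc⟩)⟩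
        intro he
        have : b = c := congrArg Subtype.val he
        subst this
        simp at h2
    exact (key y.1 (hconn _ x.2 _ y.2)).2
  have h1 := hG.card_vert_le_card_edgeSet_add_one
  have h2 : Nat.card G.edgeSet ≤ Nat.card E := by
    let f : Sym2 (verts D) → Finset V :=
      Sym2.lift ⟨fun x y => ({x.1, y.1} : Finset V), fun x y => Finset.pair_comm _ _⟩
    refine Nat.card_le_card_of_injective (fun e : G.edgeSet => (⟨f e.1, ?_⟩ : E)) ?_
    · obtain ⟨e, he⟩ := e
      induction e with
      | h x y => exact he.2
    · rintro ⟨e, he⟩ ⟨e', he'⟩ hee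
      have hee : f e = f e' := congrArg Subtype.val hee
      apply Subtype.ext
      induction e with
      | h x y =>
        induction e' with
        | h z w =>
          rcases pair_eq hee with ⟨h1, h2⟩ | ⟨h1, h2⟩
          · have h1 := Subtype.ext h1
            have h2 := Subtype.ext h2
            subst h1 h2; rfl
          · have h1 := Subtype.ext h1
            have h2 := Subtype.ext h2
            subst h1 h2; exact Sym2.eq_swap
  rw [Nat.card_coe_set_eq] at h1
  rw [Nat.card_coe_set_eq E] at h2
  omega

/-- One of the two sides of a separating cycle is a disc. -/
theorem IsRegion.boundsDisc (hK : IsTriangulatedTorus K) (hO : IsOrientation K O)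
    {D : Set (Finset V)} {n : ℕ} {u : ZMod n → V} (h : IsRegion K O D u) {c : Cycle V}
    (hc : cycleEdges c = Set.range (fun i => ({u i, u (i + 1)} : Finset V))) :
    BoundsDisc K c := by
  have h' := h.reverse hK hO
  have e1 := h.odd_euler hK hO
  have e2 := h.euler_add hK hO
  have e3 := h.euler_le hK hO
  have e4 := h'.euler_le hK hO
  have hc' : Set.range (fun i => ({u (-i), u (-(i + 1))} : Finset V)) = cycleEdges c := by
    rw [hc]
    ext e
    constructor
    · rintro ⟨i, rfl⟩
      exact ⟨-(i + 1), by simp [Finset.pair_comm]⟩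
    · rintro ⟨i, rfl⟩
      exact ⟨-(i + 1), by simp [Finset.pair_comm]⟩
  obtain ⟨k, hk⟩ := e1
  by_cases hχ : ((verts D).ncard : ℤ) - ((edges D).ncard : ℤ) + (D.ncard : ℤ) = 1
  · exact ⟨D, h.tri, h.connected hK hO, by rw [eulerChar_closure h.tri, hχ],
      by rw [bd_eq_edges hK hO h, hc]⟩
  · refine ⟨triCompl K D, h'.tri, h'.connected hK hO, ?_, by rw [bd_eq_edges hK hO h', hc']⟩
    rw [eulerChar_closure h'.tri]
    omega

/-! ### Cycles that are homologous to zero bound discs -/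

/-- The antisymmetric function that counts how often a path runs through the edge from `x` to `y`,
with sign. -/
def pairInd (x y : V) : V → V → ℤ := fun p q =>
  (if p = x ∧ q = y then 1 else 0) - (if p = y ∧ q = x then 1 else 0)

theorem pairInd_antisymm (x y p q : V) : pairInd x y p q = - pairInd x y q p := by
  simp only [pairInd, and_comm (a := p = x), and_comm (a := p = y)]; ring

theorem pairInd_swap (x y p q : V) : pairInd x y p q = - pairInd y x p q := by
  simp only [pairInd]; ring

theorem sum_pairInd_edge {n : ℕ} [NeZero n] {u : ZMod n → V} (h : IsLoop K n u) (i : ZMod n) :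
    ∑ j, pairInd (u i) (u (i + 1)) (u j) (u (j + 1)) = 1 := by
  rw [Finset.sum_eq_single i]
  · have : ¬ (u i = u (i + 1) ∧ u (i + 1) = u i) := fun h' => (h.adj i).1 h'.1
    simp [pairInd, this]
  · intro j _ hj
    have h1 : ¬ (u j = u i ∧ u (j + 1) = u (i + 1)) := fun h' => hj (h.inj h'.1)
    have h2 : ¬ (u j = u (i + 1) ∧ u (j + 1) = u i) := by
      rintro ⟨h1, h2⟩
      have e1 := h.inj h1
      have e2 := h.inj h2
      exact h.two_ne (by rw [e1] at e2; linear_combination e2)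
    simp only [pairInd, if_neg h1, if_neg h2, sub_zero]
  · simp

theorem sum_pairInd_of_not_edge {n : ℕ} [NeZero n] {u : ZMod n → V} {x y : V}
    (h : ∀ i, ({x, y} : Finset V) ≠ {u i, u (i + 1)}) :
    ∑ j, pairInd x y (u j) (u (j + 1)) = 0 := by
  refine Finset.sum_eq_zero fun j _ => ?_
  have h1 : ¬ (u j = x ∧ u (j + 1) = y) := by
    rintro ⟨rfl, rfl⟩; exact h j rfl
  have h2 : ¬ (u j = y ∧ u (j + 1) = x) := by
    rintro ⟨rfl, rfl⟩; exact h j (Finset.pair_comm _ _)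
  simp only [pairInd, if_neg h1, if_neg h2, sub_zero]

/-- A cycle that is the boundary of a 2-chain modulo `m ≠ 1` bounds a disc: the chain is constant
on the parts into which the cycle cuts the surface, so that the cycle separates. -/
theorem boundsDisc_of_chain (hK : IsTriangulatedTorus K) (hO : IsOrientation K O) {c : Cycle V}
    (hc : IsCycle K c) {m : ℕ} (hm : m ≠ 1) (C : Finset V → ℤ)
    (hC : ∀ x y z w, O x y z → O y x w →
      (m : ℤ) ∣ cycleSum (pairInd x y) c - (C {x, y, z} - C {x, y, w})) : BoundsDisc K c := by
  obtain ⟨n, u, hu, -, hedges, hsum⟩ := hc.exists_loop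
  have hn := hu.neZero
  obtain ⟨z₀, hz₀⟩ := exists_left hK hO (hu.adj 0)
  let D : Set (Finset V) :=
    {t | (t ∈ K.faces ∧ t.card = 3) ∧ (m : ℤ) ∣ C t - C {u 0, u (0 + 1), z₀}}
  have hmem : ∀ {a b z}, O a b z →
      (Lft O D a b ↔ (m : ℤ) ∣ C {a, b, z} - C {u 0, u (0 + 1), z₀}) := by
    intro a b z hz
    have ht := hO.tri hz
    rw [hO.lft_iff hz]
    exact and_iff_right ⟨ht.2.2.2, Finset.card_eq_three.mpr ⟨a, b, z, ht.1, ht.2.2.1, ht.2.1, rfl⟩⟩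
  have hsub : ∀ a b, Bd O D a b → ∃ i, ({a, b} : Finset V) = {u i, u (i + 1)} := by
    intro a b hab
    by_contra hno
    push Not at hno
    obtain ⟨z, hz⟩ := exists_left hK hO (hab.1.adj hO)
    obtain ⟨w, hw⟩ := exists_left hK hO (hab.1.adj hO).symm
    have h1 := hC a b z w hz hw
    rw [hsum hn, sum_pairInd_of_not_edge hno] at h1
    refine hab.2 ((hmem hw).mpr ?_)
    rw [triple_swap a b w]
    have := (hmem hz).mp hab.1
    have e : C {a, b, w} - C {u 0, u (0 + 1), z₀} = (0 - (C {a, b, z} - C {a, b, w})) +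
        (C {a, b, z} - C {u 0, u (0 + 1), z₀}) := by ring
    rw [e]
    exact dvd_add h1 this
  have hex : ∃ a b, Bd O D a b := by
    refine ⟨u 0, u (0 + 1), (hmem hz₀).mpr (by simp), fun hr => hm ?_⟩
    obtain ⟨w, hw⟩ := exists_left hK hO (hu.adj 0).symm
    have h1 := (hmem hw).mp hr
    rw [triple_swap (u 0) (u (0 + 1)) w] at h1
    have h2 := hC _ _ _ _ hz₀ hw
    rw [hsum hn, sum_pairInd_edge hu 0] at h2
    have h3 := dvd_sub h2 h1
    ring_nf at h3
    exact Nat.dvd_one.mp (by exact_mod_cast h3)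
  rcases exists_isRegion hK hO hu (fun t ht => ht.1) hsub hex with h | h
  · exact h.boundsDisc hK hO hedges
  · refine h.boundsDisc hK hO ?_
    rw [hedges]
    ext e
    constructor
    · rintro ⟨i, rfl⟩
      exact ⟨-(i + 1), by simp [Finset.pair_comm]⟩
    · rintro ⟨i, rfl⟩
      exact ⟨-(i + 1), by simp [Finset.pair_comm]⟩

/-! ### Turning around a vertex -/

/-- Turning around `a` in the direction of the orientation, starting at the neighbour `x`, one
meets `q` before `p`. -/
inductive Before (O : V → V → V → Prop) (a p q : V) : V → Prop
  | last {x : V} (h : O a x q) (hp : x ≠ p) : Before O a p q x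
  | step {x y : V} (h : O a x y) (hp : x ≠ p) (hq : x ≠ q) (hy : y ≠ p)
      (hb : Before O a p q y) : Before O a p q x

theorem Before.ne_left {a p q x : V} (h : Before O a p q x) : x ≠ p := by
  cases h <;> assumption

theorem Before.not_before (hO : IsOrientation K O) {a p q x : V} (hpq : p ≠ q)
    (h : Before O a p q x) : ¬ Before O a q p x := by
  induction h with
  | last h hp =>
    intro h'
    cases h' with
    | last h1 _ => exact hpq (hO.uniq h1 h)
    | step h1 _ _ hy _ => exact hy (hO.uniq h1 h)
  | step h hp hq hy hb ih =>
    intro h'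
    cases h' with
    | last h1 _ => exact hy (hO.uniq h h1)
    | step h1 _ _ _ hb' => exact ih (hO.uniq h1 h ▸ hb')

theorem before_or (hK : IsTriangulatedTorus K) (hO : IsOrientation K O) {a p q x : V}
    (hq : Adj K a q) (hx : Adj K a x) :
    x = p ∨ x = q ∨ Before O a p q x ∨ Before O a q p x := by
  refine link_backward hK hO
    (P := fun x => x = p ∨ x = q ∨ Before O a p q x ∨ Before O a q p x) hq (by simp) ?_ x hx
  intro z w h hw
  by_cases hzp : z = p
  · exact Or.inl hzp
  by_cases hzq : z = q
  · exact Or.inr (Or.inl hzq)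
  by_cases hwp : w = p
  · subst hwp; exact Or.inr (Or.inr (Or.inr (.last h hzq)))
  by_cases hwq : w = q
  · subst hwq; exact Or.inr (Or.inr (Or.inl (.last h hzp)))
  rcases hw with hw | hw | hw | hw
  · exact absurd hw hwp
  · exact absurd hw hwq
  · exact Or.inr (Or.inr (Or.inl (.step h hzp hzq hwp hw)))
  · exact Or.inr (Or.inr (Or.inr (.step h hzq hzp hwq hw)))

theorem before_iff (hO : IsOrientation K O) {a p q x y : V} (h : O a x y) (hxp : x ≠ p)
    (hxq : x ≠ q) (hyp : y ≠ p) (hyq : y ≠ q) : Before O a p q x ↔ Before O a p q y := by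
  constructor
  · intro h'
    cases h' with
    | last h1 _ => exact absurd (hO.uniq h h1) hyq
    | step h1 _ _ _ hb => exact hO.uniq h1 h ▸ hb
  · exact .step h hxp hxq hyp

/-- The first neighbour after `p`. -/
theorem before_start (hK : IsTriangulatedTorus K) (hO : IsOrientation K O) {a p q x : V}
    (hpq : p ≠ q) (hq : Adj K a q) (h : O a p x) (hxq : x ≠ q) : Before O a p q x := by
  have ht := hO.tri h
  rcases before_or hK hO (p := p) hq ht.rotate.rotate.adj.symm with h1 | h1 | h1 | h1
  · exact absurd h1.symm ht.2.1
  · exact absurd h1 hxq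
  · exact h1
  -- otherwise the neighbours between `p` and `p` would be closed under rotation
  · have := link_forward hK hO (P := fun z => z = p ∨ Before O a q p z) ht.adj (Or.inl rfl) ?_ q hq
    · rcases this with h2 | h2
      · exact absurd h2.symm hpq
      · exact absurd rfl h2.ne_left
    intro z w hzw hz
    rcases hz with rfl | hz
    · right; rwa [hO.uniq hzw h]
    · cases hz with
      | last h2 _ => exact Or.inl (hO.uniq hzw h2)
      | step h2 _ _ _ hb => exact Or.inr (hO.uniq h2 hzw ▸ hb)

/-! ### The dual cocycle of an empty triangle -/

/-- `η` is a cocycle that counts, for a set `S` of vertices, the edges that leave `S` towards one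
of its two sides. -/
structure IsCut (K : AbstractSimplicialComplex V) (S : Set V) (η : V → V → ℤ) : Prop where
  cocycle : IsCocycle K η
  zero_in : ∀ x y, x ∈ S → y ∈ S → η x y = 0
  zero_out : ∀ x y, Adj K x y → x ∉ S → y ∉ S → η x y = 0
  vals : ∀ x y, Adj K x y → x ∈ S → y ∉ S → η x y = 0 ∨ η x y = 1

/-- The edge from the vertex `s` of the loop `u` to `x` leaves the loop on its left. -/
def LeftOf (O : V → V → V → Prop) (u : ZMod 3 → V) (s x : V) : Prop :=
  ∃ i, s = u i ∧ Before O (u i) (u (i + 1)) (u (i - 1)) x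

theorem IsLoop.leftOf_iff {u : ZMod 3 → V} (h : IsLoop K 3 u) (i : ZMod 3) (x : V) :
    LeftOf O u (u i) x ↔ Before O (u i) (u (i + 1)) (u (i - 1)) x := by
  constructor
  · rintro ⟨j, hj, hb⟩
    rw [h.inj hj]; exact hb
  · exact fun hb => ⟨i, rfl, hb⟩

theorem IsLoop.adj_pred {n : ℕ} {u : ZMod n → V} (h : IsLoop K n u) (i : ZMod n) :
    Adj K (u i) (u (i - 1)) := by
  have := (h.adj (i - 1)).symm
  rwa [sub_add_cancel] at this

theorem zmod_three_triple : ∀ i j k : ZMod 3, i ≠ j → j ≠ k → i ≠ k →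
    ({i, j, k} : Finset (ZMod 3)) = {0, 1, 2} := by decide

theorem zmod_three_pair : ∀ i j : ZMod 3, i ≠ j → j = i + 1 ∨ i = j + 1 := by decide

theorem pair_subset {x y : V} {t : Finset V} (hx : x ∈ t) (hy : y ∈ t) :
    ({x, y} : Finset V) ⊆ t :=
  Finset.insert_subset hx (Finset.singleton_subset_iff.mpr hy)

theorem triple_of_loop (u : ZMod 3 → V) {i j k : ZMod 3} (hij : i ≠ j) (hjk : j ≠ k)
    (hik : i ≠ k) : ({u i, u j, u k} : Finset V) = {u 0, u 1, u 2} := by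
  simpa [Finset.image_insert] using congrArg (Finset.image u) (zmod_three_triple i j k hij hjk hik)

theorem IsLoop.succ_ne_pred {u : ZMod 3 → V} (h : IsLoop K 3 u) (i : ZMod 3) :
    u (i + 1) ≠ u (i - 1) := by
  have : ∀ i : ZMod 3, i + 1 ≠ i - 1 := by decide
  exact fun h' => this i (h.inj h')

theorem IsLoop.mem_cases {u : ZMod 3 → V} {i : ZMod 3} {y : V} (hy : y ∈ Set.range u) :
    y = u i ∨ y = u (i + 1) ∨ y = u (i - 1) := by
  obtain ⟨j, rfl⟩ := hy
  have : j = i ∨ j = i + 1 ∨ j = i - 1 := by revert i j; decide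
  rcases this with rfl | rfl | rfl <;> simp

open Classical in
/-- The cocycle dual to a loop of length three: it counts the edges that leave the loop on its
left. -/
noncomputable def leftCocycle (O : V → V → V → Prop) (u : ZMod 3 → V) : V → V → ℤ := fun x y =>
  (if LeftOf O u x y ∧ x ∈ Set.range u ∧ y ∉ Set.range u then 1 else 0) -
    (if LeftOf O u y x ∧ y ∈ Set.range u ∧ x ∉ Set.range u then 1 else 0)

theorem leftOf_left (hK : IsTriangulatedTorus K) (hO : IsOrientation K O) {u : ZMod 3 → V}
    (h : IsLoop K 3 u) {i : ZMod 3} {z : V} (ho : O (u i) (u (i + 1)) z)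
    (hz : z ∉ Set.range u) : LeftOf O u (u i) z ∧ LeftOf O u (u (i + 1)) z := by
  rw [h.leftOf_iff, h.leftOf_iff]
  constructor
  · exact before_start hK hO (h.succ_ne_pred i) (h.adj_pred i) ho
      (fun h' => hz ⟨_, h'.symm⟩)
  · refine .last ?_ (fun h' => hz ⟨_, h'.symm⟩)
    rw [add_sub_cancel_right]
    exact hO.rot ho

theorem not_leftOf_right (hK : IsTriangulatedTorus K) (hO : IsOrientation K O) {u : ZMod 3 → V}
    (h : IsLoop K 3 u) {i : ZMod 3} {z : V} (ho : O (u (i + 1)) (u i) z)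
    (hz : z ∉ Set.range u) : ¬ LeftOf O u (u i) z ∧ ¬ LeftOf O u (u (i + 1)) z := by
  rw [h.leftOf_iff, h.leftOf_iff]
  constructor
  · refine Before.not_before hO (h.succ_ne_pred i).symm (.last (hO.rot ho) ?_)
    exact (fun h' => hz ⟨_, h'.symm⟩)
  · refine Before.not_before hO (h.succ_ne_pred (i + 1)).symm ?_
    refine before_start hK hO (h.succ_ne_pred (i + 1)).symm (h.adj (i + 1)) ?_
      (fun h' => hz ⟨_, h'.symm⟩)
    rw [add_sub_cancel_right]
    exact ho

theorem leftCocycle_antisymm (u : ZMod 3 → V) (x y : V) :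
    leftCocycle O u x y = - leftCocycle O u y x := by
  simp only [leftCocycle]; ring

theorem leftCocycle_in {u : ZMod 3 → V} {x y : V} (hx : x ∈ Set.range u) (hy : y ∈ Set.range u) :
    leftCocycle O u x y = 0 := by
  simp [leftCocycle, hx, hy]

theorem leftCocycle_out {u : ZMod 3 → V} {x y : V} (hx : x ∉ Set.range u)
    (hy : y ∉ Set.range u) : leftCocycle O u x y = 0 := by
  simp [leftCocycle, hx, hy]

open Classical in
theorem leftCocycle_spoke {u : ZMod 3 → V} {x y : V} (hx : x ∈ Set.range u)
    (hy : y ∉ Set.range u) : leftCocycle O u x y = if LeftOf O u x y then 1 else 0 := by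
  simp only [leftCocycle, hx, hy, not_true, not_false_eq_true, and_true, and_false, if_false,
    sub_zero]

theorem leftCocycle_spoke_eq (hO : IsOrientation K O) {u : ZMod 3 → V} (h : IsLoop K 3 u)
    {x y z : V} (ho : O x y z) (hx : x ∈ Set.range u) (hy : y ∉ Set.range u)
    (hz : z ∉ Set.range u) : leftCocycle O u x y = leftCocycle O u x z := by
  rw [leftCocycle_spoke hx hy, leftCocycle_spoke hx hz]
  obtain ⟨i, rfl⟩ := hx
  have key : LeftOf O u (u i) y ↔ LeftOf O u (u i) z := by
    rw [h.leftOf_iff, h.leftOf_iff]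
    exact before_iff hO ho (fun h' => hy ⟨_, h'.symm⟩) (fun h' => hy ⟨_, h'.symm⟩)
      (fun h' => hz ⟨_, h'.symm⟩) (fun h' => hz ⟨_, h'.symm⟩)
  by_cases hl : LeftOf O u (u i) y
  · rw [if_pos hl, if_pos (key.mp hl)]
  · rw [if_neg hl, if_neg (fun h' => hl (key.mpr h'))]

theorem leftCocycle_edge_eq (hK : IsTriangulatedTorus K) (hO : IsOrientation K O)
    {u : ZMod 3 → V} (h : IsLoop K 3 u) {x y z : V} (ho : O x y z) (hx : x ∈ Set.range u)
    (hy : y ∈ Set.range u) (hz : z ∉ Set.range u) :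
    leftCocycle O u x z = leftCocycle O u y z := by
  rw [leftCocycle_spoke hx hz, leftCocycle_spoke hy hz]
  obtain ⟨i, rfl⟩ := hx
  rcases IsLoop.mem_cases (i := i) hy with rfl | rfl | rfl
  · rfl
  · simp [leftOf_left hK hO h ho hz]
  · obtain ⟨j, rfl⟩ : ∃ j, i = j + 1 := ⟨i - 1, by ring⟩
    rw [add_sub_cancel_right] at ho ⊢
    simp [not_leftOf_right hK hO h ho hz]

/-- An empty triangle has a dual cocycle. -/
theorem isCut_leftCocycle (hK : IsTriangulatedTorus K) (hO : IsOrientation K O) {u : ZMod 3 → V}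
    (h : IsLoop K 3 u) (hf : ({u 0, u 1, u 2} : Finset V) ∉ K.faces) :
    IsCut K (Set.range u) (leftCocycle O u) where
  zero_in _ _ := leftCocycle_in
  zero_out _ _ _ := leftCocycle_out
  vals x y _ hx hy := by
    classical
    rw [leftCocycle_spoke hx hy]
    split_ifs <;> simp
  cocycle := by
    have key : ∀ a b c, O a b c →
        leftCocycle O u a b + leftCocycle O u b c + leftCocycle O u c a = 0 := by
      intro a b c ho
      have ho' := hO.rot ho
      have ho'' := hO.rot ho'
      have A := leftCocycle_antisymm (O := O) u
      by_cases ha : a ∈ Set.range u <;> by_cases hb : b ∈ Set.range u <;>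
        by_cases hc : c ∈ Set.range u
      · exfalso
        have ht := hO.tri ho
        obtain ⟨i, rfl⟩ := ha
        obtain ⟨j, rfl⟩ := hb
        obtain ⟨k, rfl⟩ := hc
        have hij : i ≠ j := fun h' => ht.1 (by rw [h'])
        have hjk : j ≠ k := fun h' => ht.2.1 (by rw [h'])
        have hik : i ≠ k := fun h' => ht.2.2.1 (by rw [h'])
        exact hf (triple_of_loop u hij hjk hik ▸ ht.2.2.2)
      · have := leftCocycle_edge_eq hK hO h ho ha hb hc
        rw [leftCocycle_in ha hb, A c a, this]; ring
      · have := leftCocycle_edge_eq hK hO h ho'' hc ha hb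
        rw [leftCocycle_in hc ha, A b c, this]; ring
      · have := leftCocycle_spoke_eq hO h ho ha hb hc
        rw [leftCocycle_out hb hc, A c a, this]; ring
      · have := leftCocycle_edge_eq hK hO h ho' hb hc ha
        rw [leftCocycle_in hb hc, A a b, this]; ring
      · have := leftCocycle_spoke_eq hO h ho' hb hc ha
        rw [leftCocycle_out hc ha, A a b, this]; ring
      · have := leftCocycle_spoke_eq hO h ho'' hc ha hb
        rw [leftCocycle_out ha hb, A b c, this]; ring
      · rw [leftCocycle_out ha hb, leftCocycle_out hb hc, leftCocycle_out hc ha]; ring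
    refine ⟨leftCocycle_antisymm u, fun a b c ht => ?_⟩
    rcases hO.or ht with ho | ho
    · exact key a b c ho
    · have := key b a c ho
      rw [leftCocycle_antisymm u a b, leftCocycle_antisymm u b c, leftCocycle_antisymm u c a]
      omega

/-- If the dual cocycle of an empty triangle is a coboundary, the empty triangle is the boundary
of a 2-chain. -/
theorem boundsDisc_of_isCobd (hK : IsTriangulatedTorus K) (hO : IsOrientation K O) {c : Cycle V}
    (hc : IsCycle K c) {u : ZMod 3 → V} (h : IsLoop K 3 u)
    (hsum : ∀ (_ : NeZero 3) (η : V → V → ℤ), cycleSum η c = ∑ i, η (u i) (u (i + 1)))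
    (hf : ({u 0, u 1, u 2} : Finset V) ∉ K.faces) (hco : IsCobd K (leftCocycle O u)) :
    BoundsDisc K c := by
  classical
  obtain ⟨f, hfun⟩ := hco
  have hsum := hsum inferInstance
  -- the value of the chain on a triangle is the value of `f` at any vertex off the loop
  let C : Finset V → ℤ := fun t => if ht : ∃ v ∈ t, v ∉ Set.range u then f ht.choose else 0
  have hC : ∀ t ∈ K.faces, ∀ v ∈ t, v ∉ Set.range u → C t = f v := by
    intro t ht v hv hvu
    have hex : ∃ v ∈ t, v ∉ Set.range u := ⟨v, hv, hvu⟩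
    have h1 : C t = f hex.choose := dif_pos hex
    obtain ⟨h2, h3⟩ := hex.choose_spec
    rw [h1]
    by_cases hne : hex.choose = v
    · rw [hne]
    · have h4 := hfun hex.choose v
        ⟨hne, faces_of_subset ht (pair_subset h2 hv) (by simp)⟩
      rw [leftCocycle_out h3 hvu] at h4
      omega
  have hnot : ∀ {i j : ZMod 3} {z : V}, i ≠ j → IsTriangle K (u i) (u j) z → z ∉ Set.range u := by
    rintro i j z hij ht ⟨k, rfl⟩
    have hjk : j ≠ k := fun h' => ht.2.1 (by rw [h'])
    have hik : i ≠ k := fun h' => ht.2.2.1 (by rw [h'])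
    exact hf (triple_of_loop u hij hjk hik ▸ ht.2.2.2)
  have hedge : ∀ i z w, O (u i) (u (i + 1)) z → O (u (i + 1)) (u i) w →
      C {u i, u (i + 1), z} - C {u i, u (i + 1), w} = 1 := by
    intro i z w hz hw
    have hii : i ≠ i + 1 := fun h' => (h.adj i).1 (congrArg u h')
    have htz := hO.tri hz
    have htw := (hO.tri hw).swap
    have hzu := hnot hii htz
    have hwu := hnot hii htw
    rw [hC _ htz.2.2.2 z (by simp) hzu, hC _ htw.2.2.2 w (by simp) hwu]
    have e1 := hfun (u i) z htz.rotate.rotate.adj.symm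
    have e2 := hfun (u i) w htw.rotate.rotate.adj.symm
    rw [leftCocycle_spoke ⟨i, rfl⟩ hzu, if_pos (leftOf_left hK hO h hz hzu).1] at e1
    rw [leftCocycle_spoke ⟨i, rfl⟩ hwu, if_neg (not_leftOf_right hK hO h hw hwu).1] at e2
    omega
  refine boundsDisc_of_chain hK hO hc (m := 0) (by norm_num) C fun x y z w hz hw => ?_
  have htz := hO.tri hz
  have htw := (hO.tri hw).swap
  rw [hsum]
  by_cases hxy : ∃ i, ({x, y} : Finset V) = {u i, u (i + 1)}
  · obtain ⟨i, hi⟩ := hxy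
    rcases pair_eq hi with ⟨rfl, rfl⟩ | ⟨rfl, rfl⟩
    · rw [sum_pairInd_edge h i, hedge i z w hz hw]; simp
    · simp only [pairInd_swap (u (i + 1)) (u i)]
      rw [Finset.sum_neg_distrib, sum_pairInd_edge h i, triple_swap (u i) (u (i + 1)) z,
        triple_swap (u i) (u (i + 1)) w]
      have := hedge i w z hw hz
      exact ⟨0, by omega⟩
  · push Not at hxy
    rw [sum_pairInd_of_not_edge hxy]
    have : ∃ v ∈ ({x, y} : Finset V), v ∉ Set.range u := by
      by_contra hno
      push Not at hno
      obtain ⟨i, hi⟩ := hno x (by simp)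
      obtain ⟨j, hj⟩ := hno y (by simp)
      have hij : i ≠ j := fun h' => htz.1 (by rw [← hi, ← hj, h'])
      rcases zmod_three_pair i j hij with rfl | rfl
      · exact hxy i (by rw [hi, hj])
      · exact hxy j (by rw [hi, hj, Finset.pair_comm])
    obtain ⟨v, hv, hvu⟩ := this
    have hsub : ∀ t : V, ({x, y} : Finset V) ⊆ {x, y, t} := by
      intro t s; simp; tauto
    rw [hC _ htz.2.2.2 v (hsub z hv) hvu, hC _ htw.2.2.2 v (hsub w hv) hvu]
    simp

/-- A cycle of length three whose vertices span a triangle bounds a disc. -/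
theorem boundsDisc_of_face {c : Cycle V} {u : ZMod 3 → V} (h : IsLoop K 3 u)
    (hedges : cycleEdges c = Set.range (fun i => ({u i, u (i + 1)} : Finset V)))
    (hf : ({u 0, u 1, u 2} : Finset V) ∈ K.faces) : BoundsDisc K c := by
  set t : Finset V := {u 0, u 1, u 2} with ht
  have h01 : (0 : ZMod 3) ≠ 1 := by decide
  have h02 : (0 : ZMod 3) ≠ 2 := by decide
  have h12 : (1 : ZMod 3) ≠ 2 := by decide
  have hcases : ∀ i : ZMod 3, i = 0 ∨ i = 1 ∨ i = 2 := by decide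
  have hmem : ∀ v, v ∈ t ↔ v ∈ Set.range u := by
    intro v
    constructor
    · intro hv
      simp only [ht, Finset.mem_insert, Finset.mem_singleton] at hv
      rcases hv with rfl | rfl | rfl <;> exact ⟨_, rfl⟩
    · rintro ⟨i, rfl⟩
      rcases hcases i with rfl | rfl | rfl <;> simp [ht]
  have ht3 : t.card = 3 := Finset.card_eq_three.mpr
    ⟨_, _, _, fun h' => h01 (h.inj h'), fun h' => h02 (h.inj h'), fun h' => h12 (h.inj h'), rfl⟩
  have hD : ∀ s ∈ ({t} : Set (Finset V)), s ∈ K.faces ∧ s.card = 3 := by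
    rintro s rfl; exact ⟨hf, ht3⟩
  have hE : edges {t} = Set.range (fun i => ({u i, u (i + 1)} : Finset V)) := by
    ext e
    constructor
    · rintro ⟨h2, s, rfl, hes⟩
      obtain ⟨a, b, hab, rfl⟩ := Finset.card_eq_two.mp h2
      obtain ⟨i, rfl⟩ := (hmem a).mp (hes (by simp))
      obtain ⟨j, rfl⟩ := (hmem b).mp (hes (by simp))
      rcases zmod_three_pair i j (fun h' => hab (by rw [h'])) with rfl | rfl
      · exact ⟨i, rfl⟩
      · exact ⟨j, Finset.pair_comm _ _⟩
    · rintro ⟨i, rfl⟩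
      exact ⟨Finset.card_pair (h.adj i).1, t, rfl,
        pair_subset ((hmem _).mpr ⟨_, rfl⟩) ((hmem _).mpr ⟨_, rfl⟩)⟩
  have hV : verts {t} = Set.range u := by
    ext v
    rw [← hmem]
    exact ⟨by rintro ⟨s, rfl, hv⟩; exact hv, fun hv => ⟨t, rfl, hv⟩⟩
  refine ⟨{t}, hD, ?_, ?_, ?_⟩
  · rintro s rfl s' rfl
    exact .refl
  · rw [eulerChar_closure hD, hE, hV, h.ncard_range, h.ncard_range_edges]
    simp
  · rw [hedges, ← hE]
    ext e
    refine and_congr_right fun _ => ?_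
    by_cases he : e ⊆ t
    · have : {s ∈ ({t} : Set (Finset V)) | e ⊆ s} = {t} := by
        ext s; constructor
        · exact fun h' => h'.1
        · rintro rfl; exact ⟨rfl, he⟩
      rw [this, Set.ncard_singleton]
      exact ⟨fun _ => ⟨t, rfl, he⟩, fun _ => rfl⟩
    · have : {s ∈ ({t} : Set (Finset V)) | e ⊆ s} = ∅ := by
        ext s
        simp only [Set.mem_empty_iff_false, iff_false]
        rintro ⟨rfl, h'⟩; exact he h'
      rw [this]
      simp [he]

/-- A cycle of length three that bounds no disc has a dual cocycle, which is not a coboundary. -/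
theorem exists_isCut (hK : IsTriangulatedTorus K) {c : Cycle V} (hc : IsCycle K c)
    (h3 : c.length = 3) (hd : ¬ BoundsDisc K c) :
    ∃ (a b d : V) (η : V → V → ℤ), Adj K a b ∧ Adj K b d ∧ Adj K a d ∧ IsCut K {a, b, d} η ∧
      ¬ IsCobd K η ∧ cycleSum η c = 0 := by
  obtain ⟨O, hO⟩ := hK.orientable
  obtain ⟨n, u, hu, hn, hedges, hsum⟩ := hc.exists_loop
  obtain rfl : n = 3 := by omega
  have hf : ({u 0, u 1, u 2} : Finset V) ∉ K.faces :=
    fun hf => hd (boundsDisc_of_face hu hedges hf)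
  have hr : Set.range u = {u 0, u 1, u 2} := by
    ext x
    constructor
    · rintro ⟨i, rfl⟩
      have : i = 0 ∨ i = 1 ∨ i = 2 := by revert i; decide
      rcases this with rfl | rfl | rfl <;> simp
    · rintro (rfl | rfl | rfl) <;> exact ⟨_, rfl⟩
  have hcut := isCut_leftCocycle hK hO hu hf
  refine ⟨u 0, u 1, u 2, leftCocycle O u, hu.adj 0, hu.adj 1, (hu.adj 2).symm, hr ▸ hcut,
    fun hco => hd (boundsDisc_of_isCobd hK hO hc hu hsum hf hco), ?_⟩
  rw [hsum inferInstance]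
  exact Finset.sum_eq_zero fun i _ => hcut.zero_in _ _ ⟨_, rfl⟩ ⟨_, rfl⟩

/-! ### Tori of type `3 × k` -/

/-- The consequence of being of type `3 × k` used for the lower bound: the dual cocycle of an empty
triangle vanishes on all closed walks of length less than `k`, since a closed walk on which it does
not vanish contains a non-separating cycle that is not homotopic to the empty triangle. -/
theorem HasType.exists_isCut {k : ℕ} (hK : IsTriangulatedTorus K) (h : HasType K 3 k) :
    3 ≤ k ∧ ∃ (a b c : V) (η : V → V → ℤ), Adj K a b ∧ Adj K b c ∧ Adj K a c ∧
      IsCut K {a, b, c} η ∧ ¬ IsCobd K η ∧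
      ∀ v n s, WalkSum K η v v n s → s ≠ 0 → k ≤ n := by
  obtain ⟨⟨⟨N₀, hN₀, hlen⟩, -⟩, ⟨M, hM, ⟨⟨N, hN, hMN, rfl⟩, hmin⟩⟩, -⟩ := h
  obtain ⟨a, b, c, η, hab, hbc, hac, hcut, hco, hsum⟩ :=
    TorusTriangulation.exists_isCut hK hN₀.1 hlen hN₀.2
  refine ⟨hN.1.2.1, a, b, c, η, hab, hbc, hac, hcut, hco, fun v n s hw hs => ?_⟩
  obtain ⟨d, hd, hdn, hds⟩ := hw.exists_isCycle hcut.cocycle.1 hs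
  refine le_trans ?_ hdn
  by_cases hMN₀ : Homotopic K M N₀
  · refine hmin ⟨d, ⟨hd, fun hdisc => hds (hdisc.cycleSum_eq_zero hK hd hcut.cocycle)⟩, ?_, rfl⟩
    exact fun hMd => hds (cycleSum_homotopic hcut.cocycle (hMN₀.symm.trans hMd) hsum)
  · exact (hmin ⟨N₀, hN₀, hMN₀, rfl⟩).trans (hlen.trans_le hd.2.1)

/-! ### The two sides of an empty triangle -/

/-- Three pairwise adjacent vertices `a`, `b`, `c` with a dual cocycle `η` which is not a
coboundary and vanishes on all closed walks of length less than `k`. -/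
structure IsCutTriple (K : AbstractSimplicialComplex V) (k : ℕ) (η : V → V → ℤ) (a b c : V) :
    Prop where
  ab : Adj K a b
  bc : Adj K b c
  ac : Adj K a c
  cut : IsCut K {a, b, c} η
  not_cobd : ¬ IsCobd K η
  le_length : ∀ v n s, WalkSum K η v v n s → s ≠ 0 → k ≤ n

/-- The neighbours of `v` outside `S` on one of the two sides of `S`: the left side for `ε = 1`
and the right side for `ε = 0`. -/
def side (K : AbstractSimplicialComplex V) (S : Set V) (η : V → V → ℤ) (ε : ℤ) (v : V) : Set V :=
  {x | x ∉ S ∧ Adj K v x ∧ η v x = ε}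

section
variable {k : ℕ} {η : V → V → ℤ} {a b c : V}

theorem set_triple_rotate (a b c : V) : ({b, c, a} : Set V) = {a, b, c} := by
  ext x; simp; tauto

theorem set_triple_swap (a b c : V) : ({b, a, c} : Set V) = {a, b, c} := by
  ext x; simp; tauto

theorem IsCutTriple.rotate (h : IsCutTriple K k η a b c) : IsCutTriple K k η b c a where
  ab := h.bc
  bc := h.ac.symm
  ac := h.ab.symm
  cut := by rw [set_triple_rotate]; exact h.cut
  not_cobd := h.not_cobd
  le_length := h.le_length

theorem IsCutTriple.swap (h : IsCutTriple K k η a b c) : IsCutTriple K k η b a c where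
  ab := h.ab.symm
  bc := h.ac
  ac := h.bc
  cut := by rw [set_triple_swap]; exact h.cut
  not_cobd := h.not_cobd
  le_length := h.le_length

theorem WalkSum.add_cobd {v w : V} {n : ℕ} {s : ℤ} {f : V → ℤ}
    (h : WalkSum K (η - cobd f) v w n s) : WalkSum K η v w n (s + (f w - f v)) := by
  have := h.sub_cobd (-f)
  have e : η - cobd f - cobd (-f) = η := by
    funext x y; simp [cobd]; ring
  rw [e] at this
  convert this using 1
  simp; ring

open Classical in
/-- The indicator function of a set of vertices. -/
noncomputable def ind (S : Set V) : V → ℤ := fun x => if x ∈ S then 1 else 0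

theorem ind_of_mem {S : Set V} {x : V} (h : x ∈ S) : ind S x = 1 := if_pos h

theorem ind_of_notMem {S : Set V} {x : V} (h : x ∉ S) : ind S x = 0 := if_neg h

/-- The cut triple with the two sides exchanged. -/
theorem IsCutTriple.reverse (h : IsCutTriple K k η a b c) :
    IsCutTriple K k (-(η - cobd (-ind {a, b, c}))) a b c where
  ab := h.ab
  bc := h.bc
  ac := h.ac
  cut := {
    cocycle := (h.cut.cocycle.sub_cobd _).neg
    zero_in := fun x y hx hy => by
      have := h.cut.zero_in x y hx hy
      simp [cobd, ind_of_mem hx, ind_of_mem hy, this]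
    zero_out := fun x y hxy hx hy => by
      have := h.cut.zero_out x y hxy hx hy
      simp only [Pi.neg_apply, Pi.sub_apply, cobd, ind_of_notMem hx, ind_of_notMem hy, this]
      rfl
    vals := fun x y hxy hx hy => by
      have := h.cut.vals x y hxy hx hy
      simp only [Pi.neg_apply, Pi.sub_apply, cobd, ind_of_mem hx, ind_of_notMem hy]
      omega }
  not_cobd := fun ⟨f, hf⟩ => h.not_cobd (.of_sub_cobd (f := -ind {a, b, c}) ⟨-f, fun x y hxy => by
    have := hf x y hxy
    simp only [Pi.neg_apply] at this ⊢
    omega⟩)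
  le_length := fun v n s hw hs => by
    have h1 := hw.neg
    rw [neg_neg] at h1
    have h2 := h1.add_cobd
    exact h.le_length v n _ h2 (by simpa using hs)

theorem side_reverse {v : V} (hv : v ∈ ({a, b, c} : Set V)) (ε : ℤ) :
    side K {a, b, c} (-(η - cobd (-ind {a, b, c}))) ε v = side K {a, b, c} η (1 - ε) v := by
  ext x
  simp only [side, Set.mem_ofPred_eq]
  refine and_congr_right fun hx => and_congr_right fun _ => ?_
  simp only [Pi.neg_apply, Pi.sub_apply, cobd, ind_of_mem hv, ind_of_notMem hx]
  omega

theorem IsCutTriple.side_one_nonempty (hK : IsTriangulatedTorus K)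
    (h : IsCutTriple K k η a b c) : (side K {a, b, c} η 1 a).Nonempty := by
  by_contra hne
  rw [Set.not_nonempty_iff_eq_empty] at hne
  have h0 : ∀ x, Adj K a x → η a x = 0 := by
    intro x hx
    by_cases hxS : x ∈ ({a, b, c} : Set V)
    · exact h.cut.zero_in _ _ (by simp) hxS
    · rcases h.cut.vals a x hx (by simp) hxS with h1 | h1
      · exact h1
      · have : x ∈ side K {a, b, c} η 1 a := ⟨hxS, hx, h1⟩
        rw [hne] at this
        exact this.elim
  refine h.not_cobd (isCobd_of_pair hK h.cut.cocycle b c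
    (fun _ => h.cut.zero_in _ _ (by simp) (by simp)) fun x y hxy h1 h2 h3 h4 => ?_)
  by_cases hxa : x = a
  · subst hxa; exact h0 y hxy
  by_cases hya : y = a
  · subst hya
    rw [h.cut.cocycle.1, h0 x hxy.symm, neg_zero]
  exact h.cut.zero_out x y hxy (by simp [hxa, h1, h2]) (by simp [hya, h3, h4])

/-- In the link of `a`, the two neighbours of a vertex on the left of the triple are again on the
left, or belong to the triple. -/
theorem IsCutTriple.exists_link_neighbours (hK : IsTriangulatedTorus K)
    (h : IsCutTriple K k η a b c) {x : V} (hx : x ∈ side K {a, b, c} η 1 a) :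
    ∃ w w', w ≠ w' ∧ IsTriangle K a x w ∧ IsTriangle K a x w' ∧
      (w ∈ side K {a, b, c} η 1 a ∨ w = b ∨ w = c) ∧
      (w' ∈ side K {a, b, c} η 1 a ∨ w' = b ∨ w' = c) := by
  obtain ⟨O, hO⟩ := hK.orientable
  have key : ∀ w, IsTriangle K a x w → w ∈ side K {a, b, c} η 1 a ∨ w = b ∨ w = c := by
    intro w ht
    by_cases hw : w = b ∨ w = c
    · exact Or.inr hw
    · refine Or.inl ?_
      push Not at hw
      have hwS : w ∉ ({a, b, c} : Set V) := by simp [ht.2.2.1.symm, hw.1, hw.2]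
      refine ⟨hwS, ht.rotate.rotate.adj.symm, ?_⟩
      have h1 := h.cut.cocycle.closed a x w ht
      have h2 := h.cut.zero_out x w ht.rotate.adj hx.1 hwS
      have h3 := h.cut.cocycle.antisymm a w
      have h4 := hx.2.2
      omega
  obtain ⟨w, hw⟩ := exists_left hK hO hx.2.1
  obtain ⟨w', hw'⟩ := exists_left hK hO hx.2.1.symm
  have hne : w ≠ w' := by
    rintro rfl; exact hO.not_both hw hw'
  exact ⟨w, w', hne, hO.tri hw, (hO.tri hw').swap, key w (hO.tri hw), key w' (hO.tri hw').swap⟩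

theorem IsCutTriple.triangles_of_singleton (hK : IsTriangulatedTorus K)
    (h : IsCutTriple K k η a b c) {x : V} (hx : side K {a, b, c} η 1 a = {x}) :
    IsTriangle K a x b ∧ IsTriangle K a x c := by
  have hx' : x ∈ side K {a, b, c} η 1 a := by rw [hx]; rfl
  obtain ⟨w, w', hne, h1, h2, h3, h4⟩ := h.exists_link_neighbours hK hx'
  rw [hx] at h3 h4
  have h5 : w ≠ x := h1.2.1.symm
  have h6 : w' ≠ x := h2.2.1.symm
  rcases h3.resolve_left h5 with rfl | rfl <;> rcases h4.resolve_left h6 with rfl | rfl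
  · exact absurd rfl hne
  · exact ⟨h1, h2⟩
  · exact ⟨h2, h1⟩
  · exact absurd rfl hne

/-- If `a` has a single neighbour `x` on the left, the triple can be moved across the two triangles
between `a` and `x`. -/
theorem IsCutTriple.move (hK : IsTriangulatedTorus K)
    (h : IsCutTriple K k η a b c) {x : V} (hx : side K {a, b, c} η 1 a = {x}) :
    IsCutTriple K k (η - cobd (ind {x})) x b c ∧
      side K {x, b, c} (η - cobd (ind {x})) 1 b = side K {a, b, c} η 1 b \ {x} ∧
      side K {x, b, c} (η - cobd (ind {x})) 1 c = side K {a, b, c} η 1 c \ {x} ∧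
      x ∈ side K {a, b, c} η 1 b ∧ x ∈ side K {a, b, c} η 1 c := by
  have hx' : x ∈ side K {a, b, c} η 1 a := by rw [hx]; rfl
  obtain ⟨hxS, hax, hη⟩ := hx'
  obtain ⟨htb, htc⟩ := h.triangles_of_singleton hK hx
  have hxb : x ≠ b := htb.2.1
  have hxc : x ≠ c := htc.2.1
  have hxa : a ≠ x := hax.1
  have hab := h.ab.1
  have hac := h.ac.1
  have anti := h.cut.cocycle.antisymm
  have ebx : η b x = 1 := by
    have h1 := h.cut.cocycle.closed a x b htb
    have h2 := h.cut.zero_in b a (by simp) (by simp)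
    have h3 := anti x b
    omega
  have ecx : η c x = 1 := by
    have h1 := h.cut.cocycle.closed a x c htc
    have h2 := h.cut.zero_in c a (by simp) (by simp)
    have h3 := anti x c
    omega
  have exb : η x b = -1 := by rw [anti, ebx]
  have exc : η x c = -1 := by rw [anti, ecx]
  have ebc := h.cut.zero_in b c (by simp) (by simp)
  have ecb := h.cut.zero_in c b (by simp) (by simp)
  have indx : ind ({x} : Set V) x = 1 := ind_of_mem rfl
  have indn : ∀ y, y ≠ x → ind ({x} : Set V) y = 0 := fun y hy => ind_of_notMem hy
  -- the neighbours of `a` other than `x`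
  have ha : ∀ y, Adj K a y → y ≠ x → η a y = 0 := by
    intro y hy hyx
    by_cases hyS : y ∈ ({a, b, c} : Set V)
    · exact h.cut.zero_in _ _ (by simp) hyS
    · refine (h.cut.vals a y hy (by simp) hyS).resolve_right fun h1 => hyx ?_
      have : y ∈ side K {a, b, c} η 1 a := ⟨hyS, hy, h1⟩
      rwa [hx] at this
  have hside : ∀ s, s ∈ ({b, c} : Set V) → side K {x, b, c} (η - cobd (ind {x})) 1 s
      = side K {a, b, c} η 1 s \ {x} := by
    intro s hs
    have hsx : s ≠ x := by
      rcases hs with rfl | rfl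
      · exact hxb.symm
      · exact hxc.symm
    have hsS : s ∈ ({a, b, c} : Set V) := by rcases hs with rfl | rfl <;> simp
    ext y
    constructor
    · rintro ⟨h1, h2, h3⟩
      simp only [Set.mem_insert_iff, Set.mem_singleton_iff, not_or] at h1
      simp only [Pi.sub_apply, cobd, indn y h1.1, indn s hsx, sub_zero] at h3
      refine ⟨⟨?_, h2, h3⟩, h1.1⟩
      have : y ≠ a := by
        rintro rfl
        have := h.cut.zero_in s y hsS (by simp)
        omega
      simp [this, h1.2.1, h1.2.2]
    · rintro ⟨⟨h1, h2, h3⟩, h4⟩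
      simp only [Set.mem_insert_iff, Set.mem_singleton_iff, not_or] at h1 h4
      refine ⟨by simp [h4, h1.2.1, h1.2.2], h2, ?_⟩
      simp only [Pi.sub_apply, cobd, indn y h4, indn s hsx, sub_zero]
      exact h3
  refine ⟨⟨htb.rotate.adj, h.bc, htc.rotate.adj, ?_, fun h' => h.not_cobd h'.of_sub_cobd, ?_⟩,
    hside b (by simp), hside c (by simp), ⟨hxS, htb.rotate.adj.symm, ebx⟩,
    ⟨hxS, htc.rotate.adj.symm, ecx⟩⟩
  · refine ⟨h.cut.cocycle.sub_cobd _, ?_, ?_, ?_⟩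
    · have bb := h.cut.cocycle.self b
      have cc := h.cut.cocycle.self c
      have xx := h.cut.cocycle.self x
      rintro p q (rfl | rfl | rfl) (rfl | rfl | rfl) <;>
        simp only [Pi.sub_apply, cobd, indx, indn _ hxb.symm, indn _ hxc.symm] <;> omega
    · intro p q hpq hp hq
      simp only [Set.mem_insert_iff, Set.mem_singleton_iff, not_or] at hp hq
      simp only [Pi.sub_apply, cobd, indn p hp.1, indn q hq.1, sub_zero]
      by_cases hpa : p = a
      · subst hpa; exact ha q hpq hq.1
      by_cases hqa : q = a
      · subst hqa; rw [anti, ha p hpq.symm hp.1, neg_zero]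
      exact h.cut.zero_out p q hpq (by simp [hpa, hp]) (by simp [hqa, hq])
    · intro p q hpq hp hq
      simp only [Set.mem_insert_iff, Set.mem_singleton_iff, not_or] at hq
      by_cases hpx : p = x
      · subst hpx
        simp only [Pi.sub_apply, cobd, indx, indn q hq.1]
        by_cases hqa : q = a
        · subst hqa; rw [anti, hη]; simp
        · have := h.cut.zero_out p q hpq hxS (by simp [hqa, hq])
          omega
      · have hp' : p ∈ ({a, b, c} : Set V) := by
          rcases hp with rfl | rfl | rfl <;> simp at hpx ⊢
        simp only [Pi.sub_apply, cobd, indn p hpx, indn q hq.1, sub_zero]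
        by_cases hqa : q = a
        · subst hqa; exact Or.inl (h.cut.zero_in _ _ hp' (by simp))
        · exact h.cut.vals p q hpq hp' (by simp [hqa, hq])
  · intro v n s hw hs
    exact h.le_length v n _ hw.add_cobd (by simpa using hs)

theorem IsCutTriple.two_le (hK : IsTriangulatedTorus K) (h : IsCutTriple K k η a b c)
    (h1 : (side K {a, b, c} η 1 a).ncard = 1) :
    2 ≤ (side K {a, b, c} η 1 b).ncard ∧ 2 ≤ (side K {a, b, c} η 1 c).ncard := by
  have := hK.finite
  obtain ⟨x, hx⟩ := Set.ncard_eq_one.mp h1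
  obtain ⟨h2, h3, h4, h5, h6⟩ := h.move hK hx
  have h7 := h2.rotate.side_one_nonempty hK
  rw [set_triple_rotate, h3, ← Set.ncard_pos, Set.ncard_sdiff_singleton_of_mem h5] at h7
  have h8 := h2.rotate.rotate.side_one_nonempty hK
  rw [set_triple_rotate, set_triple_rotate, h4, ← Set.ncard_pos,
    Set.ncard_sdiff_singleton_of_mem h6] at h8
  omega

theorem IsCutTriple.one_le (hK : IsTriangulatedTorus K) (h : IsCutTriple K k η a b c) :
    1 ≤ (side K {a, b, c} η 1 a).ncard := by
  have := hK.finite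
  exact (Set.ncard_pos).mpr (h.side_one_nonempty hK)

theorem IsCutTriple.six_le_of_one (hK : IsTriangulatedTorus K) (h : IsCutTriple K k η a b c)
    (h1 : (side K {a, b, c} η 1 a).ncard = 1) :
    5 ≤ (side K {a, b, c} η 1 b).ncard + (side K {a, b, c} η 1 c).ncard := by
  have := hK.finite
  have h0 := h.two_le hK h1
  by_contra hlt
  obtain ⟨x, hx⟩ := Set.ncard_eq_one.mp h1
  obtain ⟨h2, h3, h4, h5, h6⟩ := h.move hK hx
  have e1 := Set.ncard_sdiff_singleton_of_mem h5
  have e2 := Set.ncard_sdiff_singleton_of_mem h6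
  rw [← h3] at e1
  rw [← h4] at e2
  have h7 := (h2.rotate.two_le hK (by rw [set_triple_rotate]; omega)).1
  rw [set_triple_rotate] at h7
  omega

/-- There are at least six edges that leave the triple on its left. -/
theorem IsCutTriple.six_le (hK : IsTriangulatedTorus K) (h : IsCutTriple K k η a b c) :
    6 ≤ (side K {a, b, c} η 1 a).ncard + (side K {a, b, c} η 1 b).ncard
      + (side K {a, b, c} η 1 c).ncard := by
  have p1 := h.one_le hK
  have p2 := h.rotate.one_le hK
  have p3 := h.rotate.rotate.one_le hK
  have q1 := h.six_le_of_one hK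
  have q2 := h.rotate.six_le_of_one hK
  have q3 := h.rotate.rotate.six_le_of_one hK
  rw [set_triple_rotate] at p2 q2
  rw [set_triple_rotate b c a, set_triple_rotate a b c] at p3 q3
  omega

theorem IsCutTriple.six_le_zero (hK : IsTriangulatedTorus K) (h : IsCutTriple K k η a b c) :
    6 ≤ (side K {a, b, c} η 0 a).ncard + (side K {a, b, c} η 0 b).ncard
      + (side K {a, b, c} η 0 c).ncard := by
  have := h.reverse.six_le hK
  rwa [side_reverse (by simp), side_reverse (by simp), side_reverse (by simp)] at this

end

section
variable {k : ℕ} {η : V → V → ℤ} {a b c : V}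

/-! ### The lower bound for the number of vertices -/

/-- The vertices outside `S` that are reached from `v` by a walk of length at most `j` along which
`η` has sum `1`. -/
def reach (K : AbstractSimplicialComplex V) (S : Set V) (η : V → V → ℤ) (v : V) (j : ℕ) : Set V :=
  {x | x ∉ S ∧ ∃ m ≤ j, WalkSum K η v x m 1}

theorem reach_mono {S : Set V} {v : V} {i j : ℕ} (hij : i ≤ j) :
    reach K S η v i ⊆ reach K S η v j :=
  fun _ ⟨hx, m, hm, hw⟩ => ⟨hx, m, hm.trans hij, hw⟩

theorem side_subset_reach {S : Set V} {v : V} {j : ℕ} (hj : 1 ≤ j) :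
    side K S η 1 v ⊆ reach K S η v j := by
  rintro x ⟨hx, hvx, h1⟩
  refine ⟨hx, 1, hj, ?_⟩
  have := WalkSum.single (η := η) hvx
  rwa [h1] at this

/-- Vertices on the right of the triple are not reached by short walks. -/
theorem IsCutTriple.notMem_reach (h : IsCutTriple K k η a b c) {s y : V}
    (hs : s ∈ ({a, b, c} : Set V)) (hy : y ∈ side K {a, b, c} η 0 s) {j : ℕ} (hj : j + 2 < k) :
    y ∉ reach K {a, b, c} η a j := by
  rintro ⟨-, m, hm, hw⟩
  have h1 := hw.snoc hy.2.1.symm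
  rw [h.cut.cocycle.1, hy.2.2] at h1
  by_cases hsa : s = a
  · subst hsa
    have := h.le_length _ _ _ h1 (by simp)
    omega
  · have hadj : Adj K s a := by
      rcases hs with rfl | rfl | rfl
      · exact absurd rfl hsa
      · exact h.ab.symm
      · exact h.ac.symm
    have h2 := h1.snoc hadj
    rw [h.cut.zero_in _ _ hs (by simp)] at h2
    have := h.le_length _ _ _ h2 (by simp)
    omega

theorem IsCutTriple.disjoint_reach (h : IsCutTriple K k η a b c) {j : ℕ} (hj : j + 1 < k) :
    Disjoint (side K {a, b, c} η 0 a) (reach K {a, b, c} η a j) := by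
  rw [Set.disjoint_left]
  rintro y hy ⟨-, m, hm, hw⟩
  have h1 := hw.snoc hy.2.1.symm
  rw [h.cut.cocycle.1, hy.2.2] at h1
  have := h.le_length _ _ _ h1 (by simp)
  omega

theorem IsCutTriple.side_subset_reach_two (h : IsCutTriple K k η a b c) {s : V}
    (hs : s ∈ ({a, b, c} : Set V)) {j : ℕ} (hj : 2 ≤ j) :
    side K {a, b, c} η 1 s ⊆ reach K {a, b, c} η a j := by
  by_cases hsa : s = a
  · subst hsa; exact side_subset_reach (by omega)
  rintro x ⟨hx, hsx, h1⟩
  have hadj : Adj K a s := by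
    rcases hs with rfl | rfl | rfl
    · exact absurd rfl hsa
    · exact h.ab
    · exact h.ac
  have h2 := (WalkSum.single (η := η) hadj).snoc hsx
  rw [h1, h.cut.zero_in _ _ (by simp) hs] at h2
  exact ⟨hx, 2, hj, by simpa using h2⟩

theorem IsCutTriple.val_eq (h : IsCutTriple K k η a b c) {s y : V}
    (hs : s ∈ ({a, b, c} : Set V)) (hy : y ∉ ({a, b, c} : Set V)) (hadj : Adj K s y) :
    y ∈ side K {a, b, c} η 0 s ∨ y ∈ side K {a, b, c} η 1 s := by
  rcases h.cut.vals s y hadj hs hy with h1 | h1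
  · exact Or.inl ⟨hy, hadj, h1⟩
  · exact Or.inr ⟨hy, hadj, h1⟩

/-- The vertices at distance exactly `j` on the left of the triple again separate the torus into an
annulus: subtracting the indicator of the vertices at smaller distance turns `η` into a cocycle
supported on the edges that leave this layer. -/
theorem IsCutTriple.three_le_layer (hK : IsTriangulatedTorus K) (h : IsCutTriple K k η a b c)
    {j : ℕ} (hj : 1 ≤ j) (hjk : j + 2 < k) :
    3 ≤ (reach K {a, b, c} η a (j + 1) \ reach K {a, b, c} η a j).ncard := by
  set S : Set V := {a, b, c} with hS
  set R := reach K S η a j with hR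
  set R' := reach K S η a (j + 1) with hR'
  have hRR' : R ⊆ R' := reach_mono (by omega)
  have hRS : ∀ x ∈ R, x ∉ S := fun x hx => hx.1
  have anti := h.cut.cocycle.antisymm
  -- an edge between two vertices outside the layer, oriented such that `S` comes before `R`
  have key : ∀ x y, Adj K x y → x ∉ R' \ R → y ∉ R' \ R →
      (x ∈ S ∨ (x ∈ R ∧ y ∉ S) ∨ (x ∉ R ∧ y ∉ S ∧ y ∉ R ∧ x ∉ S)) →
      (η - cobd (ind R)) x y = 0 := by
    rintro x y hxy hx hy (hxS | ⟨hxR, hyS⟩ | ⟨hxR, hyS, hyR, hxS⟩)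
    · have hxR : x ∉ R := fun h' => h'.1 hxS
      by_cases hyS : y ∈ S
      · have hyR : y ∉ R := fun h' => h'.1 hyS
        simp [cobd, ind_of_notMem hxR, ind_of_notMem hyR, h.cut.zero_in x y hxS hyS]
      · rcases h.val_eq hxS hyS hxy with h1 | h1
        · have hyR : y ∉ R := h.notMem_reach hxS h1 hjk
          simp [cobd, ind_of_notMem hxR, ind_of_notMem hyR, h1.2.2]
        · have h2 : y ∈ R' := h.side_subset_reach_two hxS (by omega) h1
          have hyR : y ∈ R := by
            by_contra h3; exact hy ⟨h2, h3⟩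
          simp [cobd, ind_of_notMem hxR, ind_of_mem hyR, h1.2.2]
    · have h0 := h.cut.zero_out x y hxy hxR.1 hyS
      have hyR : y ∈ R := by
        by_contra h3
        refine hy ⟨⟨hyS, ?_⟩, h3⟩
        obtain ⟨-, m, hm, hw⟩ := hxR
        have := hw.snoc hxy
        rw [h0, add_zero] at this
        exact ⟨m + 1, by omega, this⟩
      simp [cobd, ind_of_mem hxR, ind_of_mem hyR, h0]
    · simp [cobd, ind_of_notMem hxR, ind_of_notMem hyR, h.cut.zero_out x y hxy hxS hyS]
  have hcoc := h.cut.cocycle.sub_cobd (ind R)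
  refine three_le_ncard hK hcoc (fun h' => h.not_cobd h'.of_sub_cobd) ?_ ?_
  · intro x y hxy hx hy
    have := h.cut.zero_out x y hxy hx.1.1 hy.1.1
    simp [cobd, ind_of_notMem hx.2, ind_of_notMem hy.2, this]
  · intro x y hxy hx hy
    by_cases h1 : x ∈ S ∨ (x ∈ R ∧ y ∉ S) ∨ (x ∉ R ∧ y ∉ S ∧ y ∉ R ∧ x ∉ S)
    · exact key x y hxy hx hy h1
    · rw [hcoc.antisymm, key y x hxy.symm hy hx (by tauto), neg_zero]

theorem IsCutTriple.reach_growth (hK : IsTriangulatedTorus K) (h : IsCutTriple K k η a b c)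
    {i : ℕ} (hi : 1 ≤ i) (d : ℕ) (hd : i + d + 1 < k) :
    (reach K {a, b, c} η a i).ncard + 3 * d ≤ (reach K {a, b, c} η a (i + d)).ncard := by
  have := hK.finite
  induction d with
  | zero => simp
  | succ d ih =>
    have h1 := ih (by omega)
    have h2 := h.three_le_layer hK (j := i + d) (by omega) (by omega)
    have h3 := Set.ncard_sdiff_add_ncard_of_subset
      (reach_mono (by omega) : reach K {a, b, c} η a (i + d) ⊆ reach K {a, b, c} η a (i + d + 1))
    rw [← add_assoc]
    omega

theorem IsCutTriple.ncard_triple (h : IsCutTriple K k η a b c) :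
    ({a, b, c} : Set V).ncard = 3 := by
  rw [Set.ncard_eq_three]
  exact ⟨a, b, c, h.ab.1, h.ac.1, h.bc.1, rfl⟩

theorem IsCutTriple.reach_le (hK : IsTriangulatedTorus K) (h : IsCutTriple K k η a b c)
    {j : ℕ} (hj : j + 1 < k) :
    (reach K {a, b, c} η a j).ncard + (side K {a, b, c} η 0 a).ncard + 3 ≤ Nat.card V := by
  have := hK.finite
  rw [← h.ncard_triple, add_comm (reach K {a, b, c} η a j).ncard,
    ← Set.ncard_union_eq (h.disjoint_reach hj), ← Set.ncard_union_eq]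
  · exact Set.ncard_le_card _
  · rw [Set.disjoint_left]
    rintro x (hx | hx) hxS
    · exact hx.1 hxS
    · exact hx.1 hxS

theorem IsCutTriple.degree_le (hK : IsTriangulatedTorus K) (h : IsCutTriple K k η a b c)
    (hk : 3 ≤ k) :
    (side K {a, b, c} η 1 a).ncard + (side K {a, b, c} η 0 a).ncard + 3 * k
      ≤ Nat.card V + 6 := by
  have := hK.finite
  have h1 := h.reach_growth hK le_rfl (k - 3) (by omega)
  have h2 := h.reach_le hK (j := 1 + (k - 3)) (by omega)
  have h3 := Set.ncard_le_ncard (side_subset_reach le_rfl :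
    side K {a, b, c} η 1 a ⊆ reach K {a, b, c} η a 1)
  omega

theorem IsCutTriple.le_card (hK : IsTriangulatedTorus K) (h : IsCutTriple K k η a b c)
    (hk : 3 ≤ k) : 3 * k ≤ Nat.card V + 2 := by
  have h1 := h.degree_le hK hk
  have h2 := h.rotate.degree_le hK hk
  have h3 := h.rotate.rotate.degree_le hK hk
  rw [set_triple_rotate] at h2
  rw [set_triple_rotate b c a, set_triple_rotate a b c] at h3
  have h4 := h.six_le hK
  have h5 := h.six_le_zero hK
  omega

/-! ### The sides of an empty triangle in a minimal torus -/

theorem IsCutTriple.sides_of_card (hK : IsTriangulatedTorus K) (h : IsCutTriple K k η a b c)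
    (hk : 3 ≤ k) (hn : Nat.card V + 2 = 3 * k) :
    (side K {a, b, c} η 1 a).ncard + (side K {a, b, c} η 1 b).ncard
      + (side K {a, b, c} η 1 c).ncard = 6 ∧
    (side K {a, b, c} η 1 a).ncard + (side K {a, b, c} η 0 a).ncard = 4 ∧
    (side K {a, b, c} η 1 b).ncard + (side K {a, b, c} η 0 b).ncard = 4 ∧
    (side K {a, b, c} η 1 c).ncard + (side K {a, b, c} η 0 c).ncard = 4 := by
  have h1 := h.degree_le hK hk
  have h2 := h.rotate.degree_le hK hk
  have h3 := h.rotate.rotate.degree_le hK hk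
  rw [set_triple_rotate] at h2
  rw [set_triple_rotate b c a, set_triple_rotate a b c] at h3
  have h4 := h.six_le hK
  have h5 := h.six_le_zero hK
  omega

/-- An edge lies in only two triangles. -/
theorem IsOrientation.eq_of_triangles (hO : IsOrientation K O) {x y z : V}
    (hx : IsTriangle K a b x) (hy : IsTriangle K a b y) (hz : IsTriangle K a b z) :
    x = y ∨ x = z ∨ y = z := by
  rcases hO.or hx with h1 | h1 <;> rcases hO.or hy with h2 | h2 <;>
    rcases hO.or hz with h3 | h3 <;> have := @hO.uniq <;> grind

/-- On each side of the triple, every edge of the triple is in a triangle. -/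
theorem IsCutTriple.exists_common (hK : IsTriangulatedTorus K) (h : IsCutTriple K k η a b c) :
    ∃ z ∈ side K {a, b, c} η 1 a, IsTriangle K a b z := by
  obtain ⟨O, hO⟩ := hK.orientable
  by_contra hno
  push Not at hno
  have e0 : ∀ s ∈ ({a, b, c} : Set V), η a s = 0 :=
    fun s hs => h.cut.zero_in _ _ (by simp) hs
  have hb : ∀ z, IsTriangle K a b z → η a z = 0 := by
    intro z ht
    by_cases hzS : z ∈ ({a, b, c} : Set V)
    · exact e0 z hzS
    · rcases h.val_eq (by simp) hzS ht.rotate.rotate.adj.symm with h1 | h1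
      · exact h1.2.2
      · exact absurd ht (hno z h1)
  have hstep : ∀ z w, IsTriangle K a z w → z ∉ ({a, b, c} : Set V) → w ∉ ({a, b, c} : Set V) →
      η a w = η a z := by
    intro z w ht hz hw
    have h1 := h.cut.cocycle.closed a z w ht
    have h2 := h.cut.zero_out z w ht.rotate.adj hz hw
    have h3 := h.cut.cocycle.antisymm a w
    omega
  -- the vertex after `c` in the link of `a`; its value propagates around the link
  obtain ⟨w₀, hw₀⟩ := exists_left hK hO h.ac
  have hw₀t := hO.tri hw₀
  have haw₀ := hw₀t.rotate.rotate.adj.symm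
  by_cases ht : η a w₀ = 0
  · obtain ⟨x, hx⟩ := h.side_one_nonempty hK
    have hall : ∀ z, Adj K a z → η a z = 0 := by
      refine link_forward hK hO haw₀ ht ?_
      intro z w hzw hz
      have htri := hO.tri hzw
      by_cases hzb : z = b
      · subst hzb; exact hb w htri
      by_cases hzc : z = c
      · subst hzc; rw [hO.uniq hzw hw₀]; exact ht
      by_cases hwS : w ∈ ({a, b, c} : Set V)
      · exact e0 w hwS
      · rw [hstep z w htri (by simp [htri.1.symm, hzb, hzc]) hwS, hz]
    have := hx.2.2
    rw [hall x hx.2.1] at this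
    omega
  · have hall : ∀ z, Adj K a z → z ≠ b ∧ (z = c ∨ η a z ≠ 0) := by
      refine link_forward hK hO haw₀ ⟨?_, Or.inr ht⟩ ?_
      · rintro rfl; exact ht (e0 _ (by simp))
      · intro z w hzw hz
        have htri := hO.tri hzw
        by_cases hzc : z = c
        · subst hzc
          rw [hO.uniq hzw hw₀]
          exact ⟨by rintro rfl; exact ht (e0 _ (by simp)), Or.inr ht⟩
        have hz0 := hz.2.resolve_left hzc
        have hwb : w ≠ b := by
          rintro rfl
          exact hz0 (hb z htri.swap.rotate.rotate.swap.rotate.swap)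
        refine ⟨hwb, ?_⟩
        by_cases hwc : w = c
        · exact Or.inl hwc
        · right
          rw [hstep z w htri (by simp [htri.1.symm, hz.1, hzc])
            (by simp [htri.2.2.1.symm, hwb, hwc])]
          exact hz0
    exact (hall b h.ab).1 rfl

end

section
variable {k : ℕ} {η : V → V → ℤ} {a b c : V}

theorem IsCutTriple.common_mem (h : IsCutTriple K k η a b c) {z : V}
    (hz : z ∈ side K {a, b, c} η 1 a) (ht : IsTriangle K a b z) :
    z ∈ side K {a, b, c} η 1 b := by
  refine ⟨hz.1, ht.rotate.adj, ?_⟩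
  have h1 := h.cut.cocycle.closed a b z ht
  have h2 := h.cut.cocycle.antisymm z a
  have h3 := h.cut.zero_in a b (by simp) (by simp)
  have h4 := hz.2.2
  omega

theorem IsCutTriple.common_unique (hK : IsTriangulatedTorus K) (h : IsCutTriple K k η a b c)
    {z z' : V} (hz : z ∈ side K {a, b, c} η 1 a) (ht : IsTriangle K a b z)
    (hz' : z' ∈ side K {a, b, c} η 1 a) (ht' : IsTriangle K a b z') : z = z' := by
  obtain ⟨O, hO⟩ := hK.orientable
  obtain ⟨y, hy, hty⟩ := h.reverse.exists_common hK
  rw [side_reverse (by simp)] at hy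
  have h1 := hz.2.2
  have h2 := hz'.2.2
  have h3 := hy.2.2
  rcases hO.eq_of_triangles ht ht' hty with rfl | rfl | rfl
  · rfl
  · omega
  · omega

theorem set_triple_swap_right (a b c : V) : ({a, c, b} : Set V) = {a, b, c} := by
  ext x; simp; tauto

/-- If `a` has exactly two neighbours on the left, they are the third vertices of the triangles at
`ab` and `ac`, and they are adjacent. -/
theorem IsCutTriple.side_two (hK : IsTriangulatedTorus K) (h : IsCutTriple K k η a b c)
    (h2 : (side K {a, b, c} η 1 a).ncard = 2) {y z : V} (hz : z ∈ side K {a, b, c} η 1 a)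
    (htz : IsTriangle K a b z) (hy : y ∈ side K {a, b, c} η 1 a) (hty : IsTriangle K a c y) :
    y ≠ z ∧ side K {a, b, c} η 1 a = {y, z} ∧ Adj K y z := by
  have := hK.finite
  have hb : ∀ w, w ∈ side K {a, b, c} η 1 a → IsTriangle K a w b → w = z := fun w hw ht =>
    h.common_unique hK hw ht.rotate.rotate.swap hz htz
  have hc : ∀ w, w ∈ side K {a, b, c} η 1 a → IsTriangle K a w c → w = y := fun w hw ht =>
    h.swap.rotate.common_unique hK
      (by convert hw using 2; ext v; simp; tauto) ht.rotate.rotate.swap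
      (by convert hy using 2; ext v; simp; tauto) hty
  obtain ⟨p, q, hpq, hset⟩ := Set.ncard_eq_two.mp h2
  have hne : y ≠ z := by
    rintro rfl
    obtain ⟨z', hne, hset⟩ : ∃ z', z' ≠ y ∧ side K {a, b, c} η 1 a = {y, z'} := by
      have hy' := hy
      rw [hset] at hy'
      rcases hy' with rfl | rfl
      · exact ⟨q, hpq.symm, hset⟩
      · exact ⟨p, hpq, by rw [hset, Set.pair_comm]⟩
    have hz' : z' ∈ side K {a, b, c} η 1 a := by rw [hset]; simp
    obtain ⟨w, w', hww, t1, t2, h3, h4⟩ := h.exists_link_neighbours hK hz'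
    have key : ∀ v, IsTriangle K a z' v → (v ∈ side K {a, b, c} η 1 a ∨ v = b ∨ v = c) →
        v = y := by
      rintro v t (hv | rfl | rfl)
      · rw [hset] at hv
        exact hv.resolve_right t.2.1.symm
      · exact absurd (hb z' hz' t) hne
      · exact absurd (hc z' hz' t) hne
    exact hww ((key w t1 h3).trans (key w' t2 h4).symm)
  have hset' : side K {a, b, c} η 1 a = {y, z} := by
    symm
    refine Set.eq_of_subset_of_ncard_le ?_ (by rw [h2, Set.ncard_pair hne])
    rintro v (rfl | rfl)
    · exact hy
    · exact hz
  refine ⟨hne, hset', ?_⟩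
  obtain ⟨w, w', hww, t1, t2, h3, h4⟩ := h.exists_link_neighbours hK hz
  have key : ∀ v, IsTriangle K a z v → (v ∈ side K {a, b, c} η 1 a ∨ v = b ∨ v = c) →
      v = y ∨ v = b := by
    rintro v t (hv | rfl | rfl)
    · rw [hset'] at hv
      rcases hv with rfl | rfl
      · exact Or.inl rfl
      · exact absurd rfl t.2.1
    · exact Or.inr rfl
    · exact absurd (hc z hz t).symm hne
  rcases key w t1 h3 with rfl | rfl
  · exact t1.rotate.adj.symm
  · rcases key w' t2 h4 with rfl | rfl
    · exact t2.rotate.adj.symm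
    · exact absurd rfl hww

theorem IsCutTriple.exists_two_two_two (hK : IsTriangulatedTorus K)
    (h : IsCutTriple K k η a b c) (ha : (side K {a, b, c} η 1 a).ncard = 2)
    (hb : (side K {a, b, c} η 1 b).ncard = 2) (hc : (side K {a, b, c} η 1 c).ncard = 2) :
    ∃ x y z, Adj K x y ∧ Adj K y z ∧ Adj K x z ∧ side K {a, b, c} η 1 a = {y, z} ∧
      side K {a, b, c} η 1 b = {z, x} ∧ side K {a, b, c} η 1 c = {x, y} := by
  obtain ⟨z, hz, htz⟩ := h.exists_common hK
  have hz' := h.common_mem hz htz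
  obtain ⟨x, hx, htx⟩ := h.rotate.exists_common hK
  have hx' := h.rotate.common_mem hx htx
  obtain ⟨y, hy, hty⟩ := h.rotate.rotate.exists_common hK
  have hy' := h.rotate.rotate.common_mem hy hty
  have e1 : ({b, c, a} : Set V) = {a, b, c} := set_triple_rotate a b c
  have e2 : ({c, a, b} : Set V) = {a, b, c} := by rw [set_triple_rotate b c a, e1]
  rw [e1] at hx hx'
  rw [e2] at hy hy'
  obtain ⟨h1, h2, h3⟩ := h.side_two hK ha hz htz hy' hty.swap
  have s2 := h.rotate.side_two hK (y := z) (z := x)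
  rw [e1] at s2
  obtain ⟨h4, h5, h6⟩ := s2 hb hx htx hz' htz.swap
  have s3 := h.rotate.rotate.side_two hK (y := x) (z := y)
  rw [e2] at s3
  obtain ⟨h7, h8, h9⟩ := s3 hc hy hty hx' htx.swap
  exact ⟨x, y, z, h9, h3, h6.symm, h2, h5, h8⟩

theorem IsCutTriple.card_le_of_disjoint (hK : IsTriangulatedTorus K)
    (h : IsCutTriple K k η a b c) {T : Set V} (hT : ∀ x ∈ T, x ∉ ({a, b, c} : Set V))
    (hT' : ∀ x ∈ T, x ∉ side K {a, b, c} η 0 a) :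
    T.ncard + (side K {a, b, c} η 0 a).ncard + 3 ≤ Nat.card V := by
  have := hK.finite
  rw [← h.ncard_triple, ← Set.ncard_union_eq (Set.disjoint_left.mpr hT'), ← Set.ncard_union_eq]
  · exact Set.ncard_le_card _
  · rw [Set.disjoint_left]
    rintro x (hx | hx) hxS
    · exact hT x hx hxS
    · exact hx.1 hxS

/-- In a minimal torus the three vertices of the triple cannot all have two neighbours on the
left if `k = 3`: the left and the right neighbours would be six distinct vertices. -/
theorem IsCutTriple.not_two_two_two_of_three (hK : IsTriangulatedTorus K)
    (h : IsCutTriple K 3 η a b c) (hn : Nat.card V = 7) :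
    ¬ ((side K {a, b, c} η 1 a).ncard = 2 ∧ (side K {a, b, c} η 1 b).ncard = 2 ∧
      (side K {a, b, c} η 1 c).ncard = 2) := by
  rintro ⟨ha, hb, hc⟩
  obtain ⟨-, h1, h2, h3⟩ := h.sides_of_card hK le_rfl (by omega)
  obtain ⟨x, y, z, hxy, hyz, hxz, sa, sb, sc⟩ := h.exists_two_two_two hK ha hb hc
  obtain ⟨x', y', z', -, -, -, ra, rb, rc⟩ := h.reverse.exists_two_two_two hK
    (by rw [side_reverse (by simp)]; simp; omega) (by rw [side_reverse (by simp)]; simp; omega)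
    (by rw [side_reverse (by simp)]; simp; omega)
  rw [side_reverse (by simp), sub_self] at ra rb rc
  have mb : x ∈ side K {a, b, c} η 1 b := by rw [sb]; simp
  have mc : x ∈ side K {a, b, c} η 1 c := by rw [sc]; simp
  have nb := mb.2.2
  have nc := mc.2.2
  have hxR : x ∈ side K {a, b, c} η 0 a := by
    by_contra hxR
    have hy : y ∈ side K {a, b, c} η 1 a := by rw [sa]; simp
    have hz : z ∈ side K {a, b, c} η 1 a := by rw [sa]; simp
    have := h.card_le_of_disjoint hK (T := {x, y, z})
      (by rintro w (rfl | rfl | rfl); exacts [mb.1, hy.1, hz.1])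
      (by
        rintro w (rfl | rfl | rfl) hw
        · exact hxR hw
        · have := hy.2.2; have := hw.2.2; omega
        · have := hz.2.2; have := hw.2.2; omega)
    rw [Set.ncard_eq_three.mpr ⟨x, y, z, hxy.1, hxz.1, hyz.1, rfl⟩] at this
    omega
  rw [ra] at hxR
  rcases hxR with rfl | rfl
  · have : x ∈ side K {a, b, c} η 0 c := by rw [rc]; simp
    have := this.2.2
    omega
  · have : x ∈ side K {a, b, c} η 0 b := by rw [rb]; simp
    have := this.2.2
    omega

/-- In a minimal torus with `k ≥ 4`, the three vertices of the triple cannot all have two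
neighbours on the left: the left neighbours would form a triple of the same kind, and too many
vertices would be near `a`. -/
theorem IsCutTriple.not_two_two_two_of_four_le (hK : IsTriangulatedTorus K)
    (h : IsCutTriple K k η a b c) (hk : 4 ≤ k) (hn : Nat.card V + 2 = 3 * k) :
    ¬ ((side K {a, b, c} η 1 a).ncard = 2 ∧ (side K {a, b, c} η 1 b).ncard = 2 ∧
      (side K {a, b, c} η 1 c).ncard = 2) := by
  have := hK.finite
  rintro ⟨ha, hb, hc⟩
  obtain ⟨-, h1, -, -⟩ := h.sides_of_card hK (by omega) hn
  obtain ⟨x, y, z, hxy, hyz, hxz, sa, sb, sc⟩ := h.exists_two_two_two hK ha hb hc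
  set S : Set V := {a, b, c} with hS
  set B : Set V := {x, y, z} with hB
  have anti := h.cut.cocycle.antisymm
  have may : y ∈ side K S η 1 a := by rw [sa]; simp
  have maz : z ∈ side K S η 1 a := by rw [sa]; simp
  have mbx : x ∈ side K S η 1 b := by rw [sb]; simp
  have mbz : z ∈ side K S η 1 b := by rw [sb]; simp
  have mcx : x ∈ side K S η 1 c := by rw [sc]; simp
  have mcy : y ∈ side K S η 1 c := by rw [sc]; simp
  have hBS : ∀ q ∈ B, q ∉ S := by
    rintro q (rfl | rfl | rfl)
    exacts [mbx.1, may.1, maz.1]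
  have hLB : ∀ s ∈ S, ∀ q ∈ side K S η 1 s, q ∈ B := by
    rintro s (rfl | rfl | rfl) q hq
    · rw [sa] at hq; rcases hq with rfl | rfl <;> simp [hB]
    · rw [sb] at hq; rcases hq with rfl | rfl <;> simp [hB]
    · rw [sc] at hq; rcases hq with rfl | rfl <;> simp [hB]
  have hcut : IsCut K B (η - cobd (ind B)) := by
    refine ⟨h.cut.cocycle.sub_cobd _, ?_, ?_, ?_⟩
    · intro p q hp hq
      have h0 : η p q = 0 := by
        by_cases hpq : p = q
        · rw [hpq]; exact h.cut.cocycle.self q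
        · refine h.cut.zero_out p q ?_ (hBS p hp) (hBS q hq)
          rcases hp with rfl | rfl | rfl <;> rcases hq with rfl | rfl | rfl <;>
            first | exact absurd rfl hpq | assumption | (apply Adj.symm; assumption)
      simp [cobd, ind_of_mem hp, ind_of_mem hq, h0]
    · intro p q hpq hp hq
      have h0 : η p q = 0 := by
        by_cases hpS : p ∈ S <;> by_cases hqS : q ∈ S
        · exact h.cut.zero_in p q hpS hqS
        · rcases h.val_eq hpS hqS hpq with h' | h'
          · exact h'.2.2
          · exact absurd (hLB p hpS q h') hq
        · rcases h.val_eq hqS hpS hpq.symm with h' | h'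
          · rw [anti, h'.2.2, neg_zero]
          · exact absurd (hLB q hqS p h') hp
        · exact h.cut.zero_out p q hpq hpS hqS
      simp [cobd, ind_of_notMem hp, ind_of_notMem hq, h0]
    · intro p q hpq hp hq
      simp only [Pi.sub_apply, cobd, ind_of_mem hp, ind_of_notMem hq]
      by_cases hqS : q ∈ S
      · have := h.cut.vals q p hpq.symm hqS (hBS p hp)
        have := anti p q
        omega
      · have := h.cut.zero_out p q hpq (hBS p hp) hqS
        omega
  have h' : IsCutTriple K k (η - cobd (ind B)) x y z := {
    ab := hxy
    bc := hyz
    ac := hxz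
    cut := hcut
    not_cobd := fun h' => h.not_cobd h'.of_sub_cobd
    le_length := fun v n s hw hs => h.le_length v n _ hw.add_cobd (by simpa using hs) }
  have hR : ∀ s ∈ S, ∀ q ∈ B, q ∈ side K S η 1 s → s ∈ side K B (η - cobd (ind B)) 0 q := by
    intro s hs q hq hsq
    have hsB : s ∉ B := fun h' => hBS s h' hs
    refine ⟨hsB, hsq.2.1.symm, ?_⟩
    have := anti q s
    have := hsq.2.2
    simp only [Pi.sub_apply, cobd, ind_of_mem hq, ind_of_notMem hsB]
    omega
  have hR2 : ∀ s ∈ S, ∀ s' ∈ S, s ≠ s' → ∀ q ∈ B, q ∈ side K S η 1 s → q ∈ side K S η 1 s' →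
      2 ≤ (side K B (η - cobd (ind B)) 0 q).ncard := by
    intro s hs s' hs' hne q hq h1 h2
    rw [← Set.ncard_pair hne]
    refine Set.ncard_le_ncard ?_
    rintro v (rfl | rfl)
    · exact hR _ hs q hq h1
    · exact hR _ hs' q hq h2
  obtain ⟨g0, g1, g2, g3⟩ := h'.sides_of_card hK (by omega) hn
  rw [← hB] at g0 g1 g2 g3
  have r1 := hR2 b (by simp [hS]) c (by simp [hS]) h.bc.1 x (by simp [hB]) mbx mcx
  have r2 := hR2 a (by simp [hS]) c (by simp [hS]) h.ac.1 y (by simp [hB]) may mcy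
  have r3 := hR2 a (by simp [hS]) b (by simp [hS]) h.ab.1 z (by simp [hB]) maz mbz
  obtain ⟨x', y', z', hxy', hyz', hxz', -, sb', sc'⟩ := h'.exists_two_two_two hK
    (by rw [← hB]; omega) (by rw [← hB]; omega) (by rw [← hB]; omega)
  rw [← hB] at sb' sc'
  -- left neighbours of `y` and `z` are reached from `a` in two steps
  have hreach : ∀ q ∈ B, q ∈ side K S η 1 a → ∀ v ∈ side K B (η - cobd (ind B)) 1 q,
      v ∈ reach K S η a 2 := by
    intro q hq haq v hv
    have h1 := hv.2.2
    simp only [Pi.sub_apply, cobd, ind_of_mem hq, ind_of_notMem hv.1] at h1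
    have hvS : v ∉ S := by
      intro hvS
      rcases h.val_eq hvS (hBS q hq) hv.2.1.symm with h2 | h2
      · exact h.notMem_reach hvS h2 (j := 1) (by omega) (side_subset_reach le_rfl haq)
      · have := h2.2.2
        have := anti q v
        omega
    refine ⟨hvS, 2, le_rfl, ?_⟩
    have h2 := (WalkSum.single (η := η) haq.2.1).snoc hv.2.1
    rw [haq.2.2, h.cut.zero_out q v hv.2.1 (hBS q hq) hvS] at h2
    simpa using h2
  have hx' : x' ∈ side K B (η - cobd (ind B)) 1 y := by rw [sb']; simp
  have hz' : z' ∈ side K B (η - cobd (ind B)) 1 y := by rw [sb']; simp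
  have hy' : y' ∈ side K B (η - cobd (ind B)) 1 z := by rw [sc']; simp
  have hsub : B ∪ {x', y', z'} ⊆ reach K S η a 2 := by
    rintro v ((rfl | rfl | rfl) | (rfl | rfl | rfl))
    · exact h.side_subset_reach_two (by simp) le_rfl mbx
    · exact side_subset_reach (by omega) may
    · exact side_subset_reach (by omega) maz
    · exact hreach y (by simp [hB]) may _ hx'
    · exact hreach z (by simp [hB]) maz _ hy'
    · exact hreach y (by simp [hB]) may _ hz'
  have hdisj : Disjoint B {x', y', z'} := by
    rw [Set.disjoint_right]
    rintro v (rfl | rfl | rfl)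
    exacts [hx'.1, hy'.1, hz'.1]
  have hcard := Set.ncard_le_ncard hsub
  rw [Set.ncard_union_eq hdisj, h'.ncard_triple,
    Set.ncard_eq_three.mpr ⟨x', y', z', hxy'.1, hxz'.1, hyz'.1, rfl⟩] at hcard
  have h5 := h.reach_growth hK (i := 2) (by omega) (k - 4) (by omega)
  have h6 := h.reach_le hK (j := 2 + (k - 4)) (by omega)
  rw [← hS] at h5 h6
  omega

/-- After renaming its vertices, the triple of a minimal torus has `1`, `2` and `3` neighbours on
its left. -/
theorem IsCutTriple.exists_one_two_three (hK : IsTriangulatedTorus K)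
    (h : IsCutTriple K k η a b c) (hk : 3 ≤ k) (hn : Nat.card V + 2 = 3 * k) :
    ∃ p q r, IsCutTriple K k η p q r ∧ (side K {p, q, r} η 1 p).ncard = 1 ∧
      (side K {p, q, r} η 1 q).ncard = 2 ∧ (side K {p, q, r} η 1 r).ncard = 3 := by
  obtain ⟨h0, -, -, -⟩ := h.sides_of_card hK hk hn
  have h222 : ¬ ((side K {a, b, c} η 1 a).ncard = 2 ∧ (side K {a, b, c} η 1 b).ncard = 2 ∧
      (side K {a, b, c} η 1 c).ncard = 2) := by
    rcases hk.lt_or_eq with hk | rfl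
    · exact h.not_two_two_two_of_four_le hK hk hn
    · exact h.not_two_two_two_of_three hK (by omega)
  have p1 := h.one_le hK
  have p2 := h.rotate.one_le hK
  have p3 := h.rotate.rotate.one_le hK
  have q1 := h.two_le hK
  have q2 := h.rotate.two_le hK
  have q3 := h.rotate.rotate.two_le hK
  have e1 : ({b, c, a} : Set V) = {a, b, c} := set_triple_rotate a b c
  have e2 : ({c, a, b} : Set V) = {a, b, c} := by rw [set_triple_rotate b c a, e1]
  rw [e1] at p2 q2
  rw [e2] at p3 q3
  have key : ∀ p q r, IsCutTriple K k η p q r → ({p, q, r} : Set V) = {a, b, c} →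
      (side K {a, b, c} η 1 p).ncard = 1 → (side K {a, b, c} η 1 q).ncard = 2 →
      (side K {a, b, c} η 1 r).ncard = 3 →
      ∃ p q r, IsCutTriple K k η p q r ∧ (side K {p, q, r} η 1 p).ncard = 1 ∧
      (side K {p, q, r} η 1 q).ncard = 2 ∧ (side K {p, q, r} η 1 r).ncard = 3 := by
    intro p q r hc he h1 h2 h3
    exact ⟨p, q, r, hc, by rw [he]; exact h1, by rw [he]; exact h2, by rw [he]; exact h3⟩
  by_cases ha : (side K {a, b, c} η 1 a).ncard = 1
  · by_cases hb : (side K {a, b, c} η 1 b).ncard = 2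
    · exact key a b c h rfl ha hb (by omega)
    · exact key a c b h.swap.rotate (set_triple_swap_right _ _ _) ha (by omega) (by omega)
  by_cases hb : (side K {a, b, c} η 1 b).ncard = 1
  · by_cases hc : (side K {a, b, c} η 1 c).ncard = 2
    · exact key b c a h.rotate e1 hb hc (by omega)
    · exact key b a c h.swap (set_triple_swap _ _ _) hb (by omega) (by omega)
  by_cases hc : (side K {a, b, c} η 1 c).ncard = 1
  · by_cases ha' : (side K {a, b, c} η 1 a).ncard = 2
    · exact key c a b h.rotate.rotate e2 hc ha' (by omega)
    · exact key c b a h.rotate.swap (by rw [set_triple_swap, e1]) hc (by omega) (by omega)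
  omega

end

/-! ### The vertices of a minimal torus in cyclic order -/

/-- Consecutive empty triangles `x t`, `x (t + 1)`, `x (t + 2)`, each of which arises from the
previous one by moving its first vertex `x t` across two triangles to `x (t + 3)`. The cocycle dual
to the triangle number `t` is `η - cobd (F t)`. -/
structure IsUnrolling (K : AbstractSimplicialComplex V) (k : ℕ) (η : V → V → ℤ) (x : ℕ → V)
    (F : ℕ → V → ℤ) : Prop where
  cut : ∀ t, IsCutTriple K k (η - cobd (F t)) (x t) (x (t + 1)) (x (t + 2))
  next : ∀ t, F (t + 1) = F t + ind {x (t + 3)}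
  mem : ∀ t, x (t + 3) ∈ side K {x t, x (t + 1), x (t + 2)} (η - cobd (F t)) 1 (x t)
  tri_one : ∀ t, IsTriangle K (x t) (x (t + 3)) (x (t + 1))
  tri_two : ∀ t, IsTriangle K (x t) (x (t + 3)) (x (t + 2))

theorem IsCutTriple.exists_unrolling {k : ℕ} {η : V → V → ℤ} {a b c : V}
    (hK : IsTriangulatedTorus K) (h : IsCutTriple K k η a b c) (hk : 3 ≤ k)
    (hn : Nat.card V + 2 = 3 * k) : ∃ x F, IsUnrolling K k η x F := by
  have := hK.finite
  obtain ⟨p, q, r, hc, h1, h2, h3⟩ := h.exists_one_two_three hK hk hn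
  -- the possible stages of the sequence: a triple of type `(1, 2, 3)` and a potential
  let State := {s : (V × V × V) × (V → ℤ) //
    IsCutTriple K k (η - cobd s.2) s.1.1 s.1.2.1 s.1.2.2 ∧
    (side K {s.1.1, s.1.2.1, s.1.2.2} (η - cobd s.2) 1 s.1.1).ncard = 1 ∧
    (side K {s.1.1, s.1.2.1, s.1.2.2} (η - cobd s.2) 1 s.1.2.1).ncard = 2 ∧
    (side K {s.1.1, s.1.2.1, s.1.2.2} (η - cobd s.2) 1 s.1.2.2).ncard = 3}
  have step : ∀ s : State, ∃ s' : State, s'.1.1.1 = s.1.1.2.1 ∧ s'.1.1.2.1 = s.1.1.2.2 ∧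
      s'.1.2 = s.1.2 + ind {s'.1.1.2.2} ∧
      s'.1.1.2.2 ∈ side K {s.1.1.1, s.1.1.2.1, s.1.1.2.2} (η - cobd s.1.2) 1 s.1.1.1 ∧
      IsTriangle K s.1.1.1 s'.1.1.2.2 s.1.1.2.1 ∧ IsTriangle K s.1.1.1 s'.1.1.2.2 s.1.1.2.2 := by
    rintro ⟨⟨⟨a, b, c⟩, f⟩, hcut, l1, l2, l3⟩
    dsimp only at hcut l1 l2 l3
    obtain ⟨y, hy⟩ := Set.ncard_eq_one.mp l1
    obtain ⟨t1, t2⟩ := hcut.triangles_of_singleton hK hy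
    obtain ⟨m1, m2, m3, m4, m5⟩ := hcut.move hK hy
    have e : η - cobd f - cobd (ind {y}) = η - cobd (f + ind {y}) := by
      funext u v; simp [cobd]; ring
    rw [e] at m1 m2 m3
    have hs := (m1.sides_of_card hK hk hn).1
    have n2 : (side K {y, b, c} (η - cobd (f + ind {y})) 1 b).ncard = 1 := by
      rw [m2, Set.ncard_sdiff_singleton_of_mem m4, l2]
    have n3 : (side K {y, b, c} (η - cobd (f + ind {y})) 1 c).ncard = 2 := by
      rw [m3, Set.ncard_sdiff_singleton_of_mem m5, l3]
    refine ⟨⟨⟨⟨b, c, y⟩, f + ind {y}⟩, m1.rotate, ?_, ?_, ?_⟩, rfl, rfl, rfl, ?_, t1, t2⟩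
    · dsimp only; rw [set_triple_rotate]; exact n2
    · dsimp only; rw [set_triple_rotate]; exact n3
    · dsimp only; rw [set_triple_rotate]; omega
    · dsimp only; rw [hy]; rfl
  choose next hnext using step
  have e0 : η - cobd (0 : V → ℤ) = η := by funext u v; simp [cobd]
  let s₀ : State := ⟨⟨⟨p, q, r⟩, 0⟩, by
    dsimp only; rw [e0]; exact ⟨hc, h1, h2, h3⟩⟩
  let s : ℕ → State := fun t => next^[t] s₀
  have hs : ∀ t, s (t + 1) = next (s t) := fun t => Function.iterate_succ_apply' _ _ _
  have hb : ∀ t, (s t).1.1.2.1 = (s (t + 1)).1.1.1 := fun t => by rw [hs]; exact (hnext _).1.symm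
  have hc : ∀ t, (s t).1.1.2.2 = (s (t + 2)).1.1.1 := fun t => by
    rw [← hb, hs]; exact (hnext _).2.1.symm
  refine ⟨fun t => (s t).1.1.1, fun t => (s t).1.2, fun t => ?_, fun t => ?_, fun t => ?_,
    fun t => ?_, fun t => ?_⟩
  · have := (s t).2.1
    rwa [hb, hc] at this
  · have := (hnext (s t)).2.2.1
    rw [← hs, hc] at this
    exact this
  · have := (hnext (s t)).2.2.2.1
    rw [← hs, hc (t + 1), hb t, hc t] at this
    exact this
  · have := (hnext (s t)).2.2.2.2.1
    rw [← hs, hc (t + 1), hb t] at this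
    exact this
  · have := (hnext (s t)).2.2.2.2.2
    rw [← hs, hc (t + 1), hc t] at this
    exact this

namespace IsUnrolling

variable {k : ℕ} {η : V → V → ℤ} {x : ℕ → V} {F : ℕ → V → ℤ}

theorem next_eq (h : IsUnrolling K k η x F) {t : ℕ} {v : V} (hv : v ≠ x (t + 3)) :
    F (t + 1) v = F t v := by
  rw [h.next]; simp [ind_of_notMem (S := {x (t + 3)}) hv]

theorem next_self (h : IsUnrolling K k η x F) (t : ℕ) :
    F (t + 1) (x (t + 3)) = F t (x (t + 3)) + 1 := by
  rw [h.next]; simp [ind_of_mem (S := {x (t + 3)}) rfl]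

theorem mono (h : IsUnrolling K k η x F) (v : V) : Monotone (fun t => F t v) := by
  refine monotone_nat_of_le_succ fun t => ?_
  by_cases hv : v = x (t + 3)
  · rw [hv, h.next_self]; omega
  · rw [h.next_eq hv]

theorem ne_one (h : IsUnrolling K k η x F) (t : ℕ) : x (t + 1) ≠ x t := (h.cut t).ab.1.symm

theorem ne_two (h : IsUnrolling K k η x F) (t : ℕ) : x (t + 2) ≠ x t := (h.cut t).ac.1.symm

/-- The potential `t ↦ F t (x t)` computes the sum of `η` along a walk in the sequence, with steps
of length at most three. -/
theorem walk (h : IsUnrolling K k η x F) (m : ℕ) : ∀ t, WalkSum K η (x t) (x (t + m)) ((m + 2) / 3)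
    (F (t + m) (x (t + m)) - F t (x t)) := by
  induction m using Nat.strong_induction_on with
  | _ m ih =>
    intro t
    match m, ih with
    | 0, _ => simpa using WalkSum.nil (x t)
    | 1, _ =>
      have h1 := (h.cut t).cut.zero_in (x t) (x (t + 1)) (by simp) (by simp)
      have h2 := h.next_eq (t := t) (v := x (t + 1)) (h.ne_two (t + 1)).symm
      simp only [Pi.sub_apply, cobd] at h1
      convert WalkSum.single (η := η) (h.cut t).ab using 1
      omega
    | 2, _ =>
      have h1 := (h.cut t).cut.zero_in (x t) (x (t + 2)) (by simp) (by simp)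
      have h2 := h.next_eq (t := t) (v := x (t + 2)) (h.ne_one (t + 2)).symm
      have h3 := h.next_eq (t := t + 1) (v := x (t + 2)) (h.ne_two (t + 2)).symm
      simp only [Pi.sub_apply, cobd] at h1
      convert WalkSum.single (η := η) (h.cut t).ac using 1
      have e : t + 1 + 1 = t + 2 := rfl
      rw [e] at h3
      omega
    | m + 3, ih =>
      have h1 := (h.mem t).2.2
      have h2 := h.next_self t
      have h3 := h.next_eq (t := t + 1) (v := x (t + 3)) (h.ne_one (t + 3)).symm
      have h4 := h.next_eq (t := t + 2) (v := x (t + 3)) (h.ne_two (t + 3)).symm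
      simp only [Pi.sub_apply, cobd] at h1
      have h5 := (WalkSum.single (η := η) (h.mem t).2.1).append (ih m (by omega) (t + 3))
      have e : t + 3 + m = t + (m + 3) := by ring
      have e1 : t + 1 + 1 = t + 2 := rfl
      have e2 : t + 2 + 1 = t + 3 := rfl
      rw [e] at h5
      rw [e1] at h3
      rw [e2] at h4
      convert h5 using 1
      · omega
      · omega

/-- A repetition in the sequence closes a walk with positive sum, so it takes a long time. -/
theorem le_of_eq (h : IsUnrolling K k η x F) {i m : ℕ} (hm : m ≠ 0) (he : x (i + m) = x i) :
    3 * k ≤ m + 2 := by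
  obtain rfl | rfl | ⟨m, rfl⟩ : m = 1 ∨ m = 2 ∨ ∃ m', m = m' + 3 := by
    rcases m with _ | _ | _ | m
    · exact absurd rfl hm
    · exact Or.inl rfl
    · exact Or.inr (Or.inl rfl)
    · exact Or.inr (Or.inr ⟨m, rfl⟩)
  · exact absurd he (h.ne_one i)
  · exact absurd he (h.ne_two i)
  · have hw := h.walk (m + 3) i
    have h1 := h.next_self (i + m)
    have h2 : F (i + m + 1) (x (i + m + 3)) ≤ F (i + m + 3) (x (i + m + 3)) :=
      h.mono _ (by omega)
    have h3 : F i (x (i + m + 3)) ≤ F (i + m) (x (i + m + 3)) := h.mono _ (by omega)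
    have e : i + (m + 3) = i + m + 3 := by ring
    rw [e] at hw he
    rw [he] at hw h1 h2 h3
    have := (h.cut 0).le_length
    have hcut : ∀ v n s, WalkSum K η v v n s → s ≠ 0 → k ≤ n := by
      intro v n s hw hs
      have := hw.sub_cobd (F 0)
      exact (h.cut 0).le_length v n _ this (by simpa using hs)
    have := hcut _ _ _ hw (by omega)
    omega

end IsUnrolling

/-- The vertices of a minimal torus can be numbered cyclically such that the triangles that contain
`i` and `i + 3` are those of the standard torus. -/
theorem HasType.exists_equiv {k : ℕ} (hK : IsTriangulatedTorus K) (h : HasType K 3 k)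
    (hn : Nat.card V = 3 * k - 2) : ∃ e : ZMod (3 * k - 2) ≃ V,
      ∀ i, IsTriangle K (e i) (e (i + 3)) (e (i + 1)) ∧
        IsTriangle K (e i) (e (i + 3)) (e (i + 2)) := by
  have := hK.finite
  obtain ⟨hk, a, b, c, η, hab, hbc, hac, hcut, hco, hlb⟩ := h.exists_isCut hK
  obtain ⟨x, F, hx⟩ := IsCutTriple.exists_unrolling (k := k) hK
    ⟨hab, hbc, hac, hcut, hco, hlb⟩ hk (by omega)
  set n := 3 * k - 2 with hn'
  have : NeZero n := ⟨by omega⟩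
  have hinj : ∀ t, Function.Injective (fun i : Fin n => x (t + i)) := by
    intro t i j hij
    by_contra hne
    wlog hlt : i < j generalizing i j
    · exact this hij.symm (Ne.symm hne) (lt_of_le_of_ne (not_lt.mp hlt) (Ne.symm hne))
    have h1 : (i : ℕ) < j := hlt
    have h2 := j.2
    have := hx.le_of_eq (i := t + i) (m := j - i) (by omega) (by
      have e : t + (i : ℕ) + (j - i) = t + j := by omega
      rw [e]; exact hij.symm)
    omega
  have hsurj : ∀ t v, ∃ i < n, x (t + i) = v := by
    intro t v
    have hb : Function.Bijective (fun i : Fin n => x (t + i)) :=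
      (Nat.bijective_iff_injective_and_card _).mpr ⟨hinj t, by simp [hn]⟩
    obtain ⟨i, hi⟩ := hb.2 v
    exact ⟨i, i.2, hi⟩
  have hper : Function.Periodic x n := by
    intro t
    obtain ⟨i, hi, he⟩ := hsurj t (x (t + n))
    have := hx.le_of_eq (i := t + i) (m := n - i) (by omega) (by
      have e : t + i + (n - i) = t + n := by omega
      rw [e]; exact he.symm)
    have : i = 0 := by omega
    subst this
    exact he.symm
  have hval : ∀ t : ℕ, x ((t : ZMod n)).val = x t := by
    intro t
    rw [ZMod.val_natCast]
    exact hper.map_mod_nat t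
  have hbij : Function.Bijective (fun i : ZMod n => x i.val) := by
    refine (Nat.bijective_iff_injective_and_card _).mpr ⟨fun i j hij => ?_, by simp [hn]⟩
    have := hinj 0 (a₁ := ⟨i.val, ZMod.val_lt i⟩) (a₂ := ⟨j.val, ZMod.val_lt j⟩) (by simpa using hij)
    exact ZMod.val_injective n (congrArg Fin.val this)
  refine ⟨Equiv.ofBijective _ hbij, fun i => ?_⟩
  have hadd : ∀ m : ℕ, x (i + (m : ZMod n)).val = x (i.val + m) := by
    intro m
    rw [← hval (i.val + m)]
    simp
  have h1 := hadd 1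
  have h2 := hadd 2
  have h3 := hadd 3
  simp only [Nat.cast_one, Nat.cast_ofNat] at h1 h2 h3
  simp only [Equiv.ofBijective_apply, h1, h2, h3]
  exact ⟨hx.tri_one _, hx.tri_two _⟩

/-! ### Homotopies of edge paths -/

/-- The difference of the closed paths `M` and `N`, as 1-chains, is the boundary of a 2-chain. A
2-chain is given by its coefficients `C t` at the oriented triangles `t`, so that the coefficient
of its boundary at an edge is the difference of its coefficients on the two sides. -/
def Homologous (O : V → V → V → Prop) (M N : Cycle V) : Prop :=
  ∃ C : Finset V → ℤ, ∀ x y z w, O x y z → O y x w →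
    cycleSum (pairInd x y) M - cycleSum (pairInd x y) N = C {x, y, z} - C {x, y, w}

theorem Homologous.symm {M N : Cycle V} (h : Homologous O M N) : Homologous O N M := by
  obtain ⟨C, hC⟩ := h
  refine ⟨-C, fun x y z w hz hw => ?_⟩
  have := hC x y z w hz hw
  simp only [Pi.neg_apply]
  omega

theorem Homologous.trans {M N P : Cycle V} (h : Homologous O M N) (h' : Homologous O N P) :
    Homologous O M P := by
  obtain ⟨C, hC⟩ := h
  obtain ⟨C', hC'⟩ := h'
  refine ⟨C + C', fun x y z w hz hw => ?_⟩
  have := hC x y z w hz hw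
  have := hC' x y z w hz hw
  simp only [Pi.add_apply]
  omega

theorem IsOrientation.cases_of_eq (hO : IsOrientation K O) {a b c x y z : V} (h : O a b c)
    (hx : O x y z) (he : ({x, y, z} : Finset V) = {a, b, c}) :
    (x = a ∧ y = b ∧ z = c) ∨ (x = b ∧ y = c ∧ z = a) ∨ (x = c ∧ y = a ∧ z = b) := by
  have ht := hO.tri hx
  have h1 : x ∈ ({a, b, c} : Finset V) := by rw [← he]; simp
  have h2 : y ∈ ({a, b, c} : Finset V) := by rw [← he]; simp
  have h3 : z ∈ ({a, b, c} : Finset V) := by rw [← he]; simp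
  simp only [Finset.mem_insert, Finset.mem_singleton] at h1 h2 h3
  have e1 := ht.1
  have e2 := ht.2.1
  have e3 := ht.2.2.1
  have r1 := hO.rot hx
  have r2 := hO.rot r1
  have nb := @hO.not_both
  rcases h1 with rfl | rfl | rfl <;> rcases h2 with rfl | rfl | rfl <;>
    rcases h3 with rfl | rfl | rfl <;>
    first
    | exact absurd rfl e1
    | exact absurd rfl e2
    | exact absurd rfl e3
    | (exfalso; exact nb h hx)
    | (exfalso; exact nb h r1)
    | (exfalso; exact nb h r2)
    | simp

/-- The boundary of a single oriented triangle. -/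
theorem IsOrientation.boundary_triangle (hO : IsOrientation K O) {a b c : V} (h : O a b c)
    {x y z w : V} (hz : O x y z) (hw : O y x w) :
    pairInd x y a b + pairInd x y b c + pairInd x y c a =
      (if ({x, y, z} : Finset V) = {a, b, c} then 1 else 0) -
        (if ({x, y, w} : Finset V) = {a, b, c} then 1 else 0) := by
  have hr := hO.rot h
  have hr' := hO.rot hr
  have ht := hO.tri h
  have e1 := ht.1
  have e2 := ht.2.1
  have e3 := ht.2.2.1
  have hzw : z ≠ w := by rintro rfl; exact hO.not_both hz hw
  have hxy := (hO.tri hz).1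
  have hne : ¬ (({x, y, z} : Finset V) = {a, b, c} ∧ ({x, y, w} : Finset V) = {a, b, c}) := by
    rintro ⟨h1, h2⟩
    have h3 : w ∈ ({x, y, z} : Finset V) := by rw [h1, ← h2]; simp
    simp only [Finset.mem_insert, Finset.mem_singleton] at h3
    rcases h3 with rfl | rfl | rfl
    · exact (hO.tri hw).2.1 rfl
    · exact (hO.tri hw).2.2.1 rfl
    · exact hzw rfl
  by_cases h1 : ({x, y, z} : Finset V) = {a, b, c}
  · have h2 : ¬ ({x, y, w} : Finset V) = {a, b, c} := fun h' => hne ⟨h1, h'⟩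
    rw [if_pos h1, if_neg h2]
    rcases hO.cases_of_eq h hz h1 with ⟨rfl, rfl, rfl⟩ | ⟨rfl, rfl, rfl⟩ | ⟨rfl, rfl, rfl⟩ <;>
      simp [pairInd, e1, e2, e3, e1.symm, e2.symm, e3.symm]
  · rw [if_neg h1]
    by_cases h2 : ({x, y, w} : Finset V) = {a, b, c}
    · rw [if_pos h2]
      rw [← triple_swap] at h2
      rcases hO.cases_of_eq h hw h2 with ⟨rfl, rfl, rfl⟩ | ⟨rfl, rfl, rfl⟩ | ⟨rfl, rfl, rfl⟩ <;>
        simp [pairInd, e1, e2, e3, e1.symm, e2.symm, e3.symm]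
    · rw [if_neg h2]
      have key : ∀ p q r, O p q r → ({p, q, r} : Finset V) = {a, b, c} → pairInd x y p q = 0 := by
        intro p q r hpqr he
        have n1 : ¬ (p = x ∧ q = y) := by
          rintro ⟨rfl, rfl⟩
          exact h1 (by rw [hO.uniq hz hpqr, he])
        have n2 : ¬ (p = y ∧ q = x) := by
          rintro ⟨rfl, rfl⟩
          exact h2 (by rw [← triple_swap, hO.uniq hw hpqr, he])
        simp only [pairInd, if_neg n1, if_neg n2, sub_zero]
      rw [key a b c h rfl, key b c a hr (triple_rotate _ _ _),
        key c a b hr' (by rw [triple_rotate b c a, triple_rotate])]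
      simp

theorem pairInd_self (x y p : V) : pairInd x y p p = 0 := by
  simp [pairInd, and_comm]

theorem homologous_of_step (hO : IsOrientation K O) {M N : Cycle V} (h : HomotopyStep K M N) :
    Homologous O M N := by
  obtain ⟨a, b, c, l, hf⟩ := h
  have hred : ∀ x y, cycleSum (pairInd x y) ((a :: b :: c :: l : List V) : Cycle V) -
      cycleSum (pairInd x y) ((a :: c :: l : List V) : Cycle V) =
      pairInd x y a b + pairInd x y b c + pairInd x y c a := by
    intro x y
    simp only [cycleSum_coe, listSum, pathSum, List.cons_append]
    rw [pairInd_antisymm x y a c]; ring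
  by_cases hd : a ≠ b ∧ b ≠ c ∧ a ≠ c
  · rcases hO.or (⟨hd.1, hd.2.1, hd.2.2, hf⟩ : IsTriangle K a b c) with h | h
    · refine ⟨fun t => if t = {a, b, c} then 1 else 0, fun x y z w hz hw => ?_⟩
      rw [hred, hO.boundary_triangle h hz hw]
    · refine ⟨fun t => -(if t = {b, a, c} then 1 else 0), fun x y z w hz hw => ?_⟩
      have := hO.boundary_triangle h hz hw
      rw [hred, pairInd_antisymm x y a b, pairInd_antisymm x y b c, pairInd_antisymm x y c a]
      dsimp only
      linarith
  · refine ⟨0, fun x y z w _ _ => ?_⟩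
    rw [hred]
    have : a = b ∨ b = c ∨ a = c := by tauto
    rcases this with rfl | rfl | rfl
    · rw [pairInd_self, pairInd_antisymm x y c a]; simp
    · rw [pairInd_self, pairInd_antisymm x y b a]; simp
    · rw [pairInd_self, pairInd_antisymm x y b a]; simp

theorem homologous_of_eqvGen (hO : IsOrientation K O) {M N : Cycle V}
    (h : Relation.EqvGen (HomotopyStep K) M N) : Homologous O M N := by
  induction h with
  | rel _ _ h => exact homologous_of_step hO h
  | refl => exact ⟨0, fun x y z w _ _ => by simp⟩
  | symm _ _ _ ih => exact ih.symm
  | trans _ _ _ _ _ ih ih' => exact ih.trans ih'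

/-- A cycle that is homotopic to a closed path whose 1-chain is divisible by `m ≠ 1` bounds a
disc. -/
theorem boundsDisc_of_dvd (hK : IsTriangulatedTorus K) (hO : IsOrientation K O) {c d : Cycle V}
    (hc : IsCycle K c) (h : Relation.EqvGen (HomotopyStep K) c d) {m : ℕ} (hm : m ≠ 1)
    (hd : ∀ x y, (m : ℤ) ∣ cycleSum (pairInd x y) d) : BoundsDisc K c := by
  obtain ⟨C, hC⟩ := homologous_of_eqvGen hO h
  refine boundsDisc_of_chain hK hO hc hm C fun x y z w hz hw => ?_
  rw [← hC x y z w hz hw]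
  simpa using hd x y

/-- An elementary homotopy of an edge path, given by the list of its vertices, with fixed
endpoints. -/
inductive PathStep (K : AbstractSimplicialComplex V) : List V → List V → Prop
  | skip (p : List V) (a b c : V) (q : List V) (h : {a, b, c} ∈ K.faces) :
      PathStep K (p ++ a :: b :: c :: q) (p ++ a :: c :: q)

/-- Edge paths are homotopic with fixed endpoints. -/
def PathHomotopic (K : AbstractSimplicialComplex V) : List V → List V → Prop :=
  Relation.EqvGen (PathStep K)

namespace PathHomotopic

theorem refl (l : List V) : PathHomotopic K l l := Relation.EqvGen.refl _

theorem symm {l m : List V} (h : PathHomotopic K l m) : PathHomotopic K m l :=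
  Relation.EqvGen.symm _ _ h

theorem trans {l m n : List V} (h : PathHomotopic K l m) (h' : PathHomotopic K m n) :
    PathHomotopic K l n :=
  Relation.EqvGen.trans _ _ _ h h'

theorem cons (a : V) {l m : List V} (h : PathHomotopic K l m) :
    PathHomotopic K (a :: l) (a :: m) := by
  induction h with
  | rel _ _ h =>
    obtain ⟨p, x, y, z, q, h⟩ := h
    exact .rel _ _ (.skip (a :: p) x y z q h)
  | refl => exact refl _
  | symm _ _ _ ih => exact ih.symm
  | trans _ _ _ _ _ ih ih' => exact ih.trans ih'

theorem skip {a b c : V} (l : List V) (h : {a, b, c} ∈ K.faces) :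
    PathHomotopic K (a :: b :: c :: l) (a :: c :: l) :=
  .rel _ _ (.skip [] a b c l h)

theorem cycle {l m : List V} (h : PathHomotopic K l m) :
    Relation.EqvGen (HomotopyStep K) (l : Cycle V) (m : Cycle V) := by
  induction h with
  | rel _ _ h =>
    obtain ⟨p, x, y, z, q, h⟩ := h
    have e1 : ((p ++ x :: y :: z :: q : List V) : Cycle V) =
        ((x :: y :: z :: (q ++ p) : List V) : Cycle V) :=
      Cycle.coe_eq_coe.mpr ⟨p.length, by rw [List.rotate_append_length_eq]; rfl⟩
    have e2 : ((p ++ x :: z :: q : List V) : Cycle V) =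
        ((x :: z :: (q ++ p) : List V) : Cycle V) :=
      Cycle.coe_eq_coe.mpr ⟨p.length, by rw [List.rotate_append_length_eq]; rfl⟩
    rw [e1, e2]
    exact .rel _ _ (.skip x y z _ h)
  | refl => exact .refl _
  | symm _ _ _ ih => exact .symm _ _ ih
  | trans _ _ _ _ _ ih ih' => exact .trans _ _ _ ih ih'

end PathHomotopic

/-- The path `l` has at least two vertices and starts with `v`. -/
def Starts (K : AbstractSimplicialComplex V) (l : List V) (v : V) : Prop :=
  ∃ w t, l = v :: w :: t ∧ {v, w} ∈ K.faces

theorem Starts.cons {l : List V} {v w : V} (h : Starts K l v) (hadj : Adj K w v) :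
    Starts K (w :: l) w := by
  obtain ⟨x, t, rfl, _⟩ := h
  exact ⟨v, x :: t, rfl, hadj.2⟩

/-- A path may be replaced by a path with an additional detour through a triangle. -/
theorem Starts.skip {l : List V} {u v w : V} (h : Starts K l w) (hf : {u, v, w} ∈ K.faces) :
    PathHomotopic K (u :: v :: l) (u :: l) := by
  obtain ⟨x, t, rfl, _⟩ := h
  exact .skip _ hf

theorem Starts.backtrack {l : List V} {u v : V} (h : Starts K l u) (hadj : Adj K u v) :
    PathHomotopic K (u :: v :: l) l := by
  refine (h.skip (v := v) ?_).trans ?_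
  · convert hadj.2 using 1
    ext x; simp; tauto
  · obtain ⟨w, t, rfl, hf⟩ := h
    exact .skip _ (by simpa using hf)

/-- The paths that run from a base path forwards or backwards along a line of vertices. Lists of
vertices are read from the end, so that extending a path adds a vertex at the head. -/
theorem exists_ray (f : ℤ → V) (hf : ∀ z, Adj K (f z) (f (z + 1))) {l₀ : List V}
    (h₀ : Starts K l₀ (f 0)) : ∃ N : ℤ → List V, N 0 = l₀ ∧ (∀ z, Starts K (N z) (f z)) ∧
      ∀ z, PathHomotopic K (f (z + 1) :: N z) (N (z + 1)) := by
  let up : ℕ → List V := fun m => Nat.rec l₀ (fun j t => f (j + 1) :: t) m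
  let down : ℕ → List V := fun m => Nat.rec l₀ (fun j t => f (-(j + 1)) :: t) m
  have hup : ∀ m : ℕ, Starts K (up m) (f m) := by
    intro m
    induction m with
    | zero => exact h₀
    | succ m ih =>
      have : Starts K (f (m + 1) :: up m) (f (m + 1)) := ih.cons (hf m).symm
      exact_mod_cast this
  have hdown : ∀ m : ℕ, Starts K (down m) (f (-m)) := by
    intro m
    induction m with
    | zero => exact h₀
    | succ m ih =>
      have h1 := hf (-(m + 1))
      have e : -((m : ℤ) + 1) + 1 = -m := by ring
      rw [e] at h1
      have : Starts K (f (-(m + 1)) :: down m) (f (-(m + 1))) := ih.cons h1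
      exact_mod_cast this
  refine ⟨fun z => match z with
    | .ofNat m => up m
    | .negSucc m => down (m + 1), rfl, fun z => ?_, fun z => ?_⟩
  · match z with
    | .ofNat m => exact hup m
    | .negSucc m => exact hdown (m + 1)
  · match z with
    | .ofNat m => exact .refl _
    | .negSucc 0 => exact h₀.backtrack (by simpa using (hf (-1)).symm)
    | .negSucc (m + 1) => exact (hdown (m + 1)).backtrack (hf (.negSucc (m + 1))).symm

/-! ### The standard torus -/

/-- The complex on `R` with the triangles `i, i + u, i + 3u` and `i, i + 2u, i + 3u`. In the
application `R` is `ZMod n` and `u` is `1`. -/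
def stdTorus {R : Type*} [CommRing R] [DecidableEq R] (u : R) : AbstractSimplicialComplex R where
  faces := {s | s.Nonempty ∧ ∃ i, s ⊆ {i, i + u, i + 3 * u} ∨ s ⊆ {i, i + 2 * u, i + 3 * u}}
  isRelLowerSet_faces := fun s hs => ⟨hs.1, fun t hts ht => ⟨ht, hs.2.imp fun _ h =>
    h.imp hts.trans hts.trans⟩⟩
  singleton_mem v := ⟨by simp, v, Or.inl (by simp)⟩

/-- The orientation of the standard torus: around the vertex `a`, the neighbours are in the cyclic
order `a + u`, `a + 3u`, `a + 2u`, `a - u`, `a - 3u`, `a - 2u`. -/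
def stdOr {R : Type*} [CommRing R] (u a b c : R) : Prop :=
  (b = a + u ∧ c = a + 3 * u) ∨ (b = a + 3 * u ∧ c = a + 2 * u) ∨
    (b = a + 2 * u ∧ c = a - u) ∨ (b = a - u ∧ c = a - 3 * u) ∨
    (b = a - 3 * u ∧ c = a - 2 * u) ∨ (b = a - 2 * u ∧ c = a + u)

/-- The multiples of `u` by the numbers from `1` to `6` are nonzero. -/
def SmallNeZero {R : Type*} [CommRing R] (u : R) : Prop :=
  u ≠ 0 ∧ 2 * u ≠ 0 ∧ 3 * u ≠ 0 ∧ 4 * u ≠ 0 ∧ 5 * u ≠ 0 ∧ 6 * u ≠ 0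

theorem smallNeZero_zmod {n : ℕ} (hn : 7 ≤ n) : SmallNeZero (1 : ZMod n) := by
  have key : ∀ m : ℕ, m ≠ 0 → m < n → (m : ZMod n) ≠ 0 := by
    intro m h0 h
    rw [Ne, ZMod.natCast_eq_zero_iff]
    exact fun h' => absurd (Nat.le_of_dvd (by omega) h') (by omega)
  have h1 := key 1 (by omega) (by omega)
  have h2 := key 2 (by omega) (by omega)
  have h3 := key 3 (by omega) (by omega)
  have h4 := key 4 (by omega) (by omega)
  have h5 := key 5 (by omega) (by omega)
  have h6 := key 6 (by omega) (by omega)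
  simp only [SmallNeZero, mul_one]
  refine ⟨?_, ?_, ?_, ?_, ?_, ?_⟩ <;> assumption_mod_cast

section
variable {R : Type*} [CommRing R] {u : R}

theorem stdOr_rotate {a b c : R} (h : stdOr u a b c) : stdOr u b c a := by
  unfold stdOr at h ⊢
  rcases h with ⟨rfl, rfl⟩ | ⟨rfl, rfl⟩ | ⟨rfl, rfl⟩ | ⟨rfl, rfl⟩ | ⟨rfl, rfl⟩ | ⟨rfl, rfl⟩ <;>
    grind

theorem stdOr_unique (hR : SmallNeZero u) {a b c d : R} (h : stdOr u a b c) (h' : stdOr u a b d) :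
    c = d := by
  obtain ⟨h1, h2, h3, h4, h5, h6⟩ := hR
  unfold stdOr at h h'
  rcases h with ⟨rfl, rfl⟩ | ⟨rfl, rfl⟩ | ⟨rfl, rfl⟩ | ⟨rfl, rfl⟩ | ⟨rfl, rfl⟩ | ⟨rfl, rfl⟩ <;>
    grind

theorem stdOr_swap (hR : SmallNeZero u) {a b c : R} (h : stdOr u a b c) (h' : stdOr u b a c) :
    False := by
  obtain ⟨h1, h2, h3, h4, h5, h6⟩ := hR
  unfold stdOr at h h'
  rcases h with ⟨rfl, rfl⟩ | ⟨rfl, rfl⟩ | ⟨rfl, rfl⟩ | ⟨rfl, rfl⟩ | ⟨rfl, rfl⟩ | ⟨rfl, rfl⟩ <;>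
    grind

theorem stdOr_ne (hR : SmallNeZero u) {a b c : R} (h : stdOr u a b c) : a ≠ b ∧ b ≠ c ∧ a ≠ c := by
  obtain ⟨h1, h2, h3, h4, h5, h6⟩ := hR
  unfold stdOr at h
  grind

theorem triple_subset {α : Type*} [DecidableEq α] {a b c : α} {s : Finset α} :
    ({a, b, c} : Finset α) ⊆ s ↔ a ∈ s ∧ b ∈ s ∧ c ∈ s := by
  simp [Finset.insert_subset_iff]

variable [DecidableEq R]

theorem stdTorus_isTriangle (hR : SmallNeZero u) {a b c : R} :
    IsTriangle (stdTorus u) a b c ↔ stdOr u a b c ∨ stdOr u b a c := by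
  have key : ∀ a b c, stdOr u a b c → IsTriangle (stdTorus u) a b c := by
    intro a b c h
    obtain ⟨h1, h2, h3⟩ := stdOr_ne hR h
    refine ⟨h1, h2, h3, by simp, ?_⟩
    simp only [triple_subset, Finset.mem_insert, Finset.mem_singleton]
    rcases h with ⟨rfl, rfl⟩ | ⟨rfl, rfl⟩ | ⟨rfl, rfl⟩ | ⟨rfl, rfl⟩ | ⟨rfl, rfl⟩ | ⟨rfl, rfl⟩
    · exact ⟨a, by grind⟩
    · exact ⟨a, by grind⟩
    · exact ⟨a - u, by grind⟩
    · exact ⟨a - 3 * u, by grind⟩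
    · exact ⟨a - 3 * u, by grind⟩
    · exact ⟨a - 2 * u, by grind⟩
  constructor
  · rintro ⟨h1, h2, h3, -, i, h⟩
    simp only [triple_subset, Finset.mem_insert, Finset.mem_singleton] at h
    unfold stdOr
    rcases h with ⟨ha, hb, hc⟩ | ⟨ha, hb, hc⟩ <;> rcases ha with rfl | rfl | rfl <;>
      rcases hb with rfl | rfl | rfl <;> rcases hc with rfl | rfl | rfl <;> grind
  · rintro (h | h)
    · exact key a b c h
    · exact (key b a c h).swap

theorem stdTorus_isOrientation (hR : SmallNeZero u) : IsOrientation (stdTorus u) (stdOr u) where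
  triangle a b c h := (stdTorus_isTriangle hR).mpr (Or.inl h)
  rotate a b c h := stdOr_rotate h
  exactly_one a b c h := by
    rcases (stdTorus_isTriangle hR).mp h with h | h
    · exact Or.inl ⟨h, fun h' => stdOr_swap hR h h'⟩
    · exact Or.inr ⟨h, fun h' => stdOr_swap hR h h'⟩
  coherent a b c d h h' := stdOr_unique hR h h'

theorem stdTorus_adj (hR : SmallNeZero u) {a b : R} : Adj (stdTorus u) a b ↔
    b = a + u ∨ b = a + 2 * u ∨ b = a + 3 * u ∨ b = a - u ∨ b = a - 2 * u ∨ b = a - 3 * u := by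
  obtain ⟨h1, h2, h3, -, -, -⟩ := id hR
  constructor
  · rintro ⟨hne, -, i, h⟩
    simp only [Finset.insert_subset_iff, Finset.singleton_subset_iff, Finset.mem_insert,
      Finset.mem_singleton] at h
    rcases h with ⟨ha, hb⟩ | ⟨ha, hb⟩ <;> rcases ha with rfl | rfl | rfl <;>
      rcases hb with rfl | rfl | rfl <;> grind
  · have key : ∀ c, stdOr u a b c → Adj (stdTorus u) a b := fun c h =>
      ((stdTorus_isOrientation hR).tri h).adj
    rintro (h | h | h | h | h | h)
    · exact key (a + 3 * u) (by simp [stdOr, h])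
    · exact key (a - u) (by simp [stdOr, h])
    · exact key (a + 2 * u) (by simp [stdOr, h])
    · exact key (a - 3 * u) (by simp [stdOr, h])
    · exact key (a + u) (by simp [stdOr, h])
    · exact key (a - 2 * u) (by simp [stdOr, h])

theorem stdTorus_exists_left (hR : SmallNeZero u) {a b : R} (h : Adj (stdTorus u) a b) :
    ∃ c, stdOr u a b c := by
  rcases (stdTorus_adj hR).mp h with h | h | h | h | h | h
  · exact ⟨a + 3 * u, by simp [stdOr, h]⟩
  · exact ⟨a - u, by simp [stdOr, h]⟩
  · exact ⟨a + 2 * u, by simp [stdOr, h]⟩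
  · exact ⟨a - 3 * u, by simp [stdOr, h]⟩
  · exact ⟨a + u, by simp [stdOr, h]⟩
  · exact ⟨a - 2 * u, by simp [stdOr, h]⟩

end

section
variable {R : Type*} [CommRing R] [DecidableEq R] {u : R}

theorem ncard_range {α β : Type*} {f : α → β} (hf : Function.Injective f) :
    (Set.range f).ncard = Nat.card α := by
  rw [← Set.image_univ, Set.ncard_image_of_injective _ hf, Set.ncard_univ]

theorem stdTorus_edge_range (hR : SmallNeZero u) :
    {s ∈ (stdTorus u).faces | s.card = 2} =
      Set.range (fun p : R × Fin 3 => ({p.1, p.1 + ((p.2 : ℕ) + 1) * u} : Finset R)) := by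
  ext e
  constructor
  · rintro ⟨he, h2⟩
    obtain ⟨a, b, hab, rfl⟩ := Finset.card_eq_two.mp h2
    rcases (stdTorus_adj hR).mp ⟨hab, he⟩ with rfl | rfl | rfl | rfl | rfl | rfl
    · exact ⟨(a, 0), by simp⟩
    · exact ⟨(a, 1), by norm_num⟩
    · exact ⟨(a, 2), by norm_num⟩
    · exact ⟨(a - u, 0), by simp [Finset.pair_comm]⟩
    · exact ⟨(a - 2 * u, 1), by rw [Finset.pair_comm]; norm_num⟩
    · exact ⟨(a - 3 * u, 2), by rw [Finset.pair_comm]; norm_num⟩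
  · rintro ⟨⟨a, i⟩, rfl⟩
    have : Adj (stdTorus u) a (a + ((i : ℕ) + 1) * u) := by
      rw [stdTorus_adj hR]
      fin_cases i
      · simp
      · norm_num
      · norm_num
    exact ⟨this.2, Finset.card_pair this.1⟩

theorem stdTorus_edge_injective (hR : SmallNeZero u) : Function.Injective
    (fun p : R × Fin 3 => ({p.1, p.1 + ((p.2 : ℕ) + 1) * u} : Finset R)) := by
  obtain ⟨h1, h2, h3, h4, h5, h6⟩ := hR
  rintro ⟨i, p⟩ ⟨j, q⟩ h
  have : i = j ∧ p = q := by
    rcases pair_eq h with ⟨e1, e2⟩ | ⟨e1, e2⟩ <;> fin_cases p <;> fin_cases q <;>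
      norm_num at e1 e2 ⊢ <;>
      first
      | grind
      | exact absurd (by linear_combination e2 - e1) h5
  rw [this.1, this.2]

theorem stdTorus_triangle_range (hR : SmallNeZero u) :
    {s ∈ (stdTorus u).faces | s.card = 3} =
      Set.range (fun p : R × Fin 2 =>
        ({p.1, p.1 + ((p.2 : ℕ) + 1) * u, p.1 + 3 * u} : Finset R)) := by
  ext t
  constructor
  · rintro ⟨⟨-, i, h | h⟩, h3⟩
    · have := Finset.eq_of_subset_of_card_le h (by rw [h3]; exact Finset.card_le_three)
      exact ⟨(i, 0), by simp [this]⟩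
    · have := Finset.eq_of_subset_of_card_le h (by rw [h3]; exact Finset.card_le_three)
      exact ⟨(i, 1), by rw [this]; norm_num⟩
  · rintro ⟨⟨i, p⟩, rfl⟩
    have : IsTriangle (stdTorus u) i (i + ((p : ℕ) + 1) * u) (i + 3 * u) := by
      rw [stdTorus_isTriangle hR]
      fin_cases p
      · simp [stdOr]
      · refine Or.inr (stdOr_rotate (stdOr_rotate (Or.inr (Or.inl ?_))))
        norm_num
    exact ⟨this.2.2.2, Finset.card_eq_three.mpr ⟨_, _, _, this.1, this.2.2.1, this.2.1, rfl⟩⟩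

theorem stdTorus_triangle_injective (hR : SmallNeZero u) : Function.Injective
    (fun p : R × Fin 2 => ({p.1, p.1 + ((p.2 : ℕ) + 1) * u, p.1 + 3 * u} : Finset R)) := by
  obtain ⟨h1, h2, h3, h4, h5, h6⟩ := hR
  rintro ⟨i, p⟩ ⟨j, q⟩ h
  have hm := h.subset
  simp only [triple_subset, Finset.mem_insert, Finset.mem_singleton] at hm
  obtain ⟨m1, m2, m3⟩ := hm
  have : i = j ∧ p = q := by
    fin_cases p <;> fin_cases q <;> norm_num at m1 m2 m3 ⊢ <;>
      rcases m1 with m1 | m1 | m1 <;> rcases m2 with m2 | m2 | m2 <;>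
      rcases m3 with m3 | m3 | m3 <;>
      first
      | grind
      | exact absurd (by linear_combination m2 - m1) h5
      | exact absurd (by linear_combination m3 - m1) h5
  rw [this.1, this.2]

theorem stdTorus_euler (hR : SmallNeZero u) : eulerChar (stdTorus u).faces = 0 := by
  have h1 : {s ∈ (stdTorus u).faces | s.card = 1} = Set.range (fun v : R => ({v} : Finset R)) := by
    ext s
    constructor
    · rintro ⟨-, h1⟩
      obtain ⟨v, rfl⟩ := Finset.card_eq_one.mp h1
      exact ⟨v, rfl⟩
    · rintro ⟨v, rfl⟩
      exact ⟨(stdTorus u).singleton_mem v, Finset.card_singleton v⟩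
  rw [eulerChar, h1, stdTorus_edge_range hR, stdTorus_triangle_range hR,
    ncard_range Finset.singleton_injective, ncard_range (stdTorus_edge_injective hR),
    ncard_range (stdTorus_triangle_injective hR)]
  simp only [Nat.card_prod, Nat.card_eq_fintype_card, Fintype.card_fin]
  push_cast
  ring

theorem stdTorus_link (hR : SmallNeZero u) {v a b : R} (ha : Adj (stdTorus u) v a)
    (hb : Adj (stdTorus u) v b) : Relation.ReflTransGen (IsTriangle (stdTorus u) v) a b := by
  have step : ∀ x y, stdOr u v x y →
      Relation.ReflTransGen (IsTriangle (stdTorus u) v) x y := fun x y h =>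
    .single ((stdTorus_isTriangle hR).mpr (Or.inl h))
  have s1 := step (v + u) (v + 3 * u) (by simp [stdOr])
  have s2 := step (v + 3 * u) (v + 2 * u) (by simp [stdOr])
  have s3 := step (v + 2 * u) (v - u) (by simp [stdOr])
  have s4 := step (v - u) (v - 3 * u) (by simp [stdOr])
  have s5 := step (v - 3 * u) (v - 2 * u) (by simp [stdOr])
  have s6 := step (v - 2 * u) (v + u) (by simp [stdOr])
  have hto : Relation.ReflTransGen (IsTriangle (stdTorus u) v) a (v + u) := by
    rcases (stdTorus_adj hR).mp ha with rfl | rfl | rfl | rfl | rfl | rfl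
    · exact .refl
    · exact s3.trans (s4.trans (s5.trans s6))
    · exact s2.trans (s3.trans (s4.trans (s5.trans s6)))
    · exact s4.trans (s5.trans s6)
    · exact s6
    · exact s5.trans s6
  have hfrom : Relation.ReflTransGen (IsTriangle (stdTorus u) v) (v + u) b := by
    rcases (stdTorus_adj hR).mp hb with rfl | rfl | rfl | rfl | rfl | rfl
    · exact .refl
    · exact s1.trans s2
    · exact s1
    · exact s1.trans (s2.trans s3)
    · exact s1.trans (s2.trans (s3.trans (s4.trans s5)))
    · exact s1.trans (s2.trans (s3.trans s4))
  exact hto.trans hfrom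

theorem stdTorus_edge (hR : SmallNeZero u) {e : Finset R} (he : e ∈ (stdTorus u).faces)
    (h2 : e.card = 2) : {t ∈ (stdTorus u).faces | e ⊆ t ∧ t.card = 3}.ncard = 2 := by
  obtain ⟨a, b, hab, rfl⟩ := Finset.card_eq_two.mp h2
  have hadj : Adj (stdTorus u) a b := ⟨hab, he⟩
  have hO := stdTorus_isOrientation hR
  obtain ⟨c, hc⟩ := stdTorus_exists_left hR hadj
  obtain ⟨d, hd⟩ := stdTorus_exists_left hR hadj.symm
  have htc := hO.tri hc
  have htd := (hO.tri hd).swap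
  have hcd : c ≠ d := by rintro rfl; exact hO.not_both hc hd
  have mem : ∀ x, IsTriangle (stdTorus u) a b x →
      ({a, b, x} : Finset R) ∈ {t ∈ (stdTorus u).faces | {a, b} ⊆ t ∧ t.card = 3} := fun x ht =>
    ⟨ht.2.2.2, pair_subset (by simp) (by simp),
      Finset.card_eq_three.mpr ⟨a, b, x, ht.1, ht.2.2.1, ht.2.1, rfl⟩⟩
  rw [Set.ncard_eq_two]
  refine ⟨{a, b, c}, {a, b, d}, fun h => ?_, ?_⟩
  · have : c ∈ ({a, b, d} : Finset R) := by rw [← h]; simp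
    simp only [Finset.mem_insert, Finset.mem_singleton] at this
    rcases this with rfl | rfl | rfl
    · exact htc.2.2.1 rfl
    · exact htc.2.1 rfl
    · exact hcd rfl
  · ext t
    constructor
    · rintro ⟨ht, hs, h3⟩
      obtain ⟨x, hxa, hxb, rfl⟩ := exists_third hab hs h3
      rcases hO.or (⟨hab, hxb.symm, hxa.symm, ht⟩ : IsTriangle (stdTorus u) a b x) with h | h
      · rw [hO.uniq h hc]; simp
      · rw [hO.uniq h hd]; simp
    · rintro (rfl | rfl)
      · exact mem c htc
      · exact mem d htd

theorem stdTorus_isTriangulatedTorus [Finite R] (hR : SmallNeZero u)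
    (hgen : ∀ a : R, ∃ m : ℕ, a = m * u) : IsTriangulatedTorus (stdTorus u) where
  finite := inferInstance
  nonempty := ⟨0⟩
  card_le := by
    rintro s ⟨-, i, h | h⟩ <;> exact (Finset.card_le_card h).trans Finset.card_le_three
  pure := by
    rintro s ⟨-, i, h | h⟩
    · have : ({i, i + u, i + 3 * u} : Finset R) ∈
          {s ∈ (stdTorus u).faces | s.card = 3} := by
        rw [stdTorus_triangle_range hR]; exact ⟨(i, 0), by simp⟩
      exact ⟨_, this.1, h, this.2⟩
    · have : ({i, i + 2 * u, i + 3 * u} : Finset R) ∈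
          {s ∈ (stdTorus u).faces | s.card = 3} := by
        rw [stdTorus_triangle_range hR]; exact ⟨(i, 1), by norm_num⟩
      exact ⟨_, this.1, h, this.2⟩
  edge _ he h2 := stdTorus_edge hR he h2
  link _ _ _ ha hb := stdTorus_link hR ha hb
  connected a b := by
    have key : ∀ m : ℕ, Relation.ReflTransGen (Adj (stdTorus u)) a (a + m * u) := by
      intro m
      induction m with
      | zero => simpa using Relation.ReflTransGen.refl
      | succ m ih =>
        refine ih.tail ((stdTorus_adj hR).mpr (Or.inl ?_))
        push_cast; ring
    obtain ⟨m, hm⟩ := hgen (b - a)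
    have := key m
    rwa [← hm, add_sub_cancel] at this
  orientable := ⟨_, stdTorus_isOrientation hR⟩
  euler := stdTorus_euler hR

end

/-! ### Short cycles of the standard torus -/

section
variable {R : Type*} [CommRing R] {u v : R}

/-- The image of the point `(p, q)` of the triangular lattice in the standard torus. -/
def gridPt (u v : R) (p q : ℤ) : R := v + (p + 2 * q) * u

theorem gridPt_right (p q : ℤ) : gridPt u v (p + 1) q = gridPt u v p q + u := by
  simp only [gridPt]; push_cast; ring

theorem gridPt_up (p q : ℤ) : gridPt u v p (q + 1) = gridPt u v p q + 2 * u := by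
  simp only [gridPt]; push_cast; ring

variable [DecidableEq R]

/-- A family of paths from `v` to the points of the lattice, such that each path extended by an
edge of the lattice is homotopic to the path of the new end point. -/
structure IsGrid (u v : R) (N : ℤ → ℤ → List R) : Prop where
  zero : N 0 0 = [v, v]
  starts : ∀ p q, Starts (stdTorus u) (N p q) (gridPt u v p q)
  right : ∀ p q, PathHomotopic (stdTorus u) (gridPt u v (p + 1) q :: N p q) (N (p + 1) q)
  up : ∀ p q, PathHomotopic (stdTorus u) (gridPt u v p (q + 1) :: N p q) (N p (q + 1))

theorem stdTorus_mem {a b c : R} (i : R) (h : ({a, b, c} : Finset R) ⊆ {i, i + u, i + 3 * u} ∨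
    ({a, b, c} : Finset R) ⊆ {i, i + 2 * u, i + 3 * u}) : {a, b, c} ∈ (stdTorus u).faces :=
  ⟨by simp, i, h⟩

/-- The triangular lattice is simply connected. -/
theorem exists_isGrid (hR : SmallNeZero u) (v : R) : ∃ N, IsGrid u v N := by
  have adj_right : ∀ p q, Adj (stdTorus u) (gridPt u v p q) (gridPt u v (p + 1) q) :=
    fun p q => (stdTorus_adj hR).mpr (Or.inl (gridPt_right p q))
  have adj_up : ∀ p q, Adj (stdTorus u) (gridPt u v p q) (gridPt u v p (q + 1)) :=
    fun p q => (stdTorus_adj hR).mpr (Or.inr (Or.inl (gridPt_up p q)))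
  obtain ⟨row, r0, r1, r2⟩ := exists_ray (fun p => gridPt u v p 0) (fun p => adj_right p 0)
    (l₀ := [v, v]) ⟨v, [], by simp [gridPt], by simp [gridPt, (stdTorus u).singleton_mem]⟩
  choose N c0 c1 c2 using fun p => exists_ray (fun q => gridPt u v p q) (adj_up p) (r1 p)
  refine ⟨N, by rw [c0, r0], c1, fun p q => ?_, c2⟩
  have down : ∀ p q, PathHomotopic (stdTorus u) (gridPt u v p q :: N p (q + 1)) (N p q) :=
    fun p q => ((c2 p q).symm.cons _).trans ((c1 p q).backtrack (adj_up p q))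
  induction q using Int.induction_on with
  | zero => rw [c0, c0]; exact r2 p
  | succ q ih =>
    -- replace the path around the square by the path through the opposite corner
    have f1 : {gridPt u v (p + 1) (q + 1), gridPt u v p (q + 1), gridPt u v p q} ∈
        (stdTorus u).faces := by
      refine stdTorus_mem (gridPt u v p q) (Or.inr ?_)
      simp only [triple_subset, Finset.mem_insert, Finset.mem_singleton, gridPt_up, gridPt_right]
      grind
    have f2 : {gridPt u v (p + 1) (q + 1), gridPt u v (p + 1) q, gridPt u v p q} ∈
        (stdTorus u).faces := by
      refine stdTorus_mem (gridPt u v p q) (Or.inl ?_)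
      simp only [triple_subset, Finset.mem_insert, Finset.mem_singleton, gridPt_up, gridPt_right]
      grind
    exact ((c2 p q).symm.cons _).trans <| ((c1 p q).skip f1).trans <|
      ((c1 p q).skip f2).symm.trans <| (ih.cons _).trans (c2 (p + 1) q)
  | pred q ih =>
    obtain ⟨r, hr⟩ : ∃ r : ℤ, r = -q - 1 := ⟨_, rfl⟩
    have e : -(q : ℤ) = r + 1 := by omega
    rw [← hr]
    rw [e] at ih
    have f1 : {gridPt u v (p + 1) r, gridPt u v (p + 1) (r + 1), gridPt u v p r} ∈
        (stdTorus u).faces := by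
      refine stdTorus_mem (gridPt u v p r) (Or.inl ?_)
      simp only [triple_subset, Finset.mem_insert, Finset.mem_singleton, gridPt_up, gridPt_right]
      grind
    have f2 : {gridPt u v (p + 1) (r + 1), gridPt u v p r, gridPt u v p (r + 1)} ∈
        (stdTorus u).faces := by
      refine stdTorus_mem (gridPt u v p r) (Or.inr ?_)
      simp only [triple_subset, Finset.mem_insert, Finset.mem_singleton, gridPt_up, gridPt_right]
      grind
    exact ((down p r).symm.cons _).trans <|
      (((c1 p (r + 1)).cons (adj_up p r)).skip f1).symm.trans <|
      (((c1 p (r + 1)).skip f2).cons _).trans <| (ih.cons _).trans (down (p + 1) r)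

namespace IsGrid

variable {N : ℤ → ℤ → List R}

theorem left (h : IsGrid u v N) (hR : SmallNeZero u) (p q : ℤ) :
    PathHomotopic (stdTorus u) (gridPt u v p q :: N (p + 1) q) (N p q) :=
  ((h.right p q).symm.cons _).trans
    ((h.starts p q).backtrack ((stdTorus_adj hR).mpr (Or.inl (gridPt_right p q))))

theorem down (h : IsGrid u v N) (hR : SmallNeZero u) (p q : ℤ) :
    PathHomotopic (stdTorus u) (gridPt u v p q :: N p (q + 1)) (N p q) :=
  ((h.up p q).symm.cons _).trans
    ((h.starts p q).backtrack ((stdTorus_adj hR).mpr (Or.inr (Or.inl (gridPt_up p q)))))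

theorem diag (h : IsGrid u v N) (p q : ℤ) :
    PathHomotopic (stdTorus u) (gridPt u v (p + 1) (q + 1) :: N p q) (N (p + 1) (q + 1)) := by
  refine ((h.starts p q).skip (v := gridPt u v (p + 1) q) ?_).symm.trans
    (((h.right p q).cons _).trans (h.up (p + 1) q))
  refine stdTorus_mem (gridPt u v p q) (Or.inl ?_)
  simp only [triple_subset, Finset.mem_insert, Finset.mem_singleton, gridPt_up, gridPt_right]
  grind

/-- Every edge at the end point of one of the paths comes from an edge of the lattice. -/
theorem step (h : IsGrid u v N) (hR : SmallNeZero u) {p q : ℤ} {w : R}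
    (hw : Adj (stdTorus u) (gridPt u v p q) w) : ∃ p' q', w = gridPt u v p' q' ∧
      |p' + 2 * q'| ≤ |p + 2 * q| + 3 ∧ PathHomotopic (stdTorus u) (w :: N p q) (N p' q') := by
  have bd : ∀ a b : ℤ, |b - a| ≤ 3 → |b| ≤ |a| + 3 := fun a b hab => by
    have := abs_sub_abs_le_abs_sub b a
    omega
  have g : ∀ p q : ℤ, gridPt u v p q = v + (p + 2 * q) * u := fun _ _ => rfl
  rcases (stdTorus_adj hR).mp hw with rfl | rfl | rfl | rfl | rfl | rfl
  · refine ⟨p + 1, q, (gridPt_right p q).symm, bd _ _ ?_, ?_⟩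
    · ring_nf; norm_num
    · rw [← gridPt_right]; exact h.right p q
  · refine ⟨p, q + 1, (gridPt_up p q).symm, bd _ _ ?_, ?_⟩
    · ring_nf; norm_num
    · rw [← gridPt_up]; exact h.up p q
  · have e : gridPt u v p q + 3 * u = gridPt u v (p + 1) (q + 1) := by
      rw [gridPt_up, gridPt_right]; ring
    refine ⟨p + 1, q + 1, e, bd _ _ ?_, ?_⟩
    · ring_nf; norm_num
    · rw [e]; exact h.diag p q
  · have e : gridPt u v p q - u = gridPt u v (p - 1) q := by
      rw [g, g]; push_cast; ring
    refine ⟨p - 1, q, e, bd _ _ ?_, ?_⟩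
    · ring_nf; norm_num
    · rw [e]; simpa using h.left hR (p - 1) q
  · have e : gridPt u v p q - 2 * u = gridPt u v p (q - 1) := by
      rw [g, g]; push_cast; ring
    refine ⟨p, q - 1, e, bd _ _ ?_, ?_⟩
    · ring_nf; norm_num
    · rw [e]; simpa using h.down hR p (q - 1)
  · have e : gridPt u v p q - 3 * u = gridPt u v (p - 1) (q - 1) := by
      rw [g, g]; push_cast; ring
    refine ⟨p - 1, q - 1, e, bd _ _ ?_, ?_⟩
    · ring_nf; norm_num
    · rw [e]
      have h1 := h.diag (p - 1) (q - 1)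
      simp only [sub_add_cancel] at h1
      refine (h1.symm.cons _).trans ((h.starts (p - 1) (q - 1)).backtrack ?_)
      rw [stdTorus_adj hR, g, g]
      right; right; left
      push_cast; ring

/-- Every path is homotopic to one of the paths of the grid. -/
theorem exists_path (h : IsGrid u v N) (hR : SmallNeZero u) (l : List R) : ∀ w,
    List.IsChain (Adj (stdTorus u)) (w :: (l ++ [v])) → ∃ p q, w = gridPt u v p q ∧
      |p + 2 * q| ≤ 3 * (l.length + 1) ∧
      PathHomotopic (stdTorus u) (w :: (l ++ [v])) (N p q) := by
  induction l with
  | nil =>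
    intro w hw
    have hadj : Adj (stdTorus u) w v := by simpa using hw
    obtain ⟨p, q, h1, h2, h3⟩ := h.step hR (p := 0) (q := 0) (w := w)
      (by simpa [gridPt] using hadj.symm)
    refine ⟨p, q, h1, by simpa using h2, ?_⟩
    rw [h.zero] at h3
    exact (PathHomotopic.skip [] (by simpa using hadj.2)).symm.trans h3
  | cons x l ih =>
    intro w hw
    rw [List.cons_append, List.isChain_cons_cons] at hw
    obtain ⟨p, q, h1, h2, h3⟩ := ih x hw.2
    subst h1
    obtain ⟨p', q', h4, h5, h6⟩ := h.step hR hw.1.symm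
    refine ⟨p', q', h4, ?_, (h3.cons w).trans h6⟩
    rw [List.length_cons]
    push_cast
    omega

end IsGrid

/-- The path that winds `m` times around the triangle `v`, `a`, `b`. -/
def wind (v a b : R) : ℕ → List R
  | 0 => [v, v]
  | m + 1 => v :: a :: b :: wind v a b m

theorem wind_eq_cons (v a b : R) (m : ℕ) : ∃ t, wind v a b m = v :: t := by
  cases m <;> exact ⟨_, rfl⟩

theorem cycleSum_wind (x y v a b : R) (m : ℕ) :
    (m : ℤ) ∣ cycleSum (pairInd x y) (wind v a b m : Cycle R) := by
  have key : ∀ t, wind v a b m = v :: t → pathSum (pairInd x y) v (t ++ [v]) =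
      m * (pairInd x y v a + pairInd x y a b + pairInd x y b v) := by
    induction m with
    | zero =>
      rintro t ht
      obtain rfl : [v] = t := (List.cons.inj ht).2
      simp [pathSum, pairInd_self]
    | succ m ih =>
      rintro t ht
      obtain rfl : a :: b :: wind v a b m = t := (List.cons.inj ht).2
      obtain ⟨s, hs⟩ := wind_eq_cons v a b m
      have := ih s hs
      rw [hs]
      simp only [List.cons_append, pathSum] at this ⊢
      rw [this]
      push_cast; ring
  obtain ⟨t, ht⟩ := wind_eq_cons v a b m
  have := key t ht
  rw [ht, cycleSum_coe, listSum, this]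
  exact dvd_mul_right _ _

theorem eqvGen_wind_one {a b : R} (h : Adj (stdTorus u) v a) :
    Relation.EqvGen (HomotopyStep (stdTorus u)) (wind v a b 1 : Cycle R)
      ([v, a, b] : List R) := by
  have e : (wind v a b 1 : Cycle R) = ([v, v, v, a, b] : List R) :=
    Cycle.coe_eq_coe.mpr ⟨3, rfl⟩
  rw [e]
  exact .trans _ _ _ (.rel _ _ (.skip v v v [a, b] (by simp [(stdTorus u).singleton_mem])))
    (.rel _ _ (.skip v v a [b] (by simpa using h.2)))

theorem IsGrid.wind_pos {N : ℤ → ℤ → List R} (h : IsGrid u v N) (hR : SmallNeZero u) (m : ℕ) :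
    PathHomotopic (stdTorus u) (wind v (v + u) (v + 2 * u) m) (N (-(2 * m)) m) := by
  induction m with
  | zero => simp only [wind, Nat.cast_zero, mul_zero, neg_zero, h.zero]; exact .refl _
  | succ m ih =>
    have h1 := h.up (-(2 * m)) m
    have h2 := h.left hR (-(2 * m) - 1) (m + 1)
    have h3 := h.left hR (-(2 * m) - 2) (m + 1)
    have e1 : gridPt u v (-(2 * m)) (m + 1) = v + 2 * u := by simp only [gridPt]; push_cast; ring
    have e2 : gridPt u v (-(2 * m) - 1) (m + 1) = v + u := by simp only [gridPt]; push_cast; ring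
    have e3 : gridPt u v (-(2 * m) - 2) (m + 1) = v := by simp only [gridPt]; push_cast; ring
    have e4 : -(2 * (m : ℤ)) - 2 + 1 = -(2 * m) - 1 := by ring
    have e5 : -(2 * ((m + 1 : ℕ) : ℤ)) = -(2 * m) - 2 := by push_cast; ring
    rw [e1] at h1
    rw [e2, sub_add_cancel] at h2
    rw [e3, e4] at h3
    rw [e5, Nat.cast_succ]
    exact ((((ih.cons _).trans h1).cons _).trans h2 |>.cons _).trans h3

theorem IsGrid.wind_neg {N : ℤ → ℤ → List R} (h : IsGrid u v N) (hR : SmallNeZero u) (m : ℕ) :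
    PathHomotopic (stdTorus u) (wind v (v + 2 * u) (v + u) m) (N (2 * m) (-m)) := by
  induction m with
  | zero => simp only [wind, Nat.cast_zero, mul_zero, neg_zero, h.zero]; exact .refl _
  | succ m ih =>
    have h1 := h.right (2 * m) (-m)
    have h2 := h.right (2 * m + 1) (-m)
    have h3 := h.down hR (2 * m + 2) (-m - 1)
    have e1 : gridPt u v (2 * m + 1) (-m) = v + u := by simp only [gridPt]; push_cast; ring
    have e2 : gridPt u v (2 * m + 2) (-m) = v + 2 * u := by simp only [gridPt]; push_cast; ring
    have e3 : gridPt u v (2 * m + 2) (-m - 1) = v := by simp only [gridPt]; push_cast; ring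
    have e4 : 2 * (m : ℤ) + 1 + 1 = 2 * m + 2 := by ring
    have e5 : 2 * ((m + 1 : ℕ) : ℤ) = 2 * m + 2 := by push_cast; ring
    have e6 : -((m + 1 : ℕ) : ℤ) = -m - 1 := by push_cast; ring
    rw [e1] at h1
    rw [e4, e2] at h2
    rw [e3, sub_add_cancel] at h3
    rw [e5, e6]
    exact ((((ih.cons _).trans h1).cons _).trans h2 |>.cons _).trans h3

theorem eqvGen_translate (u v : R) : Relation.EqvGen (HomotopyStep (stdTorus u))
    ([v, v + u, v + 2 * u] : List R) ([v + u, v + u + u, v + u + 2 * u] : List R) := by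
  have e1 : (([v, v + u, v + 2 * u] : List R) : Cycle R) = ([v + 2 * u, v, v + u] : List R) :=
    Cycle.coe_eq_coe.mpr ⟨2, rfl⟩
  have e2 : (([v + 2 * u, v + 3 * u, v, v + u] : List R) : Cycle R) =
      ([v + 3 * u, v, v + u, v + 2 * u] : List R) := Cycle.coe_eq_coe.mpr ⟨1, rfl⟩
  have e3 : (([v + u, v + u + u, v + u + 2 * u] : List R) : Cycle R) =
      ([v + 3 * u, v + u, v + 2 * u] : List R) := by
    have a1 : v + u + u = v + 2 * u := by ring
    have a2 : v + u + 2 * u = v + 3 * u := by ring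
    rw [a1, a2]
    exact Cycle.coe_eq_coe.mpr ⟨2, rfl⟩
  rw [e1, e3]
  refine .trans _ _ _ (.symm _ _ (.rel _ _ (.skip (v + 2 * u) (v + 3 * u) v [v + u] ?_))) ?_
  · exact stdTorus_mem v (Or.inr (by simp [triple_subset]))
  rw [e2]
  exact .rel _ _ (.skip _ _ _ _ (stdTorus_mem v (Or.inl (by simp [triple_subset]))))

theorem homotopic_translate (hgen : ∀ a : R, ∃ m : ℕ, a = m * u) (v : R) :
    Relation.EqvGen (HomotopyStep (stdTorus u)) ([0, u, 2 * u] : List R)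
      ([v, v + u, v + 2 * u] : List R) := by
  obtain ⟨m, rfl⟩ := hgen v
  induction m with
  | zero => simpa using Relation.EqvGen.refl _
  | succ m ih =>
    refine .trans _ _ _ ih ?_
    have := eqvGen_translate u (m * u)
    have e : ((m + 1 : ℕ) : R) * u = m * u + u := by push_cast; ring
    rwa [e]

end

/-! ### The type of the standard torus -/

section
variable {R : Type*} [CommRing R] [DecidableEq R] {u : R}

/-- The cocycle of the standard torus with value `α` on the edges from `i` to `i + u` and `β` on
the edges from `i` to `i + 2u`. -/
def stdCocycle (u : R) (α β : ℤ) (a b : R) : ℤ :=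
  ((if b = a + u then α else 0) + (if b = a + 2 * u then β else 0) +
    (if b = a + 3 * u then α + β else 0)) -
  ((if a = b + u then α else 0) + (if a = b + 2 * u then β else 0) +
    (if a = b + 3 * u then α + β else 0))

theorem stdCocycle_antisymm (α β : ℤ) (a b : R) :
    stdCocycle u α β a b = - stdCocycle u α β b a := by
  simp only [stdCocycle]; ring

theorem stdCocycle_values (hR : SmallNeZero u) (α β : ℤ) {a b : R} :
    (b = a + u → stdCocycle u α β a b = α) ∧ (b = a + 2 * u → stdCocycle u α β a b = β) ∧
      (b = a + 3 * u → stdCocycle u α β a b = α + β) := by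
  obtain ⟨h1, h2, h3, h4, h5, h6⟩ := hR
  have ne : ∀ {x y z : R}, z ≠ 0 → x - y = z → x ≠ y := by
    rintro x y z hz h rfl
    exact hz (by rw [← h, sub_self])
  refine ⟨?_, ?_, ?_⟩ <;> rintro rfl <;> unfold stdCocycle
  · rw [if_pos rfl, if_neg (ne (neg_ne_zero.mpr h1) (by ring)),
      if_neg (ne (neg_ne_zero.mpr h2) (by ring)), if_neg (ne (neg_ne_zero.mpr h2) (by ring)),
      if_neg (ne (neg_ne_zero.mpr h3) (by ring)), if_neg (ne (neg_ne_zero.mpr h4) (by ring))]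
    ring
  · rw [if_pos rfl, if_neg (ne h1 (by ring)),
      if_neg (ne (neg_ne_zero.mpr h1) (by ring)), if_neg (ne (neg_ne_zero.mpr h3) (by ring)),
      if_neg (ne (neg_ne_zero.mpr h4) (by ring)), if_neg (ne (neg_ne_zero.mpr h5) (by ring))]
    ring
  · rw [if_pos rfl, if_neg (ne h2 (by ring)),
      if_neg (ne h1 (by ring)), if_neg (ne (neg_ne_zero.mpr h4) (by ring)),
      if_neg (ne (neg_ne_zero.mpr h5) (by ring)), if_neg (ne (neg_ne_zero.mpr h6) (by ring))]
    ring

theorem stdCocycle_isCocycle (hR : SmallNeZero u) (α β : ℤ) :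
    IsCocycle (stdTorus u) (stdCocycle u α β) := by
  have val := fun a b => stdCocycle_values hR α β (a := a) (b := b)
  have anti := stdCocycle_antisymm (u := u) α β
  have k1 : ∀ a b c : R, b = a + u → c = a + 3 * u → stdCocycle u α β a b +
      stdCocycle u α β b c + stdCocycle u α β c a = 0 := by
    intro a b c hb hc
    rw [anti c a, (val a b).1 hb, (val a c).2.2 hc, (val b c).2.1 (by rw [hb, hc]; ring)]
    ring
  have k2 : ∀ a b c : R, b = a + 3 * u → c = a + 2 * u → stdCocycle u α β a b +
      stdCocycle u α β b c + stdCocycle u α β c a = 0 := by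
    intro a b c hb hc
    rw [anti c a, anti b c, (val a b).2.2 hb, (val a c).2.1 hc,
      (val c b).1 (by rw [hb, hc]; ring)]
    ring
  have key : ∀ a b c : R, stdOr u a b c → stdCocycle u α β a b +
      stdCocycle u α β b c + stdCocycle u α β c a = 0 := by
    rintro a b c (⟨hb, hc⟩ | ⟨hb, hc⟩ | ⟨hb, hc⟩ | ⟨hb, hc⟩ | ⟨hb, hc⟩ | ⟨hb, hc⟩)
    · exact k1 a b c hb hc
    · exact k2 a b c hb hc
    · have := k1 c a b (by rw [hc]; ring) (by rw [hb, hc]; ring)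
      omega
    · have := k2 c a b (by rw [hc]; ring) (by rw [hb, hc]; ring)
      omega
    · have := k1 b c a (by rw [hb, hc]; ring) (by rw [hb]; ring)
      omega
    · have := k2 b c a (by rw [hb, hc]; ring) (by rw [hb]; ring)
      omega
  refine ⟨anti, fun a b c h => ?_⟩
  rcases (stdTorus_isTriangle hR).mp h with h | h
  · exact key a b c h
  · have := key b a c h
    rw [anti a b, anti b c, anti c a]
    omega

theorem cycleSum_base (hR : SmallNeZero u) (α β : ℤ) :
    cycleSum (stdCocycle u α β) ([0, u, 2 * u] : List R) = 2 * α - β := by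
  have val := fun a b => stdCocycle_values hR α β (a := a) (b := b)
  simp only [cycleSum_coe, listSum, List.cons_append, List.nil_append, pathSum]
  rw [(val 0 u).1 (by ring), (val u (2 * u)).1 (by ring), stdCocycle_antisymm α β (2 * u) 0,
    (val 0 (2 * u)).2.1 (by ring)]
  ring

theorem isCycle_base (hR : SmallNeZero u) : IsCycle (stdTorus u) ([0, u, 2 * u] : List R) := by
  have h1 := hR.1
  have h2 := hR.2.1
  have h3 : u ≠ 2 * u := fun h => h1 (by linear_combination -h)
  refine ⟨?_, by simp, ?_⟩
  · rw [Cycle.nodup_coe_iff]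
    simp [h1.symm, h2.symm, h3]
  · rw [Cycle.chain_coe_cons]
    simp only [List.cons_append, List.nil_append, List.isChain_cons_cons, List.isChain_singleton,
      and_true, stdTorus_adj hR]
    refine ⟨Or.inl (by ring), Or.inl (by ring), Or.inr (Or.inr (Or.inr (Or.inr (Or.inl ?_))))⟩
    ring

end

section
variable {n k : ℕ}

/-- In the standard torus all non-separating cycles of length less than `k` are homotopic: the lift
of such a cycle to the triangular lattice ends at a point `(-2 q, q)`, so that the cycle winds `q`
times around an empty triangle, and it bounds a disc unless `q` is `1` or `-1`. -/
theorem homotopic_base (hk : 3 ≤ k) (hn : n + 2 = 3 * k)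
    (hT : IsTriangulatedTorus (stdTorus (1 : ZMod n)))
    (hgen : ∀ a : ZMod n, ∃ m : ℕ, a = m * 1) {c : Cycle (ZMod n)}
    (hc : IsNonSeparating (stdTorus (1 : ZMod n)) c) (hlt : c.length < k) :
    Homotopic (stdTorus (1 : ZMod n)) ([0, 1, 2 * 1] : List (ZMod n)) c := by
  have hR := smallNeZero_zmod (n := n) (by omega)
  have hO := stdTorus_isOrientation hR
  obtain ⟨hcyc, hnd⟩ := hc
  induction c using Quotient.inductionOn with
  | h l =>
  change IsCycle _ (l : Cycle (ZMod n)) at hcyc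
  change ¬ BoundsDisc _ (l : Cycle (ZMod n)) at hnd
  change (l : Cycle (ZMod n)).length < k at hlt
  change Homotopic _ _ (l : Cycle (ZMod n))
  match l with
  | [] => exact absurd hcyc.2.1 (by simp)
  | [_] => exact absurd hcyc.2.1 (by simp)
  | v :: x :: l =>
    have hch := (Cycle.chain_coe_cons _ _ _).mp hcyc.2.2
    obtain ⟨N, hN⟩ := exists_isGrid hR v
    obtain ⟨p, q, h1, h2, h3⟩ := hN.exists_path hR (x :: l) v hch
    rw [Cycle.length_coe, List.length_cons] at hlt
    have h4 : p + 2 * q = 0 := by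
      have h5 : (((p + 2 * q : ℤ)) : ZMod n) = 0 := by
        simp only [gridPt, mul_one] at h1
        push_cast
        linear_combination -h1
      rw [ZMod.intCast_zmod_eq_zero_iff_dvd] at h5
      exact Int.eq_zero_of_abs_lt_dvd h5 (by omega)
    obtain rfl : p = -(2 * q) := by omega
    -- the cycle is homotopic to the closed path with its first vertex repeated
    have h6 : Relation.EqvGen (HomotopyStep (stdTorus (1 : ZMod n)))
        ((v :: x :: l : List (ZMod n)) : Cycle (ZMod n)) (N (-(2 * q)) q) := by
      refine .trans _ _ _ (.symm _ _ (.rel _ _ (.skip v v x l ?_))) ?_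
      · simpa using ((List.isChain_cons_cons.mp hch).1).2
      · have e : ((v :: v :: x :: l : List (ZMod n)) : Cycle (ZMod n)) =
            (v :: (x :: l ++ [v]) : List (ZMod n)) := Cycle.coe_eq_coe.mpr ⟨1, by simp⟩
        rw [e]
        exact h3.cycle
    -- winding once around the triangle
    have hbase := homotopic_translate hgen v
    have hq : ∀ m : ℕ, ∀ a b : ZMod n, Relation.EqvGen (HomotopyStep (stdTorus (1 : ZMod n)))
        ((v :: x :: l : List (ZMod n)) : Cycle (ZMod n)) (wind v a b m) → m = 1 := by
      intro m a b h
      by_contra hm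
      exact hnd (boundsDisc_of_dvd hT hO hcyc h hm fun y z => cycleSum_wind y z v a b m)
    have adj1 : Adj (stdTorus (1 : ZMod n)) v (v + 1) := (stdTorus_adj hR).mpr (Or.inl rfl)
    have adj2 : Adj (stdTorus (1 : ZMod n)) v (v + 2 * 1) :=
      (stdTorus_adj hR).mpr (Or.inr (Or.inl rfl))
    obtain ⟨m, rfl | rfl⟩ := q.eq_nat_or_neg
    · have h7 := Relation.EqvGen.trans _ _ _ h6 (hN.wind_pos hR m).cycle.symm
      obtain rfl := hq m _ _ h7
      exact Or.inl (hbase.trans _ _ _ (h7.trans _ _ _ (eqvGen_wind_one adj1)).symm)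
    · rw [mul_neg, neg_neg] at h6
      have h7 := Relation.EqvGen.trans _ _ _ h6 (hN.wind_neg hR m).cycle.symm
      obtain rfl := hq m _ _ h7
      have h8 := eqvGen_reverse (h7.trans _ _ _ (eqvGen_wind_one adj2))
      have e : (([v, v + 2 * 1, v + 1] : List (ZMod n)) : Cycle (ZMod n)).reverse =
          ([v, v + 1, v + 2 * 1] : List (ZMod n)) :=
        Cycle.coe_eq_coe.mpr ⟨2, rfl⟩
      rw [e] at h8
      exact Or.inr (hbase.trans _ _ _ h8.symm)

theorem stdTorus_hasType (hk : 3 ≤ k) (hn : n + 2 = 3 * k) :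
    IsTriangulatedTorus (stdTorus (1 : ZMod n)) ∧ HasType (stdTorus (1 : ZMod n)) 3 k := by
  have : NeZero n := ⟨by omega⟩
  have hR := smallNeZero_zmod (n := n) (by omega)
  have hgen : ∀ a : ZMod n, ∃ m : ℕ, a = m * 1 := fun a => ⟨a.val, by simp⟩
  have hT := stdTorus_isTriangulatedTorus hR hgen
  have hbase : IsNonSeparating (stdTorus (1 : ZMod n)) ([0, 1, 2 * 1] : List (ZMod n)) := by
    refine ⟨isCycle_base hR, fun hd => ?_⟩
    have h1 := hd.cycleSum_eq_zero hT (isCycle_base hR) (stdCocycle_isCocycle hR 1 0)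
    rw [cycleSum_base hR] at h1
    omega
  -- a cycle of length at most `k` that winds around in the other direction
  obtain ⟨c, hc, hck, hcs⟩ : ∃ c, IsCycle (stdTorus (1 : ZMod n)) c ∧ c.length ≤ k ∧
      cycleSum (stdCocycle (1 : ZMod n) 1 2) c ≠ 0 := by
    have val := fun a b => stdCocycle_values hR 1 2 (a := a) (b := b)
    have hw : ∀ m : ℕ, WalkSum (stdTorus (1 : ZMod n)) (stdCocycle 1 1 2) 0
        (3 * m : ZMod n) m (3 * m) := by
      intro m
      induction m with
      | zero => simpa using WalkSum.nil _
      | succ m ih =>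
        have hadj : (3 * (m + 1 : ℕ) : ZMod n) = 3 * m + 3 * 1 := by push_cast; ring
        have := ih.snoc ((stdTorus_adj hR).mpr (Or.inr (Or.inr (Or.inl hadj))))
        rw [(val _ _).2.2 hadj] at this
        convert this using 1
        push_cast; ring
    have hlast : (0 : ZMod n) = 3 * ((k - 1 : ℕ) : ZMod n) + 1 := by
      have h0 : ((3 * (k - 1) + 1 : ℕ) : ZMod n) = 0 :=
        (ZMod.natCast_eq_zero_iff _ _).mpr ⟨1, by omega⟩
      push_cast at h0
      exact h0.symm
    have h1 := (hw (k - 1)).snoc ((stdTorus_adj hR).mpr (Or.inl hlast))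
    rw [(val _ _).1 hlast] at h1
    obtain ⟨c, h2, h3, h4⟩ := h1.exists_isCycle (stdCocycle_antisymm 1 2) (by omega)
    exact ⟨c, h2, by omega, h4⟩
  have hcn : IsNonSeparating (stdTorus (1 : ZMod n)) c :=
    ⟨hc, fun hd => hcs (hd.cycleSum_eq_zero hT hc (stdCocycle_isCocycle hR 1 2))⟩
  have hch : ¬ Homotopic (stdTorus (1 : ZMod n)) ([0, 1, 2 * 1] : List (ZMod n)) c := fun h =>
    hcs (cycleSum_homotopic (stdCocycle_isCocycle hR 1 2) h (by rw [cycleSum_base hR]; norm_num))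
  have hlow : ∀ d, IsNonSeparating (stdTorus (1 : ZMod n)) d →
      ¬ Homotopic (stdTorus (1 : ZMod n)) ([0, 1, 2 * 1] : List (ZMod n)) d → k ≤ d.length := by
    intro d hd hdh
    by_contra hlt
    exact hdh (homotopic_base hk hn hT hgen hd (by omega))
  refine ⟨hT, ⟨⟨_, hbase, rfl⟩, ?_⟩, ⟨_, hbase, ⟨c, hcn, hch, ?_⟩, ?_⟩, ?_⟩
  · rintro l ⟨d, hd, rfl⟩
    exact hd.1.2.1
  · exact le_antisymm hck (hlow c hcn hch)
  · rintro l ⟨d, hd, hdh, rfl⟩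
    exact hlow d hd hdh
  · rintro j ⟨M, hM, hj⟩
    by_cases hMb : Homotopic (stdTorus (1 : ZMod n)) ([0, 1, 2 * 1] : List (ZMod n)) M
    · exact (hj.2 ⟨c, hcn, fun h => hch (hMb.trans h), rfl⟩).trans hck
    · refine (hj.2 ⟨_, hbase, fun h => hMb h.symm, rfl⟩).trans ?_
      exact hk

end

/-! ### Uniqueness -/

section
variable {R : Type*} [CommRing R] [DecidableEq R] {u : R}

/-- A bijection that maps the triangles of the standard torus to triangles of `K` is an
isomorphism, since the image has no boundary. -/
theorem isomorphic_of_equiv (hR : SmallNeZero u) (hK : IsTriangulatedTorus K) (e : R ≃ V)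
    (he : ∀ i, IsTriangle K (e i) (e (i + 3 * u)) (e (i + u)) ∧
      IsTriangle K (e i) (e (i + 3 * u)) (e (i + 2 * u))) : Isomorphic (stdTorus u) K := by
  obtain ⟨O, hO⟩ := hK.orientable
  have hS := stdTorus_isOrientation hR
  have hmap : ∀ s ∈ (stdTorus u).faces, s.map e.toEmbedding ∈ K.faces := by
    rintro s ⟨hne, i, h | h⟩
    · refine faces_of_subset (he i).1.2.2.2 ?_ (hne.map)
      intro x hx
      obtain ⟨y, hy, rfl⟩ := Finset.mem_map.mp hx
      have := h hy
      simp only [Finset.mem_insert, Finset.mem_singleton] at this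
      rcases this with rfl | rfl | rfl <;> simp
    · refine faces_of_subset (he i).2.2.2.2 ?_ (hne.map)
      intro x hx
      obtain ⟨y, hy, rfl⟩ := Finset.mem_map.mp hx
      have := h hy
      simp only [Finset.mem_insert, Finset.mem_singleton] at this
      rcases this with rfl | rfl | rfl <;> simp
  have htri : ∀ a b c, IsTriangle (stdTorus u) a b c → IsTriangle K (e a) (e b) (e c) := by
    intro a b c h
    refine ⟨fun h' => h.1 (e.injective h'), fun h' => h.2.1 (e.injective h'),
      fun h' => h.2.2.1 (e.injective h'), ?_⟩
    simpa [Finset.map_insert] using hmap _ h.2.2.2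
  -- the set of triangles in the image
  let D : Set (Finset V) :=
    {t | ∃ a b c, IsTriangle (stdTorus u) a b c ∧ t = {e a, e b, e c}}
  have hleft : ∀ a b, Adj (stdTorus u) a b → Lft O D (e a) (e b) := by
    intro a b hadj
    -- of the two triangles at the edge, one lies on the left of its image
    obtain ⟨c, hc⟩ := stdTorus_exists_left hR hadj
    obtain ⟨d, hd⟩ := stdTorus_exists_left hR hadj.symm
    have hcd : c ≠ d := by rintro rfl; exact hS.not_both hc hd
    have tc := hS.tri hc
    have td := (hS.tri hd).swap
    rcases hO.or (htri _ _ _ tc) with h1 | h1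
    · exact ⟨e c, h1, a, b, c, tc, rfl⟩
    rcases hO.or (htri _ _ _ td) with h2 | h2
    · exact ⟨e d, h2, a, b, d, td, rfl⟩
    exact absurd (e.injective (hO.uniq h1 h2)) hcd
  have hadjD : ∀ x y, Lft O D x y → Adj (stdTorus u) (e.symm x) (e.symm y) := by
    rintro x y ⟨z, hz, a, b, c, ht, heq⟩
    have hne : e.symm x ≠ e.symm y := fun h => (hO.tri hz).1 (e.symm.injective h)
    refine ⟨hne, faces_of_subset ht.2.2.2 ?_ (by simp)⟩
    have key : ∀ w ∈ ({x, y, z} : Finset V), e.symm w ∈ ({a, b, c} : Finset R) := by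
      intro w hw
      rw [heq] at hw
      simp only [Finset.mem_insert, Finset.mem_singleton] at hw ⊢
      rcases hw with rfl | rfl | rfl <;> simp
    exact pair_subset (key x (by simp)) (key y (by simp))
  have hbd : ∀ x y, ¬ Bd O D x y := by
    rintro x y ⟨h1, h2⟩
    have := hleft _ _ (hadjD x y h1).symm
    rw [e.apply_symm_apply, e.apply_symm_apply] at this
    exact h2 this
  have hall := lft_of_no_boundary hK hO hbd (hleft 0 (0 + u) ((stdTorus_adj hR).mpr (Or.inl rfl)))
  refine ⟨e, fun s => ⟨hmap s, fun hs => ?_⟩⟩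
  obtain ⟨t, ht, hst, h3⟩ := hK.pure _ hs
  obtain ⟨x, y, z, hxy, hxz, hyz, rfl⟩ := Finset.card_eq_three.mp h3
  have hT : IsTriangle K x y z := ⟨hxy, hyz, hxz, ht⟩
  have hD : ({x, y, z} : Finset V) ∈ D := by
    rcases hO.or hT with h | h
    · obtain ⟨w, hw, hwD⟩ := hall x y hT.adj
      rwa [hO.uniq hw h] at hwD
    · obtain ⟨w, hw, hwD⟩ := hall y x hT.adj.symm
      rw [hO.uniq hw h, triple_swap] at hwD
      exact hwD
  obtain ⟨a, b, c, htri', heq⟩ := hD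
  rw [heq] at hst
  refine faces_of_subset htri'.2.2.2 ?_ ?_
  · intro i hi
    have := hst (Finset.mem_map_of_mem e.toEmbedding hi)
    simpa using this
  · rw [← Finset.map_nonempty (f := e.toEmbedding)]
    exact Finset.card_pos.mp (by
      by_contra h0
      have h1 : s.map e.toEmbedding = ∅ := Finset.card_eq_zero.mp (by omega)
      rw [h1] at hs
      exact (Finset.not_nonempty_empty) ((K.isRelLowerSet_faces hs).1))

end

theorem HasType.le_card {k : ℕ} (hK : IsTriangulatedTorus K) (h : HasType K 3 k) :
    3 * k ≤ Nat.card V + 2 := by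
  obtain ⟨hk, a, b, c, η, hab, hbc, hac, hcut, hco, hlb⟩ := h.exists_isCut hK
  exact IsCutTriple.le_card hK (⟨hab, hbc, hac, hcut, hco, hlb⟩ : IsCutTriple K k η a b c) hk

theorem HasType.isomorphic {k : ℕ} (hk : 3 ≤ k) (hK : IsTriangulatedTorus K) (h : HasType K 3 k)
    (hn : Nat.card V = 3 * k - 2) : Isomorphic (stdTorus (1 : ZMod (3 * k - 2))) K := by
  obtain ⟨e, he⟩ := h.exists_equiv hK hn
  exact isomorphic_of_equiv (smallNeZero_zmod (by omega)) hK e fun i => by simpa using he i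

end TorusTriangulation

theorem mainTheorem2 (k : ℕ) :
    (∀ (V : Type*) [DecidableEq V] (K : AbstractSimplicialComplex V),
      TorusTriangulation.IsTriangulatedTorus K → TorusTriangulation.HasType K 3 k →
        3 * k ≤ Nat.card V + 2) ∧
    (3 ≤ k →
      ∃ T : AbstractSimplicialComplex (Fin (3 * k - 2)),
        TorusTriangulation.IsTriangulatedTorus T ∧ TorusTriangulation.HasType T 3 k ∧
        ∀ (V : Type*) [DecidableEq V] (K : AbstractSimplicialComplex V),
          TorusTriangulation.IsTriangulatedTorus K → TorusTriangulation.HasType K 3 k →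
            Nat.card V = 3 * k - 2 → TorusTriangulation.Isomorphic T K) := by
  refine ⟨fun V _ K hK h => h.le_card hK, fun hk => ?_⟩
  have h1 := TorusTriangulation.stdTorus_hasType (n := 3 * k - 2) hk (by omega)
  have h2 := fun (V : Type _) [DecidableEq V] (K : AbstractSimplicialComplex V)
    (hK : TorusTriangulation.IsTriangulatedTorus K) (h : TorusTriangulation.HasType K 3 k)
    (hn : Nat.card V = 3 * k - 2) => h.isomorphic hk hK hn
  -- `ZMod n` is `Fin n` for positive `n`
  generalize hn : 3 * k - 2 = n at h1 h2
  obtain _ | n := n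
  · omega
  exact ⟨_, h1.1, h1.2, h2⟩
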